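/- For a vertex $v$ of a finite simple graph $G=(V,E)$ let $N(v)$ be its set of neighbors and $\deg v=|N(v)|$; for nonempty $K\subseteq V$ let $\Delta(K)=\max_{v\in K}\deg v$ (degrees in $G$). For constants $\eta_0,\varepsilon>0$, an \emph{$\varepsilon$-sparse-dense decomposition} of $G$ (with parameter $\eta_0$) is a partition $V=V_{\mathrm{sparse}}\sqcup K_1\sqcup\dots\sqcup K_m$ (with $m\ge 0$ and nonempty $K_i$) such that: - every $v\in V_{\mathrm{sparse}}$ has at least $\eta_0\varepsilon\deg v$ neighbors $u$ with $|N(v)\,\triangle\,N(u)|\ge \eta_0\varepsilon\max\{\deg u,\deg v\}$; - every $K_i$ is an almost-clique: each $v\in K_i$ has at most $\varepsilon\Delta(K_i)$ non-neighbors in $K_i\setminus\{v\}$ and at most $\varepsilon\Delta(K_i)$ neighbors outside $K_i$, and $(1-\varepsilon)\Delta(K_i)\le|K_i|\le(1+\varepsilon)\Delta(K_i)$. **Theorem.** There are absolute constants $\eta_0,\varepsilon_0>0$ such that the following holds for every $0<\varepsilon<\varepsilon_0$. 1. Every finite simple graph has an $\varepsilon$-sparse-dense decomposition (with parameter $\eta_0$).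 2. Such a decomposition can be recovered from samples, with high probability, in time $O(n\log^2 n)$. Precisely: for every integer $k\ge 0$ there is a constant $c>0$, depending only on $k$, such that for every $0<\varepsilon<\varepsilon_0$ there are a deterministic word-RAM program $P$ (with words of $O(\log n)$ bits) and a constant $C$, with $P$, $C$ and the constant in the word length depending only on $\varepsilon$ and $k$, with the following property. Let $n\ge 2$ and let $G$ be any graph on $n$ vertices, named $0,\dots,n-1$. Suppose that $P$ is given only $n$ and the following information about $G$: - the degree of every vertex; - for every vertex $v$ of positive degree, $t=\lceil c\log n/\varepsilon^2\rceil$ neighbors of $v$, chosen independently and uniformly at random with repetition; - a random set of vertices that contains each $v$ independently with probability $p_v=\min\{c\log n/\deg v,\,1\}$ (with $p_v=1$ if $\deg v=0$), together with the whole neighborhood $N(v)$, listed in an arbitrary fixed order, of each $v$ in this set, where all these random choices are independent. Then with probability at least $1-n^{-k}$, $P$ halts within $C\,n\log^2 n$ steps and outputs an $\varepsilon$-sparse-dense decomposition of $G$ (with parameter $\eta_0$), given as a labelling of the vertices in which $0$ marks the sparse vertices and equal positive labels mark the vertices of the same almost-clique. -/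

import Mathlib

open MeasureTheory ProbabilityTheory

section Decomposition

variable {V : Type*} [Fintype V] [DecidableEq V]

/-- The maximum degree, in the whole graph `G`, of a vertex of `K`. -/
def maxDegreeOn (G : SimpleGraph V) [DecidableRel G.Adj] (K : Finset V) : ℕ :=
  K.sup fun v => G.degree v

/-- `K` is an `ε`-almost-clique of `G`; with `Δ` the maximum degree (in `G`) of a vertex of `K`,
every vertex of `K` has at most `ε Δ` non-neighbors inside `K` and at most `ε Δ` neighbors outside
`K`, and the size of `K` lies between `(1 - ε) Δ` and `(1 + ε) Δ`. -/
structure IsAlmostClique (G : SimpleGraph V) [DecidableRel G.Adj] (ε : ℝ) (K : Finset V) :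
    Prop where
  nonNeighbors : ∀ v ∈ K,
    ((K.filter fun u => u ≠ v ∧ ¬ G.Adj v u).card : ℝ) ≤ ε * (maxDegreeOn G K : ℝ)
  outside : ∀ v ∈ K, ((G.neighborFinset v \ K).card : ℝ) ≤ ε * (maxDegreeOn G K : ℝ)
  size_lower : (1 - ε) * (maxDegreeOn G K : ℝ) ≤ (K.card : ℝ)
  size_upper : (K.card : ℝ) ≤ (1 + ε) * (maxDegreeOn G K : ℝ)

/-- `v` has at least `θ deg(v)` neighbors `u` such that
`|N(v) ∆ N(u)| ≥ θ max (deg u, deg v)`. -/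
def IsSparseVertex (G : SimpleGraph V) [DecidableRel G.Adj] (θ : ℝ) (v : V) : Prop :=
  θ * (G.degree v : ℝ) ≤
    (((G.neighborFinset v).filter fun u =>
      θ * max (G.degree u : ℝ) (G.degree v : ℝ) ≤
        ((symmDiff (G.neighborFinset v) (G.neighborFinset u)).card : ℝ)).card : ℝ)

/-- The set `sparse` and the members of `cliques` form a partition of the vertices of `G` into
sparse vertices (with parameter `η ε`) and `ε`-almost-cliques. -/
structure IsSparseDenseDecomposition (G : SimpleGraph V) [DecidableRel G.Adj] (η ε : ℝ)
    (sparse : Finset V) (cliques : Finset (Finset V)) : Prop where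
  cover : ∀ v, v ∈ sparse ∨ ∃ K ∈ cliques, v ∈ K
  sparse_disjoint : ∀ K ∈ cliques, Disjoint sparse K
  cliques_disjoint : ∀ K ∈ cliques, ∀ K' ∈ cliques, K ≠ K' → Disjoint K K'
  cliques_nonempty : ∀ K ∈ cliques, K.Nonempty
  sparse_vertices : ∀ v ∈ sparse, IsSparseVertex G (η * ε) v
  almost_cliques : ∀ K ∈ cliques, IsAlmostClique G ε K

/-- The sparse part described by a labelling of the vertices. Label `0` means sparse. -/
def sparseOfLabels (L : V → ℕ) : Finset V :=
  Finset.univ.filter fun v => L v = 0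

/-- The almost-cliques described by a labelling of the vertices, that is, the nonempty classes of
vertices with a common positive label. -/
def cliquesOfLabels (L : V → ℕ) : Finset (Finset V) :=
  (Finset.univ.filter fun v => L v ≠ 0).image fun v => Finset.univ.filter fun u => L u = L v

end Decomposition

section Machine

/-- The arithmetic and comparison instructions of the word RAM. -/
inductive WordOp : Type
  | add | sub | mul | div | mod | lt | eq

/-- The value of an instruction before reduction to the word length (subtraction is truncated,
division by zero gives zero, comparisons give `1` or `0`). -/
def WordOp.eval : WordOp → ℕ → ℕ → ℕ
  | .add, a, b => a + b
  | .sub, a, b => a - b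
  | .mul, a, b => a * b
  | .div, a, b => a / b
  | .mod, a, b => a % b
  | .lt, a, b => if a < b then 1 else 0
  | .eq, a, b => if a = b then 1 else 0

/-- Deterministic structured programs for the word RAM. Registers are numbered; a program mentions
only finitely many of them. `load r a` and `store a r` access the memory cell whose address is in
register `a`; `ite` and `loop` branch on whether register `r` is nonzero. -/
inductive Prog : Type
  | skip : Prog
  | const (r k : ℕ) : Prog
  | arith (o : WordOp) (r a b : ℕ) : Prog
  | load (r a : ℕ) : Prog
  | store (a r : ℕ) : Prog
  | seq (p q : Prog) : Prog
  | ite (r : ℕ) (p q : Prog) : Prog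
  | loop (r : ℕ) (p : Prog) : Prog

/-- A configuration of the machine, given by its registers and its random access memory. -/
structure RamState : Type where
  reg : ℕ → ℕ
  mem : ℕ → ℕ

/-- `Runs w p s s' T`: with words of `w` bits, the program `p` started in `s` halts in `s'` after
exactly `T` steps. Every instruction and every test of a branch or of a loop takes one step, and
every computed value is reduced modulo `2 ^ w`. -/
inductive Runs (w : ℕ) : Prog → RamState → RamState → ℕ → Prop
  | skip (s : RamState) : Runs w .skip s s 1
  | const (s : RamState) (r k : ℕ) :
      Runs w (.const r k) s ⟨Function.update s.reg r (k % 2 ^ w), s.mem⟩ 1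
  | arith (s : RamState) (o : WordOp) (r a b : ℕ) :
      Runs w (.arith o r a b) s
        ⟨Function.update s.reg r (o.eval (s.reg a) (s.reg b) % 2 ^ w), s.mem⟩ 1
  | load (s : RamState) (r a : ℕ) :
      Runs w (.load r a) s ⟨Function.update s.reg r (s.mem (s.reg a)), s.mem⟩ 1
  | store (s : RamState) (a r : ℕ) :
      Runs w (.store a r) s ⟨s.reg, Function.update s.mem (s.reg a) (s.reg r)⟩ 1
  | seq {p q : Prog} {s s₁ s₂ : RamState} {T₁ T₂ : ℕ} :
      Runs w p s s₁ T₁ → Runs w q s₁ s₂ T₂ → Runs w (.seq p q) s s₂ (T₁ + T₂)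
  | ite_true {r : ℕ} {p q : Prog} {s s' : RamState} {T : ℕ} :
      s.reg r ≠ 0 → Runs w p s s' T → Runs w (.ite r p q) s s' (T + 1)
  | ite_false {r : ℕ} {p q : Prog} {s s' : RamState} {T : ℕ} :
      s.reg r = 0 → Runs w q s s' T → Runs w (.ite r p q) s s' (T + 1)
  | loop_exit {r : ℕ} {p : Prog} {s : RamState} :
      s.reg r = 0 → Runs w (.loop r p) s s 1
  | loop_step {r : ℕ} {p : Prog} {s s₁ s₂ : RamState} {T₁ T₂ : ℕ} :
      s.reg r ≠ 0 → Runs w p s s₁ T₁ → Runs w (.loop r p) s₁ s₂ T₂ →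
      Runs w (.loop r p) s s₂ (T₁ + T₂ + 1)

/-- The initial configuration on an input, a list of words. All registers are zero, and the input
occupies the first cells of the memory, which is zero elsewhere. -/
def initialState (w : ℕ) (input : List ℕ) : RamState where
  reg := fun _ => 0
  mem := fun i => input.getD i 0 % 2 ^ w

/-- With words of `w` bits, the program `p` halts on `input` after at most `B` steps, and leaves in
the memory cells `0, …, n - 1` a labelling of the vertices `0, …, n - 1` with the property
`good`. -/
def ComputesLabels (w : ℕ) (p : Prog) (input : List ℕ) (n : ℕ) (B : ℝ)
    (good : (Fin n → ℕ) → Prop) : Prop :=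
  ∃ (s : RamState) (T : ℕ), Runs w p (initialState w input) s T ∧ (T : ℝ) ≤ B ∧
    good fun v => s.mem (v : ℕ)

end Machine

noncomputable section Sampling

variable {n : ℕ}

/-- The number `⌈c log n / ε ^ 2⌉` of sampled neighbors per vertex. -/
def sampleCount (c ε : ℝ) (n : ℕ) : ℕ :=
  ⌈c * Real.log n / ε ^ 2⌉₊

/-- The probability `min (c log n / d, 1)` (equal to `1` for `d = 0`) with which a vertex of degree
`d` is sampled. -/
def inclusionProb (c : ℝ) (n d : ℕ) : ℝ :=
  if (d : ℝ) ≤ c * Real.log n then 1 else c * Real.log n / d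

/-- The law of one sampled neighbor of `v`, uniform on the neighbors of `v`. (An isolated vertex has
no neighbors; its own name fills the positions of its samples.) -/
def neighborLaw (G : SimpleGraph (Fin n)) [DecidableRel G.Adj] (v : Fin n) : Measure (Fin n) :=
  if G.degree v = 0 then Measure.dirac v else uniformOn (G.neighborSet v)

/-- The law of the indicator of the event that `v` is one of the sampled vertices. -/
def inclusionLaw (G : SimpleGraph (Fin n)) [DecidableRel G.Adj] (c : ℝ) (v : Fin n) :
    Measure Bool :=
  ENNReal.ofReal (inclusionProb c n (G.degree v)) • Measure.dirac true +
    ENNReal.ofReal (1 - inclusionProb c n (G.degree v)) • Measure.dirac false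

/-- The joint law of the sampled neighbors `σ v i` (`i < t`) of all the vertices `v` and of the
indicator of the set of sampled vertices; all of these are independent. -/
def samplingLaw (G : SimpleGraph (Fin n)) [DecidableRel G.Adj] (c : ℝ) (t : ℕ) :
    Measure ((Fin n → Fin t → Fin n) × (Fin n → Bool)) :=
  (Measure.pi fun v => Measure.pi fun _ => neighborLaw G v).prod
    (Measure.pi fun v => inclusionLaw G c v)

/-- `adj v` lists the neighbors of `v`, each once, in an arbitrary order. -/
def IsAdjacencyList (G : SimpleGraph (Fin n)) (adj : Fin n → List (Fin n)) : Prop :=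
  ∀ v, (adj v).Nodup ∧ ∀ u, u ∈ adj v ↔ G.Adj v u

/-- The input of the recovery algorithm as a list of numbers: `n`, the number `t` of samples per
vertex, the number of sampled vertices, the degrees of all vertices, the `t` sampled neighbors of
every vertex, and each sampled vertex followed by all of its neighbors. -/
def recoveryInput (G : SimpleGraph (Fin n)) [DecidableRel G.Adj] (adj : Fin n → List (Fin n))
    {t : ℕ} (ω : (Fin n → Fin t → Fin n) × (Fin n → Bool)) : List ℕ :=
  [n, t, ((List.finRange n).filter fun v => ω.2 v).length] ++
    (List.finRange n).map (fun v => G.degree v) ++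
    (List.finRange n).flatMap (fun v => (List.finRange t).map fun i => (ω.1 v i : ℕ)) ++
    ((List.finRange n).filter fun v => ω.2 v).flatMap
      (fun v : Fin n => (v : ℕ) :: (adj v).map fun u => (u : ℕ))

end Sampling

/-! ### Neighborhood distance and almost-cliques around a center. -/

section Graph

variable {V : Type*} [Fintype V] [DecidableEq V]

/-! Write `D(u, w) = |N(u) ∆ N(w)|`, which obeys the triangle inequality, and put `θ = η₀ ε`. A
vertex `v` that is not sparse has more than `(1 - θ) deg v` neighbors at distance at most about `θ
deg v`. If `w` is one of these, then `v` and almost all of `N(w)` are close to `w`. So it suffices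
to have centers that include a similar neighbor of every non-sparse vertex: for each center `w` let
`A` be the set of its neighbors found close to it, and keep `w` if `A` is almost all of `N(w)`. The
kept sets cover all non-sparse vertices.

Kept sets are clustered greedily. A set that meets no earlier core becomes a core; otherwise its
unlabelled vertices join a core that it meets. Every vertex of a cluster is then close to the center
of the core, and the core is almost the whole neighborhood of that center. Double counting the edges
between the core and the rest of the cluster shows that the rest is small, so the cluster is an
almost-clique (`isAlmostClique_of_center`). The argument tolerates errors of order `θ` in the
distances (`ClusterInv.decomposition_of_approxTest`) and is used twice: with all vertices as centers
and exact distances it gives existence, with sampled centers and estimated distances it gives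
recovery.

For the estimates, `D(u, w) = deg u + deg w - 2 |N(u) ∩ N(w)|`, and the fraction of samples of `u`
that fall in `N(w)` estimates `|N(u) ∩ N(w)| / deg u`. Hoeffding's inequality and a union bound over
pairs control all errors. A non-sparse `v` has more than `deg v / 2` similar neighbors, each sampled
with probability at least `min (c log n / (2 deg v), 1)`, so one is hit with high probability. A
center `w` costs `O((deg w + 1) (t + 1))` steps; an exponential moment bounds the sampled degrees by
`O(n log n)`, and `t = O(log n)`.

The running time on the machine comes from a program logic with step counts (`WP`).
`recoveryProg_runs` shows that the program carries out the greedy clustering, and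
`computesLabels_of_good` combines this with the graph theory. -/

/-- The number of vertices adjacent to exactly one of `u` and `v`. -/
def nbrDist (G : SimpleGraph V) [DecidableRel G.Adj] (u v : V) : ℕ :=
  (symmDiff (G.neighborFinset u) (G.neighborFinset v)).card

variable (G : SimpleGraph V) [DecidableRel G.Adj]

lemma nbrDist_comm (u v : V) : nbrDist G u v = nbrDist G v u := by
  unfold nbrDist; rw [symmDiff_comm]

lemma nbrDist_triangle (u v w : V) : nbrDist G u w ≤ nbrDist G u v + nbrDist G v w := by
  unfold nbrDist
  refine (Finset.card_le_card ?_).trans (Finset.card_union_le _ _)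
  exact symmDiff_triangle _ _ _

lemma card_neighborFinset_sdiff_le (u v : V) :
    (G.neighborFinset u \ G.neighborFinset v).card ≤ nbrDist G u v := by
  unfold nbrDist
  refine Finset.card_le_card fun x hx => ?_
  rw [Finset.mem_symmDiff]; rw [Finset.mem_sdiff] at hx; exact Or.inl hx

lemma degree_le_add_nbrDist (u v : V) : G.degree u ≤ G.degree v + nbrDist G u v := by
  have h := card_neighborFinset_sdiff_le G u v
  have h2 := Finset.card_le_card_sdiff_add_card (s := G.neighborFinset u) (t := G.neighborFinset v)
  simp only [SimpleGraph.card_neighborFinset_eq_degree] at h2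
  omega

lemma nbrDist_add_two_mul_card_inter (u v : V) :
    nbrDist G u v + 2 * (G.neighborFinset u ∩ G.neighborFinset v).card
      = G.degree u + G.degree v := by
  have h1 := Finset.card_sdiff_add_card_inter (G.neighborFinset u) (G.neighborFinset v)
  have h2 := Finset.card_sdiff_add_card_inter (G.neighborFinset v) (G.neighborFinset u)
  rw [Finset.inter_comm] at h2
  simp only [SimpleGraph.card_neighborFinset_eq_degree] at h1 h2
  have h3 : nbrDist G u v = (G.neighborFinset u \ G.neighborFinset v).card +
      (G.neighborFinset v \ G.neighborFinset u).card := by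
    unfold nbrDist
    rw [symmDiff_def, Finset.sup_eq_union, Finset.card_union_of_disjoint]
    exact disjoint_sdiff_sdiff
  omega

/-- A set of vertices whose neighborhoods are close to that of a common center `w`, and which
contains almost all neighbors of `w`, is an almost-clique. -/
theorem isAlmostClique_of_center {w : V} {A K : Finset V} {l ε : ℝ} (hA : A ⊆ G.neighborFinset w)
    (hAK : A ⊆ K) (hd : 0 < G.degree w)
    (hcard : ((G.neighborFinset w \ A).card : ℝ) ≤ l * G.degree w)
    (hD : ∀ u ∈ K, (nbrDist G u w : ℝ) ≤ l * G.degree w)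
    (hl : l ≤ 1 / 20) (hε : 5 * l ≤ ε) : IsAlmostClique G ε K := by
  have hd' : (0 : ℝ) < G.degree w := by exact_mod_cast hd
  set d : ℝ := (G.degree w : ℝ) with hdd
  have hl0 : 0 ≤ l := by
    by_contra h
    have : l * d < 0 := mul_neg_of_neg_of_pos (not_le.1 h) hd'
    have h0 : (0 : ℝ) ≤ ((G.neighborFinset w \ A).card : ℝ) := by positivity
    linarith
  have hAcard : ((G.neighborFinset w \ A).card : ℝ) + A.card = d := by
    have h := Finset.card_sdiff_add_card_eq_card hA
    rw [SimpleGraph.card_neighborFinset_eq_degree] at h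
    rw [hdd]; exact_mod_cast h
  have hld : l * d ≤ d / 20 := by nlinarith
  have hA_sdiff : ∀ u ∈ K, ((A \ G.neighborFinset u).card : ℝ) ≤ l * d := by
    intro u hu
    refine le_trans ?_ (hD u hu)
    rw [nbrDist_comm]
    exact_mod_cast (Finset.card_le_card (Finset.sdiff_subset_sdiff hA subset_rfl)).trans
      (card_neighborFinset_sdiff_le G w u)
  have hN_sdiff : ∀ u ∈ K, ((G.neighborFinset u \ A).card : ℝ) ≤ 2 * l * d := by
    intro u hu
    have h1 : (G.neighborFinset u \ A).card ≤ nbrDist G u w + (G.neighborFinset w \ A).card := by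
      refine le_trans (Finset.card_le_card ?_) ((Finset.card_union_le _ _).trans
        (Nat.add_le_add_right (card_neighborFinset_sdiff_le G u w) _))
      exact sdiff_triangle _ _ _
    have h1' : ((G.neighborFinset u \ A).card : ℝ) ≤
      nbrDist G u w + (G.neighborFinset w \ A).card := by exact_mod_cast h1
    have := hD u hu
    linarith
  -- Double count the edges between `A` and `K \ A`. Each vertex of `K \ A` has at least `d - 2 l d
  -- ≥ 0.9 d` neighbors in `A`, while each of the at most `d` vertices of `A` has at most `2 l d`
  -- neighbors outside `A`.
  have hB : ((K \ A).card : ℝ) ≤ 3 * l * d := by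
    have hcount : ∑ b ∈ K \ A, (A ∩ G.neighborFinset b).card =
        ∑ a ∈ A, ((K \ A) ∩ G.neighborFinset a).card := by
      have h1 : ∀ s : Finset V, ∀ b, (s ∩ G.neighborFinset b) = s.filter fun a => G.Adj b a := by
        intro s b; ext; simp
      simp only [h1, Finset.card_filter]
      rw [Finset.sum_comm]
      simp only [G.adj_comm]
    have hlow : ∀ b ∈ K \ A, d - 2 * (l * d) ≤ ((A ∩ G.neighborFinset b).card : ℝ) := by
      intro b hb
      have h1 := hA_sdiff b (Finset.mem_sdiff.1 hb).1
      have h2 := Finset.card_sdiff_add_card_inter A (G.neighborFinset b)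
      have h2' : ((A \ G.neighborFinset b).card : ℝ) + (A ∩ G.neighborFinset b).card = A.card := by
        exact_mod_cast h2
      linarith
    have hup : ∀ a ∈ A, (((K \ A) ∩ G.neighborFinset a).card : ℝ) ≤ 2 * l * d := by
      intro a ha
      refine le_trans ?_ (hN_sdiff a (hAK ha))
      refine Nat.cast_le.2 (Finset.card_le_card fun x hx => ?_)
      simp only [Finset.mem_inter, Finset.mem_sdiff] at hx ⊢
      tauto
    have h1 := Finset.card_nsmul_le_sum (K \ A) _ _ hlow
    have h2 := Finset.sum_le_card_nsmul A _ _ hup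
    have h3 : (∑ b ∈ K \ A, ((A ∩ G.neighborFinset b).card : ℝ)) =
        ∑ a ∈ A, (((K \ A) ∩ G.neighborFinset a).card : ℝ) := by exact_mod_cast hcount
    rw [h3] at h1
    have h4 := h1.trans h2
    simp only [nsmul_eq_mul] at h4
    have h5 : (A.card : ℝ) ≤ d := by
      have : (0 : ℝ) ≤ ((G.neighborFinset w \ A).card : ℝ) := by positivity
      linarith
    have h6 : (A.card : ℝ) * (2 * l * d) ≤ d * (2 * l * d) :=
      mul_le_mul_of_nonneg_right h5 (by positivity)
    have h7 : ((K \ A).card : ℝ) * (d * (9 / 10)) ≤ ((K \ A).card : ℝ) * (d - 2 * (l * d)) :=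
      mul_le_mul_of_nonneg_left (by linarith) (by positivity)
    have h8 : (((K \ A).card : ℝ) * (9 / 10)) * d ≤ (2 * l * d) * d := by linarith
    have h9 := le_of_mul_le_mul_right h8 hd'
    have : 0 ≤ l * d := by positivity
    linarith
  have hKcard : (K.card : ℝ) = (K \ A).card + A.card := by
    exact_mod_cast (Finset.card_sdiff_add_card_eq_card hAK).symm
  have hdeg_le : ∀ u ∈ K, (G.degree u : ℝ) ≤ d + l * d := by
    intro u hu
    have h := degree_le_add_nbrDist G u w
    have h' : (G.degree u : ℝ) ≤ d + nbrDist G u w := by rw [hdd]; exact_mod_cast h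
    linarith [hD u hu]
  have hle_deg : ∀ u ∈ K, d - l * d ≤ (G.degree u : ℝ) := by
    intro u hu
    have h := degree_le_add_nbrDist G w u
    have h' : d ≤ G.degree u + nbrDist G u w := by
      rw [hdd, nbrDist_comm]; exact_mod_cast h
    linarith [hD u hu]
  have hApos : (0 : ℝ) < A.card := by linarith
  have hAne : A.Nonempty := Finset.card_pos.1 (by exact_mod_cast hApos)
  have hKne : K.Nonempty := hAne.mono hAK
  obtain ⟨x, hxK, hx⟩ := Finset.exists_mem_eq_sup K hKne fun v => G.degree v
  have hmax : maxDegreeOn G K = G.degree x := hx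
  have hx1 := hdeg_le x hxK
  have hx2 := hle_deg x hxK
  rw [← hmax] at hx1 hx2
  set Δ : ℝ := (maxDegreeOn G K : ℝ)
  have hld0 : 0 ≤ l * d := by positivity
  have hΔ0 : 0 ≤ Δ := by linarith
  -- Passing from `d` to `Δ` costs a factor `20 / 19`, because `Δ ≥ (1 - l) d`. The largest defect
  -- below is `l d + 3 l d`, and `4 · 20 / 19 < 5`.
  have hlΔ : l * d ≤ (20 / 19) * (l * Δ) := by nlinarith
  have hεΔ : 5 * (l * Δ) ≤ ε * Δ := by nlinarith
  have hlΔ0 : 0 ≤ l * Δ := by positivity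
  refine ⟨fun v hv => ?_, fun v hv => ?_, ?_, ?_⟩
  · have h1 : (K.filter fun u => u ≠ v ∧ ¬ G.Adj v u).card ≤
        (A \ G.neighborFinset v).card + (K \ A).card := by
      refine le_trans (Finset.card_le_card ?_) (Finset.card_union_le _ _)
      intro u hu
      simp only [Finset.mem_filter, Finset.mem_union, Finset.mem_sdiff,
        SimpleGraph.mem_neighborFinset] at hu ⊢
      tauto
    have h1' : ((K.filter fun u => u ≠ v ∧ ¬ G.Adj v u).card : ℝ) ≤
        (A \ G.neighborFinset v).card + (K \ A).card := by exact_mod_cast h1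
    have := hA_sdiff v hv
    linarith
  · have h1 : (G.neighborFinset v \ K).card ≤ (G.neighborFinset v \ A).card :=
      Finset.card_le_card (Finset.sdiff_subset_sdiff subset_rfl hAK)
    have h1' : ((G.neighborFinset v \ K).card : ℝ) ≤ (G.neighborFinset v \ A).card := by
      exact_mod_cast h1
    have := hN_sdiff v hv
    linarith
  · have : (0 : ℝ) ≤ ((K \ A).card : ℝ) := by positivity
    nlinarith
  · have : (0 : ℝ) ≤ ((G.neighborFinset w \ A).card : ℝ) := by positivity
    nlinarith

end Graph

/-! ### Greedy clustering of the neighborhoods of centers. -/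

section Clustering

variable {V : Type*}

/-- The state after the first `m` members of a family `A` of sets of vertices have been clustered:
`core` describes disjoint members of the family, and `L` assigns each vertex of a member satisfying
`pass` to one of them, at distance at most one. -/
structure ClusterInv (A : ℕ → Finset V) (pass : ℕ → Prop) (m : ℕ) (core L : V → ℕ) : Prop where
  core_eq : ∀ u, core u ≠ 0 → L u = core u ∧
    ∃ i < m, pass i ∧ core u = i + 1 ∧ u ∈ A i ∧ ∀ x ∈ A i, core x = i + 1
  label : ∀ u, L u ≠ 0 → core u = L u ∨
    ∃ i < m, pass i ∧ u ∈ A i ∧ ∃ x ∈ A i, core x = L u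
  labelled : ∀ i < m, pass i → ∀ u ∈ A i, L u ≠ 0

variable {A : ℕ → Finset V} {pass : ℕ → Prop} {m : ℕ} {core L : V → ℕ}

lemma ClusterInv.zero : ClusterInv A pass 0 (fun _ => 0) (fun _ => 0) :=
  ⟨by simp, by simp, by simp⟩

lemma ClusterInv.skip (h : ClusterInv A pass m core L) (hm : ¬ pass m) :
    ClusterInv A pass (m + 1) core L := by
  refine ⟨fun u hu => ?_, fun u hu => ?_, fun i hi hp u hu => ?_⟩
  · obtain ⟨h1, i, hi, h2⟩ := h.core_eq u hu
    exact ⟨h1, i, by omega, h2⟩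
  · rcases h.label u hu with h1 | ⟨i, hi, h2⟩
    · exact Or.inl h1
    · exact Or.inr ⟨i, by omega, h2⟩
  · have : i ≠ m := by rintro rfl; exact hm hp
    exact h.labelled i (by omega) hp u hu

variable [DecidableEq V]

/-- Vertices of `A m` that had joined an older cluster are moved to the new one. No other vertex is
harmed: the older cores miss `A m`, so each witness `core x = L u` survives. -/
lemma ClusterInv.new (h : ClusterInv A pass m core L) (hm : pass m) (h0 : ∀ u ∈ A m, core u = 0) :
    ClusterInv A pass (m + 1) (fun v => if v ∈ A m then m + 1 else core v)
      (fun v => if v ∈ A m then m + 1 else L v) := by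
  have keep : ∀ x, core x ≠ 0 → (if x ∈ A m then m + 1 else core x) = core x := by
    intro x hx
    rw [if_neg fun hxA => hx (h0 x hxA)]
  refine ⟨fun u hu => ?_, fun u hu => ?_, fun i hi hp u hu => ?_⟩
  · by_cases hA : u ∈ A m
    · simp only [if_pos hA]
      exact ⟨trivial, m, by omega, hm, rfl, hA, fun x hx => if_pos hx⟩
    · simp only [if_neg hA] at hu ⊢
      obtain ⟨h1, i, hi, h2, h3, h4, h5⟩ := h.core_eq u hu
      exact ⟨h1, i, by omega, h2, h3, h4, fun x hx => by
        rw [keep x (by rw [h5 x hx]; omega), h5 x hx]⟩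
  · by_cases hA : u ∈ A m
    · simp [hA]
    · simp only [if_neg hA] at hu ⊢
      rcases h.label u hu with h1 | ⟨i, hi, h2, h3, x, hx, h4⟩
      · exact Or.inl h1
      · exact Or.inr ⟨i, by omega, h2, h3, x, hx, by rw [keep x (by rw [h4]; exact hu), h4]⟩
  · by_cases hA : u ∈ A m
    · simp [hA]
    · simp only [if_neg hA]
      have : i ≠ m := by rintro rfl; exact hA hu
      exact h.labelled i (by omega) hp u hu

/-- Only unlabelled vertices change, so cores keep their labels; `x` is the common point of `A m`
and a core that `label` asks for. -/
lemma ClusterInv.join (h : ClusterInv A pass m core L) (hm : pass m) {x : V} (hx : x ∈ A m)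
    (h0 : core x ≠ 0) :
    ClusterInv A pass (m + 1) core (fun v => if v ∈ A m ∧ L v = 0 then core x else L v) := by
  refine ⟨fun u hu => ?_, fun u hu => ?_, fun i hi hp u hu => ?_⟩
  · obtain ⟨h1, i, hi, h2⟩ := h.core_eq u hu
    have : ¬ (u ∈ A m ∧ L u = 0) := by rw [h1]; exact fun h => hu h.2
    exact ⟨by rw [if_neg this, h1], i, by omega, h2⟩
  · by_cases hA : u ∈ A m ∧ L u = 0
    · simp only [if_pos hA]
      exact Or.inr ⟨m, by omega, hm, hA.1, x, hx, rfl⟩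
    · simp only [if_neg hA] at hu ⊢
      rcases h.label u hu with h1 | ⟨i, hi, h2⟩
      · exact Or.inl h1
      · exact Or.inr ⟨i, by omega, h2⟩
  · by_cases hA : u ∈ A m ∧ L u = 0
    · simpa only [if_pos hA]
    · simp only [if_neg hA]
      by_cases hi' : i = m
      · subst hi'; exact fun h => hA ⟨hu, h⟩
      · exact h.labelled i (by omega) hp u hu

lemma exists_clusterInv (A : ℕ → Finset V) (pass : ℕ → Prop) (m : ℕ) :
    ∃ core L, ClusterInv A pass m core L := by
  induction m with
  | zero => exact ⟨_, _, ClusterInv.zero⟩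
  | succ m ih =>
    obtain ⟨core, L, h⟩ := ih
    by_cases hm : pass m
    · by_cases h0 : ∃ x ∈ A m, core x ≠ 0
      · obtain ⟨x, hx, hx0⟩ := h0
        exact ⟨_, _, h.join hm hx hx0⟩
      · push Not at h0
        exact ⟨_, _, h.new hm h0⟩
    · exact ⟨_, _, h.skip hm⟩

variable [Fintype V] {G : SimpleGraph V} [DecidableRel G.Adj]

/-- `A` is a set of neighbors of `w` that contains almost all of them, all with neighborhoods close
to that of `w`. -/
structure IsDenseCenter (G : SimpleGraph V) [DecidableRel G.Adj] (γ : ℝ) (w : V) (A : Finset V) :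
    Prop where
  subset : A ⊆ G.neighborFinset w
  card_sdiff : ((G.neighborFinset w \ A).card : ℝ) ≤ γ * G.degree w
  dist : ∀ u ∈ A, (nbrDist G u w : ℝ) ≤ γ * G.degree w

/-- A non-sparse vertex lies in a passing set and is therefore labelled, so label `0` implies
sparse. The core of a cluster is a full set `A i`, hence almost all of `N(ctr i)`. A vertex `u` that
joined through `A i'` reaches `ctr i` by way of `ctr i'` and a point `y` of `A i'` in the core. This
bounds its distance to `ctr i` by `4 γ deg (ctr i)`, and `isAlmostClique_of_center` applies with `l
= 4 γ`. -/
theorem ClusterInv.isSparseDenseDecomposition (h : ClusterInv A pass m core L) {γ ε η : ℝ}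
    (hγ : γ ≤ 1 / 80) (hε : 20 * γ ≤ ε) (hγ0 : 0 ≤ γ) {ctr : ℕ → V}
    (hctr : ∀ i < m, pass i → IsDenseCenter G γ (ctr i) (A i))
    (hcover : ∀ v, ¬ IsSparseVertex G (η * ε) v → ∃ i < m, pass i ∧ v ∈ A i) :
    IsSparseDenseDecomposition G η ε (sparseOfLabels L) (cliquesOfLabels L) := by
  have hmem : ∀ K ∈ cliquesOfLabels L, ∃ v, L v ≠ 0 ∧ ∀ u, u ∈ K ↔ L u = L v := by
    intro K hK
    simp only [cliquesOfLabels, Finset.mem_image, Finset.mem_filter, Finset.mem_univ,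
      true_and] at hK
    obtain ⟨v, hv, rfl⟩ := hK
    exact ⟨v, hv, by simp⟩
  refine ⟨fun v => ?_, fun K hK => ?_, fun K hK K' hK' hne => ?_, fun K hK => ?_, fun v hv => ?_,
    fun K hK => ?_⟩
  · by_cases hv : L v = 0
    · exact Or.inl (by simp [sparseOfLabels, hv])
    · refine Or.inr ⟨Finset.univ.filter fun u => L u = L v, ?_, by simp⟩
      exact Finset.mem_image.2 ⟨v, by simp [hv], rfl⟩
  · obtain ⟨v, hv, hK⟩ := hmem K hK
    rw [Finset.disjoint_left]
    intro u hu huK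
    simp only [sparseOfLabels, Finset.mem_filter, Finset.mem_univ, true_and] at hu
    rw [hK, hu] at huK
    exact hv huK.symm
  · obtain ⟨v, hv, hK⟩ := hmem K hK
    obtain ⟨v', hv', hK'⟩ := hmem K' hK'
    rw [Finset.disjoint_left]
    intro u hu hu'
    apply hne
    rw [hK] at hu
    rw [hK'] at hu'
    ext x
    rw [hK, hK', ← hu, ← hu']
  · obtain ⟨v, hv, hK⟩ := hmem K hK
    exact ⟨v, by rw [hK]⟩
  · by_contra hs
    obtain ⟨i, hi, hp, hvA⟩ := hcover v hs
    simp only [sparseOfLabels, Finset.mem_filter, Finset.mem_univ, true_and] at hv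
    exact h.labelled i hi hp v hvA hv
  · obtain ⟨v, hv, hK⟩ := hmem K hK
    have hcore : ∃ x, core x = L v := by
      rcases h.label v hv with h1 | ⟨i, hi, h2, h3, x, hx, h4⟩
      · exact ⟨v, h1⟩
      · exact ⟨x, h4⟩
    obtain ⟨x, hx⟩ := hcore
    obtain ⟨-, i, hi, hp, hxi, hxA, hAi⟩ := h.core_eq x (by rw [hx]; exact hv)
    have hc := hctr i hi hp
    have hLv : L v = i + 1 := by rw [← hx, hxi]
    have hpos : 0 < G.degree (ctr i) := by
      rw [← SimpleGraph.card_neighborFinset_eq_degree]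
      exact Finset.card_pos.2 ⟨x, hc.subset hxA⟩
    have hdp : (0 : ℝ) < G.degree (ctr i) := by exact_mod_cast hpos
    refine isAlmostClique_of_center (w := ctr i) (A := A i) G (l := 4 * γ) hc.subset ?_ hpos ?_ ?_
      (by linarith) (by linarith)
    · intro y hy
      rw [hK, hLv]
      have := hAi y hy
      rw [(h.core_eq y (by omega)).1, this]
    · refine hc.card_sdiff.trans ?_
      nlinarith
    · intro u hu
      rw [hK, hLv] at hu
      have hown : ∀ y, core y = i + 1 → (nbrDist G y (ctr i) : ℝ) ≤ γ * G.degree (ctr i) := by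
        intro y hy
        obtain ⟨-, i', hi', hp', hyi', hyA', -⟩ := h.core_eq y (by omega)
        have : i' = i := by omega
        subst this
        exact hc.dist y hyA'
      rcases h.label u (by omega) with h1 | ⟨i', hi', hp', huA, y, hyA, hy⟩
      · refine (hown u (by rw [h1, hu])).trans ?_
        nlinarith
      · have hc' := hctr i' hi' hp'
        have e1 := hc'.dist u huA
        have e2 := hc'.dist y hyA
        have e3 := hown y (by rw [hy, hu])
        have e4 : (nbrDist G u (ctr i) : ℝ) ≤
            nbrDist G u (ctr i') + (nbrDist G y (ctr i') + nbrDist G y (ctr i)) := by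
          have t1 := nbrDist_triangle G u (ctr i') (ctr i)
          have t2 := nbrDist_triangle G (ctr i') y (ctr i)
          rw [nbrDist_comm G (ctr i') y] at t2
          exact_mod_cast t1.trans (Nat.add_le_add_left t2 _)
        have e5 : (G.degree (ctr i') : ℝ) ≤ G.degree y + nbrDist G y (ctr i') := by
          rw [nbrDist_comm]; exact_mod_cast degree_le_add_nbrDist G (ctr i') y
        have e6 : (G.degree y : ℝ) ≤ G.degree (ctr i) + nbrDist G y (ctr i) := by
          exact_mod_cast degree_le_add_nbrDist G y (ctr i)
        -- The two centers have comparable degrees since both are close to `y`. The path then has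
        -- length at most `(2 · 5 / 4 + 1) γ` times the degree of `ctr i`, which is below `4 γ`.
        have e7 : (G.degree (ctr i') : ℝ) ≤ (5 / 4) * G.degree (ctr i) := by nlinarith
        nlinarith

end Clustering

/-! ### Non-sparse vertices, approximate closeness tests, and existence. -/

section Similarity

variable {V : Type*} [Fintype V] [DecidableEq V] (G : SimpleGraph V) [DecidableRel G.Adj]

/-- The neighbors `u` of `v` with `|N(v) ∆ N(u)| < θ max (deg u, deg v)`. -/
noncomputable def similarNbrs (θ : ℝ) (v : V) : Finset V :=
  (G.neighborFinset v).filter fun u =>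
    (nbrDist G v u : ℝ) < θ * max (G.degree u : ℝ) (G.degree v : ℝ)

variable {G} {θ : ℝ} {v w : V}

lemma card_similarNbrs (h : ¬ IsSparseVertex G θ v) :
    (G.degree v : ℝ) - θ * G.degree v < ((similarNbrs G θ v).card : ℝ) := by
  unfold IsSparseVertex at h
  rw [not_le] at h
  have h2 : ((G.neighborFinset v).filter fun u =>
      θ * max (G.degree u : ℝ) (G.degree v : ℝ) ≤
        ((symmDiff (G.neighborFinset v) (G.neighborFinset u)).card : ℝ)).card +
      (similarNbrs G θ v).card = G.degree v := by
    have hs : similarNbrs G θ v = (G.neighborFinset v).filter fun u =>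
        ¬ θ * max (G.degree u : ℝ) (G.degree v : ℝ) ≤
          ((symmDiff (G.neighborFinset v) (G.neighborFinset u)).card : ℝ) := by
      unfold similarNbrs nbrDist
      ext u
      simp
    rw [hs, Finset.card_filter_add_card_filter_not, SimpleGraph.card_neighborFinset_eq_degree]
  have h3 : (((G.neighborFinset v).filter fun u =>
      θ * max (G.degree u : ℝ) (G.degree v : ℝ) ≤
        ((symmDiff (G.neighborFinset v) (G.neighborFinset u)).card : ℝ)).card : ℝ) +
      (similarNbrs G θ v).card = G.degree v := by exact_mod_cast h2
  linarith

/-- Degrees differ by at most the distance, so similar neighbors have degrees within one percent of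
each other and every bound can be expressed through `deg v`. -/
lemma dist_of_mem_similarNbrs (hθ0 : 0 ≤ θ) (hθ : θ ≤ 1 / 1000) (hw : w ∈ similarNbrs G θ v) :
    (nbrDist G v w : ℝ) ≤ 1.01 * θ * G.degree v ∧ (G.degree w : ℝ) ≤ 1.01 * G.degree v ∧
      0.99 * (G.degree v : ℝ) ≤ G.degree w := by
  simp only [similarNbrs, Finset.mem_filter] at hw
  have h1 := hw.2
  have e1 : (G.degree w : ℝ) ≤ G.degree v + nbrDist G v w := by
    rw [nbrDist_comm]; exact_mod_cast degree_le_add_nbrDist G w v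
  have e2 : (G.degree v : ℝ) ≤ G.degree w + nbrDist G v w := by
    exact_mod_cast degree_le_add_nbrDist G v w
  have e3 : (0 : ℝ) ≤ G.degree v := by positivity
  have e4 : (0 : ℝ) ≤ G.degree w := by positivity
  rcases max_cases (G.degree w : ℝ) (G.degree v : ℝ) with ⟨h, h'⟩ | ⟨h, h'⟩ <;> rw [h] at h1
  · have : θ * (G.degree w : ℝ) ≤ 1 / 1000 * G.degree w := by gcongr
    have h2 : (G.degree w : ℝ) ≤ 1.01 * G.degree v := by linarith
    refine ⟨?_, h2, by linarith⟩
    nlinarith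
  · have : θ * (G.degree v : ℝ) ≤ 1 / 1000 * G.degree v := by gcongr
    have : 0 ≤ θ * (G.degree v : ℝ) := by positivity
    refine ⟨by linarith, by linarith, by linarith⟩

/-- The outcome of estimating the distances between the neighborhoods of `w` and of its neighbors up
to a relative error `2 θ`, and of accepting estimates up to a fraction `β` of the degrees. -/
structure IsApproxTest (G : SimpleGraph V) [DecidableRel G.Adj] (θ β : ℝ) (w : V) (A : Finset V) :
    Prop where
  subset : A ⊆ G.neighborFinset w
  mem : ∀ u ∈ G.neighborFinset w,
    (nbrDist G u w : ℝ) + 2 * θ * G.degree u ≤ β * (G.degree u + G.degree w) → u ∈ A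
  dist : ∀ u ∈ A, (nbrDist G u w : ℝ) ≤ β * (G.degree u + G.degree w) + 2 * θ * G.degree u

/-- The error `2 θ deg u` is at most `β deg u`. Replacing `deg u` by `deg w + D(u, w)` gives `(1 - 2
β) D ≤ 3 β deg w`, and `β ≤ 1 / 100` leaves room for `4 β`. -/
lemma IsApproxTest.isDenseCenter {β : ℝ} {A : Finset V} (h : IsApproxTest G θ β w A) (hθ0 : 0 ≤ θ)
    (hθβ : 3 * θ ≤ β) (hβ : β ≤ 1 / 100)
    (hpass : ((G.neighborFinset w \ A).card : ℝ) ≤ β * G.degree w) :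
    IsDenseCenter G (4 * β) w A := by
  refine ⟨h.subset, ?_, fun u hu => ?_⟩
  · have : 0 ≤ β * (G.degree w : ℝ) := le_trans (by positivity) hpass
    linarith
  · have e1 := h.dist u hu
    have e2 : (G.degree u : ℝ) ≤ G.degree w + nbrDist G u w := by
      exact_mod_cast degree_le_add_nbrDist G u w
    have e3 : (0 : ℝ) ≤ G.degree u := by positivity
    have e4 : (0 : ℝ) ≤ G.degree w := by positivity
    have e5 : (0 : ℝ) ≤ nbrDist G u w := by positivity
    have hβ0 : 0 ≤ β := by linarith
    have e6 : 2 * θ * (G.degree u : ℝ) ≤ β * G.degree u := by nlinarith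
    have e7 : β * (G.degree u : ℝ) ≤ β * (G.degree w + nbrDist G u w) := by gcongr
    have e8 : β * (nbrDist G u w : ℝ) ≤ 1 / 100 * nbrDist G u w := by gcongr
    nlinarith

/-- Let `d = deg v`. A vertex `u` of `N(w)` similar to `v` is within `2.02 θ d` of `w`, by the
triangle inequality through `v`. Adding the error `2 θ deg u` stays below `3 θ (deg u + deg w)`,
which is at least `5.94 θ d`, so `u` is accepted. The rest of `N(w)` lies outside `N(v)` or is not
similar to `v`; this is at most `1.01 θ d + θ d` vertices. -/
lemma IsApproxTest.of_similar {β : ℝ} {A : Finset V} (h : IsApproxTest G θ β w A)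
    (hθ0 : 0 ≤ θ) (hθ : θ ≤ 1 / 1000) (hθβ : 3 * θ ≤ β) (hv : ¬ IsSparseVertex G θ v)
    (hw : w ∈ similarNbrs G θ v) :
    v ∈ A ∧ ((G.neighborFinset w \ A).card : ℝ) ≤ β * G.degree w := by
  obtain ⟨hD, hw1, hw2⟩ := dist_of_mem_similarNbrs hθ0 hθ hw
  have hβ0 : 0 ≤ β := by linarith
  have hvw : G.Adj v w := by
    have := (Finset.mem_filter.1 hw).1
    simpa using this
  have hv0 : (0 : ℝ) ≤ G.degree v := by positivity
  have hθd : 0 ≤ θ * (G.degree v : ℝ) := by positivity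
  refine ⟨h.mem v (by simpa using hvw.symm) ?_, ?_⟩
  · nlinarith
  · have hsub : similarNbrs G θ v ∩ G.neighborFinset w ⊆ A := by
      intro u hu
      rw [Finset.mem_inter] at hu
      obtain ⟨hDu, hu1, hu2⟩ := dist_of_mem_similarNbrs hθ0 hθ hu.1
      refine h.mem u hu.2 ?_
      have : (nbrDist G u w : ℝ) ≤ nbrDist G v u + nbrDist G v w := by
        rw [nbrDist_comm G v u]; exact_mod_cast nbrDist_triangle G u v w
      have h3 : θ * (G.degree u : ℝ) ≤ θ * (1.01 * G.degree v) := by gcongr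
      have h4 : 3 * θ * (0.99 * (G.degree v : ℝ) + 0.99 * G.degree v) ≤
        β * (G.degree u + G.degree w) := by gcongr
      nlinarith
    have h1 : (G.neighborFinset w \ A) ⊆ (G.neighborFinset w \ G.neighborFinset v) ∪
        (G.neighborFinset v \ similarNbrs G θ v) := by
      intro u hu
      have := @hsub u
      simp only [Finset.mem_union, Finset.mem_sdiff, Finset.mem_inter] at hu this ⊢
      tauto
    have h2 := (Finset.card_le_card h1).trans (Finset.card_union_le _ _)
    have h3 := card_neighborFinset_sdiff_le G w v
    have h4 : (G.neighborFinset v \ similarNbrs G θ v).card + (similarNbrs G θ v).card =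
        G.degree v := by
      rw [← SimpleGraph.card_neighborFinset_eq_degree]
      exact Finset.card_sdiff_add_card_eq_card (Finset.filter_subset _ _)
    have h5 := card_similarNbrs hv
    have h2' : ((G.neighborFinset w \ A).card : ℝ) ≤
        nbrDist G v w + (G.neighborFinset v \ similarNbrs G θ v).card := by
      rw [nbrDist_comm]; exact_mod_cast h2.trans (Nat.add_le_add_right h3 _)
    have h4' : ((G.neighborFinset v \ similarNbrs G θ v).card : ℝ) + (similarNbrs G θ v).card =
        G.degree v := by exact_mod_cast h4
    have h6 : 3 * θ * (0.99 * (G.degree v : ℝ)) ≤ β * G.degree w := by gcongr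
    nlinarith

lemma similarNbrs_nonempty (hθ : θ ≤ 1 / 1000) (hv : ¬ IsSparseVertex G θ v) :
    (similarNbrs G θ v).Nonempty := by
  have h := card_similarNbrs hv
  have hv0 : (0 : ℝ) ≤ G.degree v := by positivity
  have : (0 : ℝ) < (similarNbrs G θ v).card := by nlinarith
  exact Finset.card_pos.1 (by exact_mod_cast this)

/-- Clustering accepted centers yields a decomposition as soon as every non-sparse vertex has a
center among its similar neighbors. -/
theorem ClusterInv.decomposition_of_approxTest {A : ℕ → Finset V} {pass : ℕ → Prop} {m : ℕ}
    {core L : V → ℕ} (h : ClusterInv A pass m core L) {η ε β : ℝ} {ctr : ℕ → V} (hη0 : 0 < η)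
    (hη : η ≤ 1 / 10000) (hε0 : 0 < ε) (hε : ε ≤ 1) (hβ : 3 * (η * ε) ≤ β) (hβ' : β ≤ 6 * (η * ε))
    (htest : ∀ i < m, IsApproxTest G (η * ε) β (ctr i) (A i))
    (hpass : ∀ i < m, pass i ↔
      ((G.neighborFinset (ctr i) \ A i).card : ℝ) ≤ β * G.degree (ctr i))
    (hhit : ∀ v, ¬ IsSparseVertex G (η * ε) v → ∃ i < m, ctr i ∈ similarNbrs G (η * ε) v) :
    IsSparseDenseDecomposition G η ε (sparseOfLabels L) (cliquesOfLabels L) := by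
  have hθ0 : 0 < η * ε := by positivity
  have hθ1 : η * ε ≤ 1 / 10000 * ε := by gcongr
  -- Here `γ = 4 β ≤ 24 η ε`, and `20 γ ≤ 480 η ε ≤ ε` is what the smallness of `η` provides.
  refine h.isSparseDenseDecomposition (γ := 4 * β) (ctr := ctr) (by linarith) (by linarith)
    (by linarith) (fun i hi hp => ?_) (fun v hv => ?_)
  · exact (htest i hi).isDenseCenter hθ0.le hβ (by linarith) ((hpass i hi).1 hp)
  · obtain ⟨i, hi, hw⟩ := hhit v hv
    obtain ⟨h1, h2⟩ := (htest i hi).of_similar hθ0.le (by linarith) hβ hv hw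
    exact ⟨i, hi, (hpass i hi).2 h2, h1⟩

/-- Every finite graph has a sparse-dense decomposition. -/
theorem exists_isSparseDenseDecomposition (G : SimpleGraph V) [DecidableRel G.Adj] {η ε : ℝ}
    (hη0 : 0 < η) (hη : η ≤ 1 / 10000) (hε0 : 0 < ε) (hε : ε ≤ 1) :
    ∃ (sparse : Finset V) (cliques : Finset (Finset V)),
      IsSparseDenseDecomposition G η ε sparse cliques := by
  have hθ0 : 0 < η * ε := by positivity
  have hθ1 : η * ε ≤ 1 / 10000 * ε := by gcongr
  rcases isEmpty_or_nonempty V with hV | ⟨⟨v₀⟩⟩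
  · exact ⟨∅, ∅, ⟨fun v => hV.elim v, by simp, by simp, by simp, by simp, by simp⟩⟩
  let e := Fintype.equivFin V
  -- Every vertex serves as a center and distances are exact, so the smallest admissible threshold
  -- `β = 3 η ε` works. The value `v₀` is never reached.
  let ctr : ℕ → V := fun i => if h : i < Fintype.card V then e.symm ⟨i, h⟩ else v₀
  let A : ℕ → Finset V := fun i => (G.neighborFinset (ctr i)).filter fun u =>
    (nbrDist G u (ctr i) : ℝ) ≤ (3 * (η * ε)) * (G.degree u + G.degree (ctr i))
  obtain ⟨core, L, h⟩ := exists_clusterInv A (fun i =>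
    ((G.neighborFinset (ctr i) \ A i).card : ℝ) ≤ (3 * (η * ε)) * G.degree (ctr i))
    (Fintype.card V)
  refine ⟨_, _, h.decomposition_of_approxTest hη0 hη hε0 hε le_rfl (by linarith)
    (fun i _ => ⟨Finset.filter_subset _ _, fun u hu h1 => ?_, fun u hu => ?_⟩)
    (fun i _ => Iff.rfl) fun v hv => ?_⟩
  · refine Finset.mem_filter.2 ⟨hu, ?_⟩
    have : 0 ≤ 2 * (η * ε) * (G.degree u : ℝ) := by positivity
    linarith
  · have : 0 ≤ 2 * (η * ε) * (G.degree u : ℝ) := by positivity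
    have := (Finset.mem_filter.1 hu).2
    linarith
  · obtain ⟨w, hw⟩ := similarNbrs_nonempty (by linarith) hv
    refine ⟨e w, (e w).2, ?_⟩
    simpa [ctr] using hw

end Similarity

/-! ### A small imperative language over the word RAM, with a step-counting program logic. -/

section Language

/-- Expressions over program variables and the memory. -/
inductive Expr : Type
  | lit (k : ℕ) : Expr
  | var (x : ℕ) : Expr
  | op (o : WordOp) (a b : Expr) : Expr
  | mem (a : Expr) : Expr

namespace Expr

/-- The value of an expression in unbounded arithmetic. -/
def val (ρ μ : ℕ → ℕ) : Expr → ℕ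
  | lit k => k
  | var x => ρ x
  | op o a b => o.eval (a.val ρ μ) (b.val ρ μ)
  | mem a => μ (a.val ρ μ)

/-- No value computed in the evaluation reaches `W`. -/
def Fits (W : ℕ) (ρ μ : ℕ → ℕ) : Expr → Prop
  | lit k => k < W
  | var _ => True
  | op o a b => a.Fits W ρ μ ∧ b.Fits W ρ μ ∧ o.eval (a.val ρ μ) (b.val ρ μ) < W
  | mem a => a.Fits W ρ μ

/-- Code that leaves the value in the `r`-th temporary. The program variable `x` lives in the
register `2 x + 1`, the `r`-th temporary in the register `2 r`. -/
def compile : Expr → ℕ → Prog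
  | lit k, r => .const (2 * r) k
  | var x, r => .seq (.const (2 * r) 0) (.arith .add (2 * r) (2 * r) (2 * x + 1))
  | op o a b, r =>
      .seq (a.compile r) (.seq (b.compile (r + 1)) (.arith o (2 * r) (2 * r) (2 * (r + 1))))
  | mem a, r => .seq (a.compile r) (.load (2 * r) (2 * r))

/-- The running time of the code of an expression. -/
def cost : Expr → ℕ
  | lit _ => 1
  | var _ => 2
  | op _ a b => a.cost + (b.cost + 1)
  | mem a => a.cost + 1

end Expr

/-- All registers and memory cells hold words of `w` bits. -/
structure RamState.Valid (w : ℕ) (s : RamState) : Prop where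
  reg : ∀ r, s.reg r < 2 ^ w
  mem : ∀ a, s.mem a < 2 ^ w

lemma RamState.Valid.update {w : ℕ} {s : RamState} (h : s.Valid w) (r : ℕ) {x : ℕ}
    (hx : x < 2 ^ w) : RamState.Valid w ⟨Function.update s.reg r x, s.mem⟩ := by
  refine ⟨fun r' => ?_, h.mem⟩
  by_cases hr : r' = r
  · subst hr; simpa using hx
  · simpa [Function.update_of_ne hr] using h.reg r'

lemma RamState.Valid.updateMem {w : ℕ} {s : RamState} (h : s.Valid w) (a : ℕ) {x : ℕ}
    (hx : x < 2 ^ w) : RamState.Valid w ⟨s.reg, Function.update s.mem a x⟩ := by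
  refine ⟨h.reg, fun a' => ?_⟩
  by_cases ha : a' = a
  · subst ha; simpa using hx
  · simpa [Function.update_of_ne ha] using h.mem a'

/-- Temporaries below `r` survive, so the first operand of a binary operation can wait in temporary
`r` while the second is evaluated in `r + 1`. Program variables occupy odd registers, which
evaluation never writes. -/
lemma Expr.runs_compile {w : ℕ} {ρ μ : ℕ → ℕ} (e : Expr) (r : ℕ) (s : RamState) (hs : s.Valid w)
    (hρ : ∀ x, s.reg (2 * x + 1) = ρ x) (hμ : s.mem = μ) (he : e.Fits (2 ^ w) ρ μ) :
    ∃ s', Runs w (e.compile r) s s' e.cost ∧ s'.Valid w ∧ s'.mem = μ ∧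
      s'.reg (2 * r) = e.val ρ μ ∧ (∀ x, s'.reg (2 * x + 1) = ρ x) ∧
      ∀ r' < r, s'.reg (2 * r') = s.reg (2 * r') := by
  have odd : ∀ (f : ℕ → ℕ) (i x v : ℕ), Function.update f (2 * i) v (2 * x + 1) = f (2 * x + 1) :=
    fun f i x v => Function.update_of_ne (by omega) _ _
  have even : ∀ (f : ℕ → ℕ) (i v : ℕ), ∀ r' < i, Function.update f (2 * i) v (2 * r') = f (2 * r') :=
    fun f i v r' hr' => Function.update_of_ne (by omega) _ _
  induction e generalizing r s with
  | lit k =>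
    have hk : k % 2 ^ w = k := Nat.mod_eq_of_lt he
    refine ⟨_, .const s (2 * r) k, hs.update _ (by rw [hk]; exact he), hμ, ?_, ?_, ?_⟩
    · simp [hk, Expr.val]
    · intro x; simp only [odd, hρ]
    · intro r' hr'; simp only [even _ _ _ _ hr']
  | var x =>
    have hx : ρ x < 2 ^ w := by rw [← hρ]; exact hs.reg _
    refine ⟨_, .seq (.const s (2 * r) 0) (.arith _ .add (2 * r) (2 * r) (2 * x + 1)),
      (hs.update _ ?_).update _ ?_, hμ, ?_, ?_, ?_⟩
    · exact Nat.mod_lt _ (by positivity)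
    · exact Nat.mod_lt _ (by positivity)
    · simp [odd, hρ, WordOp.eval, Nat.mod_eq_of_lt hx, Expr.val]
    · intro x; simp only [odd, hρ]
    · intro r' hr'; simp only [even _ _ _ _ hr']
  | op o a b iha ihb =>
    obtain ⟨ha, hb, hab⟩ := he
    obtain ⟨s₁, h1, v1, m1, e1, f1, g1⟩ := iha r s hs hρ hμ ha
    obtain ⟨s₂, h2, v2, m2, e2, f2, g2⟩ := ihb (r + 1) s₁ v1 f1 m1 hb
    refine ⟨_, .seq h1 (.seq h2 (.arith _ o (2 * r) (2 * r) (2 * (r + 1)))), v2.update _ ?_, m2,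
      ?_, ?_, ?_⟩
    · exact Nat.mod_lt _ (by positivity)
    · simp only [Function.update_self]
      rw [g2 r (by omega), e1, e2, Nat.mod_eq_of_lt hab, Expr.val]
    · intro x; simp only [odd, f2]
    · intro r' hr'
      simp only [even _ _ _ _ hr']
      rw [g2 r' (by omega), g1 r' hr']
  | mem a iha =>
    obtain ⟨s₁, h1, v1, m1, e1, f1, g1⟩ := iha r s hs hρ hμ he
    refine ⟨_, .seq h1 (.load _ (2 * r) (2 * r)), v1.update _ (v1.mem _), m1, ?_, ?_, ?_⟩
    · simp only [Function.update_self]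
      rw [e1, m1, Expr.val]
    · intro x; simp only [odd, f1]
    · intro r' hr'
      simp only [even _ _ _ _ hr', g1 r' hr']

/-- Assign the value of an expression to a program variable. -/
def Prog.assign (x : ℕ) (e : Expr) : Prog :=
  .seq (e.compile 0) (.seq (.const (2 * x + 1) 0) (.arith .add (2 * x + 1) (2 * x + 1) 0))

/-- Store the value of `e` in the memory cell with address `a`. -/
def Prog.put (a e : Expr) : Prog :=
  .seq (a.compile 0) (.seq (e.compile 1) (.store 0 2))

/-- Branch on whether the value of an expression is nonzero. -/
def Prog.cond (e : Expr) (p q : Prog) : Prog :=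
  .seq (e.compile 0) (.ite 0 p q)

/-- Run `p` while the value of an expression is nonzero. -/
def Prog.whileLoop (e : Expr) (p : Prog) : Prog :=
  .seq (e.compile 0) (.loop 0 (.seq p (e.compile 0)))

/-- Run `p` with the variable `i` equal to `0, 1, …` up to the value of the variable `N`. -/
def Prog.forLoop (i N : ℕ) (p : Prog) : Prog :=
  .seq (.assign i (.lit 0)) (.whileLoop (.op .lt (.var i) (.var N))
    (.seq p (.assign i (.op .add (.var i) (.lit 1)))))

/-- Started with the variables `ρ` and the memory `μ`, the program halts within `B` steps, with
variables and memory satisfying `Q`. -/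
def WP (w : ℕ) (p : Prog) (B : ℕ) (ρ μ : ℕ → ℕ) (Q : (ℕ → ℕ) → (ℕ → ℕ) → Prop) : Prop :=
  ∀ s : RamState, s.Valid w → (∀ x, s.reg (2 * x + 1) = ρ x) → s.mem = μ →
    ∃ s' T, Runs w p s s' T ∧ T ≤ B ∧ s'.Valid w ∧ Q (fun x => s'.reg (2 * x + 1)) s'.mem

namespace WP

variable {w : ℕ} {p q : Prog} {B B' : ℕ} {ρ μ : ℕ → ℕ} {Q Q' : (ℕ → ℕ) → (ℕ → ℕ) → Prop}

lemma mono (h : WP w p B ρ μ Q) (hB : B ≤ B') (hQ : ∀ ρ μ, Q ρ μ → Q' ρ μ) :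
    WP w p B' ρ μ Q' := by
  intro s hs hρ hμ
  obtain ⟨s', T, h1, h2, h3, h4⟩ := h s hs hρ hμ
  exact ⟨s', T, h1, h2.trans hB, h3, hQ _ _ h4⟩

lemma skip (h : Q ρ μ) : WP w .skip 1 ρ μ Q := by
  intro s hs hρ hμ
  refine ⟨s, 1, .skip s, le_rfl, hs, ?_⟩
  rwa [funext hρ, hμ]

lemma seq (h : WP w p B ρ μ fun ρ μ => WP w q B' ρ μ Q) : WP w (.seq p q) (B + B') ρ μ Q := by
  intro s hs hρ hμ
  obtain ⟨s₁, T₁, h1, h2, h3, h4⟩ := h s hs hρ hμ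
  obtain ⟨s₂, T₂, g1, g2, g3, g4⟩ := h4 s₁ h3 (fun _ => rfl) rfl
  exact ⟨s₂, _, .seq h1 g1, by omega, g3, g4⟩

lemma assign {x : ℕ} {e : Expr} (he : e.Fits (2 ^ w) ρ μ)
    (h : Q (Function.update ρ x (e.val ρ μ)) μ) : WP w (.assign x e) (e.cost + 2) ρ μ Q := by
  intro s hs hρ hμ
  obtain ⟨s₁, h1, v1, m1, e1, f1, -⟩ := e.runs_compile 0 s hs hρ hμ he
  have hv : e.val ρ μ < 2 ^ w := by rw [← e1]; exact v1.reg _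
  refine ⟨_, _, .seq h1 (.seq (.const _ (2 * x + 1) 0)
    (.arith _ .add (2 * x + 1) (2 * x + 1) 0)), le_rfl, (v1.update _ ?_).update _ ?_, ?_⟩
  · exact Nat.mod_lt _ (by positivity)
  · exact Nat.mod_lt _ (by positivity)
  · convert h using 1
    funext y
    simp only [mul_zero] at e1
    dsimp only
    by_cases hy : y = x
    · subst hy
      simp [WordOp.eval, e1, Nat.mod_eq_of_lt hv]
    · rw [Function.update_of_ne hy, Function.update_of_ne (by omega),
        Function.update_of_ne (by omega), f1]

lemma put {a e : Expr} (ha : a.Fits (2 ^ w) ρ μ) (he : e.Fits (2 ^ w) ρ μ)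
    (h : Q ρ (Function.update μ (a.val ρ μ) (e.val ρ μ))) :
    WP w (.put a e) (a.cost + (e.cost + 1)) ρ μ Q := by
  intro s hs hρ hμ
  obtain ⟨s₁, h1, v1, m1, e1, f1, -⟩ := a.runs_compile 0 s hs hρ hμ ha
  obtain ⟨s₂, h2, v2, m2, e2, f2, g2⟩ := e.runs_compile 1 s₁ v1 f1 m1 he
  have e1' : s₂.reg 0 = a.val ρ μ := by rw [← e1]; exact g2 0 one_pos
  have e2' : s₂.reg 2 = e.val ρ μ := e2
  refine ⟨_, _, .seq h1 (.seq h2 (.store _ 0 2)), le_rfl, v2.updateMem _ (v2.reg _), ?_⟩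
  simpa only [f2, m2, e1', e2'] using h

lemma cond {e : Expr} (he : e.Fits (2 ^ w) ρ μ) (h1 : e.val ρ μ ≠ 0 → WP w p B ρ μ Q)
    (h0 : e.val ρ μ = 0 → WP w q B' ρ μ Q) :
    WP w (.cond e p q) (e.cost + (max B B' + 1)) ρ μ Q := by
  intro s hs hρ hμ
  obtain ⟨s₁, r1, v1, m1, e1, f1, -⟩ := e.runs_compile 0 s hs hρ hμ he
  have e1' : s₁.reg 0 = e.val ρ μ := e1
  by_cases hv : e.val ρ μ = 0
  · obtain ⟨s₂, T, g1, g2, g3, g4⟩ := h0 hv s₁ v1 f1 m1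
    exact ⟨s₂, _, .seq r1 (.ite_false (by rw [e1', hv]) g1), by omega, g3, g4⟩
  · obtain ⟨s₂, T, g1, g2, g3, g4⟩ := h1 hv s₁ v1 f1 m1
    exact ⟨s₂, _, .seq r1 (.ite_true (by rw [e1']; exact hv) g1), by omega, g3, g4⟩

lemma whileLoop_exit {e : Expr} (he : e.Fits (2 ^ w) ρ μ) (h0 : e.val ρ μ = 0) (hQ : Q ρ μ) :
    WP w (.whileLoop e p) (e.cost + 1) ρ μ Q := by
  intro s hs hρ hμ
  obtain ⟨s₁, r1, v1, m1, e1, f1, -⟩ := e.runs_compile 0 s hs hρ hμ he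
  have e1' : s₁.reg 0 = e.val ρ μ := e1
  refine ⟨s₁, _, .seq r1 (.loop_exit (by rw [e1', h0])), le_rfl, v1, ?_⟩
  simpa only [f1, m1] using hQ

lemma whileLoop_step {e : Expr} (he : e.Fits (2 ^ w) ρ μ) (h0 : e.val ρ μ ≠ 0)
    (h : WP w p B ρ μ fun ρ μ => WP w (.whileLoop e p) B' ρ μ Q) :
    WP w (.whileLoop e p) (e.cost + B + B' + 1) ρ μ Q := by
  intro s hs hρ hμ
  obtain ⟨s₁, r1, v1, m1, e1, f1, -⟩ := e.runs_compile 0 s hs hρ hμ he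
  have e1' : s₁.reg 0 = e.val ρ μ := e1
  obtain ⟨s₂, T, g1, g2, g3, g4⟩ := h s₁ v1 f1 m1
  obtain ⟨s₃, T', k1, k2, k3, k4⟩ := g4 s₂ g3 (fun _ => rfl) rfl
  -- The remaining run begins by evaluating the condition. That evaluation is regrouped as the end
  -- of the current loop body.
  cases k1 with
  | seq k1 k1' =>
    exact ⟨s₃, _, .seq r1 (.loop_step (by rw [e1']; exact h0) (.seq g1 k1) k1'), by omega, k3, k4⟩

/-- The rule for counting loops, with invariant `I`. -/
lemma forLoop (hw : 1 ≤ w) {i N m : ℕ} {cost : ℕ → ℕ} (I : ℕ → (ℕ → ℕ) → (ℕ → ℕ) → Prop)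
    (h0 : I 0 (Function.update ρ i 0) μ) (hi : ∀ k ρ μ, I k ρ μ → ρ i = k)
    (hN : ∀ k ρ μ, I k ρ μ → ρ N = m)
    (hstep : ∀ k < m, ∀ ρ μ, I k ρ μ → WP w p (cost k) ρ μ
      fun ρ μ => ρ i = k ∧ I (k + 1) (Function.update ρ i (k + 1)) μ)
    (hQ : ∀ ρ μ, I m ρ μ → Q ρ μ) :
    WP w (.forLoop i N p) (∑ k ∈ Finset.range m, (cost k + 12) + 9) ρ μ Q := by
  have h2 : 1 < 2 ^ w := Nat.one_lt_two_pow (by omega)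
  have hfit : ∀ ρ μ, (Expr.op .lt (.var i) (.var N)).Fits (2 ^ w) ρ μ := by
    intro ρ μ
    refine ⟨trivial, trivial, ?_⟩
    change (if ρ i < ρ N then 1 else 0) < 2 ^ w
    split_ifs <;> omega
  have hval : ∀ k ρ μ, I k ρ μ →
      (Expr.op .lt (.var i) (.var N)).val ρ μ = if k < m then 1 else 0 := by
    intro k ρ μ hI
    simp only [Expr.val, WordOp.eval, hi _ _ _ hI, hN _ _ _ hI]
  -- Each round adds 5 steps for the test, 6 for the increment and 1 for the branch; the final test
  -- with the exit takes 6.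
  have key : ∀ l k, k + l = m → ∀ ρ μ, I k ρ μ →
      WP w (.whileLoop (.op .lt (.var i) (.var N)) (.seq p (.assign i (.op .add (.var i) (.lit 1)))))
        (∑ k ∈ Finset.Ico k m, (cost k + 12) + 6) ρ μ Q := by
    intro l
    induction l with
    | zero =>
      intro k hk ρ μ hI
      obtain rfl : k = m := by omega
      refine (whileLoop_exit (hfit ρ μ) ?_ (hQ _ _ hI)).mono ?_ fun _ _ h => h
      · rw [hval _ _ _ hI, if_neg (lt_irrefl _)]
      · simp [Expr.cost]
    | succ l ih =>
      intro k hk ρ μ hI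
      have hkm : k < m := by omega
      refine (whileLoop_step (B := cost k + 6) (B' := ∑ k ∈ Finset.Ico (k + 1) m, (cost k + 12) + 6)
        (hfit ρ μ) ?_ (seq (B' := 6) ?_)).mono ?_ fun _ _ h => h
      · rw [hval _ _ _ hI, if_pos hkm]; exact one_ne_zero
      -- The increment cannot overflow, because `m` is the content of a register. If `m` were not a
      -- word, no valid state would have these variables and the claim would be vacuous.
      · have hm : m < 2 ^ w ∨ ¬ m < 2 ^ w := em _
        rcases hm with hm | hm
        · refine (hstep k hkm ρ μ hI).mono le_rfl fun ρ' μ' h => ?_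
          refine assign ⟨trivial, h2, ?_⟩ ?_
          · simp only [Expr.val, WordOp.eval, h.1]; omega
          · have := ih (k + 1) (by omega) _ _ h.2
            simpa only [Expr.val, WordOp.eval, h.1] using this
        · intro s hs hρ _
          exact absurd (by rw [← hN _ _ _ hI, ← hρ]; exact hs.reg _) hm
      · rw [Finset.sum_eq_sum_Ico_succ_bot hkm]
        simp only [Expr.cost]
        omega
  refine (seq (B := 3) (assign (e := .lit 0) (by simp only [Expr.Fits]; omega) ?_)).mono
    (B := 3 + (∑ k ∈ Finset.range m, (cost k + 12) + 6)) (by omega) fun _ _ h => h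
  have := key m 0 (by omega) _ _ h0
  rwa [← Finset.range_eq_Ico] at this

end WP

end Language

/-! ### Overflow-free evaluation of expressions, and rules with explicit step budgets. -/

section Evaluation

/-- The expression `e` evaluates to `v` without overflow. -/
structure Ev (w : ℕ) (ρ μ : ℕ → ℕ) (e : Expr) (v : ℕ) : Prop where
  fits : e.Fits (2 ^ w) ρ μ
  val_eq : e.val ρ μ = v

namespace Ev

variable {w : ℕ} {ρ μ : ℕ → ℕ} {a b : Expr} {x y v : ℕ}

lemma lit (h : v < 2 ^ w) : Ev w ρ μ (.lit v) v := ⟨h, rfl⟩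

lemma var (h : ρ x = v) : Ev w ρ μ (.var x) v := ⟨trivial, h⟩

lemma mem (ha : Ev w ρ μ a x) (h : μ x = v) : Ev w ρ μ (.mem a) v :=
  ⟨ha.fits, by rw [Expr.val, ha.val_eq, h]⟩

lemma op (o : WordOp) (ha : Ev w ρ μ a x) (hb : Ev w ρ μ b y) (h : o.eval x y < 2 ^ w) :
    Ev w ρ μ (.op o a b) (o.eval x y) :=
  ⟨⟨ha.fits, hb.fits, by rw [ha.val_eq, hb.val_eq]; exact h⟩,
    by rw [Expr.val, ha.val_eq, hb.val_eq]⟩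

lemma add (ha : Ev w ρ μ a x) (hb : Ev w ρ μ b y) (h : x + y < 2 ^ w) :
    Ev w ρ μ (.op .add a b) (x + y) := op .add ha hb h

lemma mul (ha : Ev w ρ μ a x) (hb : Ev w ρ μ b y) (h : x * y < 2 ^ w) :
    Ev w ρ μ (.op .mul a b) (x * y) := op .mul ha hb h

lemma lt (hw : 1 < 2 ^ w) (ha : Ev w ρ μ a x) (hb : Ev w ρ μ b y) :
    Ev w ρ μ (.op .lt a b) (if x < y then 1 else 0) :=
  op .lt ha hb (by change (if x < y then 1 else 0) < 2 ^ w; split_ifs <;> omega)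

lemma eq (hw : 1 < 2 ^ w) (ha : Ev w ρ μ a x) (hb : Ev w ρ μ b y) :
    Ev w ρ μ (.op .eq a b) (if x = y then 1 else 0) :=
  op .eq ha hb (by change (if x = y then 1 else 0) < 2 ^ w; split_ifs <;> omega)

end Ev

namespace WP

variable {w : ℕ} {p q : Prog} {B B' : ℕ} {ρ μ : ℕ → ℕ} {Q : (ℕ → ℕ) → (ℕ → ℕ) → Prop}

lemma assign_of_ev {x v : ℕ} {e : Expr} (he : Ev w ρ μ e v) (h : Q (Function.update ρ x v) μ) :
    WP w (.assign x e) (e.cost + 2) ρ μ Q :=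
  assign he.fits (by rwa [he.val_eq])

lemma put_of_ev {x v : ℕ} {a e : Expr} (ha : Ev w ρ μ a x) (he : Ev w ρ μ e v)
    (h : Q ρ (Function.update μ x v)) : WP w (.put a e) (a.cost + (e.cost + 1)) ρ μ Q :=
  put ha.fits he.fits (by rwa [ha.val_eq, he.val_eq])

/-- Here and in the next rules the budget is given in advance, so that cost bounds become separate
arithmetic side goals. -/
lemma seq_le {B'' : ℕ} (B' : ℕ) (h : WP w p B ρ μ fun ρ μ => WP w q B' ρ μ Q)
    (hB : B + B' ≤ B'' := by first | decide | (simp only [Expr.cost]; omega)) :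
    WP w (.seq p q) B'' ρ μ Q := (seq h).mono hB fun _ _ h => h

lemma skip_le (h : Q ρ μ) (hB : 1 ≤ B := by omega) : WP w .skip B ρ μ Q :=
  (skip h).mono hB fun _ _ h => h

lemma assign_le {x v : ℕ} {e : Expr} (he : Ev w ρ μ e v) (h : Q (Function.update ρ x v) μ)
    (hB : e.cost + 2 ≤ B := by first | decide | (simp only [Expr.cost]; omega)) :
    WP w (.assign x e) B ρ μ Q := (assign_of_ev he h).mono hB fun _ _ h => h

lemma put_le {x v : ℕ} {a e : Expr} (ha : Ev w ρ μ a x) (he : Ev w ρ μ e v)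
    (h : Q ρ (Function.update μ x v))
    (hB : a.cost + (e.cost + 1) ≤ B := by first | decide | (simp only [Expr.cost]; omega)) :
    WP w (.put a e) B ρ μ Q := (put_of_ev ha he h).mono hB fun _ _ h => h

lemma cond_le (B' : ℕ) {v : ℕ} {e : Expr} (he : Ev w ρ μ e v) (h1 : v ≠ 0 → WP w p B' ρ μ Q)
    (h0 : v = 0 → WP w q B' ρ μ Q)
    (hB : e.cost + (B' + 1) ≤ B := by first | decide | (simp only [Expr.cost]; omega)) :
    WP w (.cond e p q) B ρ μ Q :=
  (cond he.fits (by rwa [he.val_eq]) (by rwa [he.val_eq])).mono (by simpa using hB) fun _ _ h => h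

end WP

end Evaluation

/-! ### The recovery program and the counting loop. -/

section Recovery

open Expr

local infixl:65 " ∔ " => Expr.op WordOp.add
local infixl:70 " ⋇ " => Expr.op WordOp.mul

/-- Count the samples in the current neighborhood of the vertex whose samples start at the address
in the variable `15`. -/
def countLoop : Prog :=
  .forLoop 9 1 (.assign 10
    (var 10 ∔ .op .eq (mem (var 3 ∔ mem (var 15 ∔ var 9))) (var 14)))

/-- Mark the current neighborhood. -/
def markLoop : Prog :=
  .forLoop 7 6 (.put (var 3 ∔ mem (var 4 ∔ lit 1 ∔ var 7)) (var 14))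

/-- Test the `k`-th neighbor of the current center, `k` being the variable `7`. -/
def testBody (M : ℕ) : Prog :=
  .seq (.assign 8 (mem (var 4 ∔ lit 1 ∔ var 7)))
  (.seq (.assign 13 (mem (lit 3 ∔ var 8)))
  (.seq (.assign 15 (lit 3 ∔ var 0 ∔ var 8 ⋇ var 1))
  (.seq (.assign 10 (lit 0))
  (.seq countLoop
  -- With `m` hits among `t` samples, the distance is estimated by `deg u + d - 2 (deg u) m / t`.
  -- The neighbor is rejected if this exceeds `(deg u + d) / M`; denominators are cleared and the
  -- subtraction is moved across, since machine subtraction truncates.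
  (.cond (.op .lt (lit 2 ⋇ lit M ⋇ var 13 ⋇ var 10 ∔ var 1 ⋇ (var 13 ∔ var 6))
      (lit M ⋇ (var 1 ⋇ (var 13 ∔ var 6))))
    .skip
    (.seq (.put (var 3 ∔ var 0 ∔ var 8) (var 14))
    (.seq (.assign 11 (var 11 ∔ lit 1))
      (.cond (mem (var 3 ∔ lit 2 ⋇ var 0 ∔ var 8))
        (.assign 12 (mem (var 3 ∔ lit 2 ⋇ var 0 ∔ var 8))) .skip))))))))

/-- Label the `k`-th neighbor of the current center, `k` being the variable `7`, if it has passed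
the test. -/
def labelBody : Prog :=
  .seq (.assign 8 (mem (var 4 ∔ lit 1 ∔ var 7)))
  (.cond (.op .eq (mem (var 3 ∔ var 0 ∔ var 8)) (var 14))
    (.cond (var 12)
      (.cond (mem (var 3 ∔ lit 3 ⋇ var 0 ∔ var 8)) .skip
        (.put (var 3 ∔ lit 3 ⋇ var 0 ∔ var 8) (var 12)))
      (.seq (.put (var 3 ∔ lit 2 ⋇ var 0 ∔ var 8) (var 14))
        (.put (var 3 ∔ lit 3 ⋇ var 0 ∔ var 8) (var 14))))
    .skip)

/-- Process the sampled vertex whose record starts at the address in the variable `4`. -/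
def roundBody (M : ℕ) : Prog :=
  .seq (.assign 6 (mem (lit 3 ∔ mem (var 4))))
  -- The stamp, one more than the round number, is nonzero and new in each round. Marks and
  -- acceptances of earlier rounds are thereby invalidated without clearing the arrays.
  (.seq (.assign 14 (var 5 ∔ lit 1))
  (.seq markLoop
  (.seq (.assign 11 (lit 0))
  (.seq (.assign 12 (lit 0))
  (.seq (.forLoop 7 6 (testBody M))
  (.seq (.cond (.op .lt (var 6 ∔ lit M ⋇ var 11) (lit M ⋇ var 6)) .skip
      (.forLoop 7 6 labelBody))
    (.assign 4 (var 4 ∔ lit 1 ∔ var 6))))))))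

/-- The recovery program. -/
def recoveryProg (M : ℕ) : Prog :=
  .seq (.assign 0 (mem (lit 0)))
  (.seq (.assign 1 (mem (lit 1)))
  (.seq (.assign 2 (mem (lit 2)))
  -- The work arrays start at `(n + t + 3)²`, which is at least the length of the input, so their
  -- cells are initially zero.
  (.seq (.assign 3 ((var 0 ∔ var 1 ∔ lit 3) ⋇ (var 0 ∔ var 1 ∔ lit 3)))
  (.seq (.assign 4 (lit 3 ∔ var 0 ∔ var 0 ⋇ var 1))
  (.seq (.forLoop 5 2 (roundBody M))
    (.forLoop 7 0 (.put (var 7) (mem (var 3 ∔ lit 3 ⋇ var 0 ∔ var 7)))))))))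

variable {w : ℕ} {ρ μ : ℕ → ℕ} {Q : (ℕ → ℕ) → (ℕ → ℕ) → Prop}

lemma countLoop_spec (hw : 1 ≤ w) (h10 : ρ 10 = 0)
    (hB : ∀ i < ρ 1, ρ 15 + i < 2 ^ w ∧ ρ 3 + μ (ρ 15 + i) < 2 ^ w) (ht : ρ 1 < 2 ^ w)
    (hQ : Q (Function.update (Function.update ρ 10
      (∑ i ∈ Finset.range (ρ 1), if μ (ρ 3 + μ (ρ 15 + i)) = ρ 14 then 1 else 0)) 9 (ρ 1)) μ) :
    WP w countLoop (ρ 1 * 40 + 9) ρ μ Q := by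
  have h2 : 1 < 2 ^ w := Nat.one_lt_two_pow (by omega)
  set S : ℕ → ℕ := fun k =>
    ∑ i ∈ Finset.range k, if μ (ρ 3 + μ (ρ 15 + i)) = ρ 14 then 1 else 0 with hS
  have hSle : ∀ k, S k ≤ k := fun k => by
    refine (Finset.sum_le_card_nsmul _ _ 1 fun i _ => ?_).trans (by simp)
    split_ifs <;> omega
  refine (WP.forLoop (m := ρ 1) (cost := fun _ => 28) hw (fun k ρ' μ' => μ = μ' ∧
    ρ' = Function.update (Function.update ρ 10 (S k)) 9 k) ⟨rfl, ?_⟩ ?_ ?_ ?_ ?_).mono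
      (by simp) fun _ _ h => h
  · have : S 0 = ρ 10 := by simp [hS, h10]
    rw [this, Function.update_eq_self]
  · rintro k _ _ ⟨-, rfl⟩; simp
  · rintro k _ _ ⟨-, rfl⟩; simp
  · rintro k hk _ _ ⟨rfl, rfl⟩
    obtain ⟨b1, b2⟩ := hB k hk
    have hk' := hSle (k + 1)
    refine WP.assign_le (v := S (k + 1)) ?_ ⟨by simp, rfl, ?_⟩
    · have e : S (k + 1) = S k + if μ (ρ 3 + μ (ρ 15 + k)) = ρ 14 then 1 else 0 :=
        Finset.sum_range_succ _ _
      rw [e] at hk' ⊢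
      exact .add (.var (by simp)) (.eq h2 (.mem (.add (.var (by simp))
        (.mem (.add (.var (by simp)) (.var (by simp)) b1) rfl) b2) rfl) (.var (by simp)))
        (by omega)
    · funext x
      simp only [Function.update_apply]
      split_ifs <;> simp_all
  · rintro _ _ ⟨rfl, rfl⟩
    exact hQ

end Recovery

/-! ### Memory representation, and the loops that mark and test the neighbors of a center. -/

section Rounds

/-- The memory `μ` consists of the input, below the address `B`, and of four arrays of length `n`
stored from the address `B` on. -/
structure MemRep (B n : ℕ) (inp mark accepted core label μ : ℕ → ℕ) : Prop where
  inp : ∀ a < B, μ a = inp a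
  mark : ∀ v < n, μ (B + v) = mark v
  accepted : ∀ v < n, μ (B + n + v) = accepted v
  core : ∀ v < n, μ (B + 2 * n + v) = core v
  label : ∀ v < n, μ (B + 3 * n + v) = label v

namespace MemRep

variable {B n : ℕ} {inp mark accepted core label μ f : ℕ → ℕ} {u x : ℕ}

lemma set_mark (h : MemRep B n inp mark accepted core label μ) (hu : u < n)
    (hf : ∀ v < n, f v = if v = u then x else mark v) :
    MemRep B n inp f accepted core label (Function.update μ (B + u) x) := by
  refine ⟨fun a ha => ?_, fun v hv => ?_, fun v hv => ?_, fun v hv => ?_, fun v hv => ?_⟩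
  · rw [Function.update_of_ne (by omega), h.inp a ha]
  · rw [hf v hv, Function.update_apply, h.mark v hv]
    exact if_congr (by omega) rfl rfl
  · rw [Function.update_of_ne (by omega), h.accepted v hv]
  · rw [Function.update_of_ne (by omega), h.core v hv]
  · rw [Function.update_of_ne (by omega), h.label v hv]

lemma set_accepted (h : MemRep B n inp mark accepted core label μ) (hu : u < n)
    (hf : ∀ v < n, f v = if v = u then x else accepted v) :
    MemRep B n inp mark f core label (Function.update μ (B + n + u) x) := by
  refine ⟨fun a ha => ?_, fun v hv => ?_, fun v hv => ?_, fun v hv => ?_, fun v hv => ?_⟩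
  · rw [Function.update_of_ne (by omega), h.inp a ha]
  · rw [Function.update_of_ne (by omega), h.mark v hv]
  · rw [hf v hv, Function.update_apply, h.accepted v hv]
    exact if_congr (by omega) rfl rfl
  · rw [Function.update_of_ne (by omega), h.core v hv]
  · rw [Function.update_of_ne (by omega), h.label v hv]

lemma set_core (h : MemRep B n inp mark accepted core label μ) (hu : u < n)
    (hf : ∀ v < n, f v = if v = u then x else core v) :
    MemRep B n inp mark accepted f label (Function.update μ (B + 2 * n + u) x) := by
  refine ⟨fun a ha => ?_, fun v hv => ?_, fun v hv => ?_, fun v hv => ?_, fun v hv => ?_⟩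
  · rw [Function.update_of_ne (by omega), h.inp a ha]
  · rw [Function.update_of_ne (by omega), h.mark v hv]
  · rw [Function.update_of_ne (by omega), h.accepted v hv]
  · rw [hf v hv, Function.update_apply, h.core v hv]
    exact if_congr (by omega) rfl rfl
  · rw [Function.update_of_ne (by omega), h.label v hv]

lemma set_label (h : MemRep B n inp mark accepted core label μ) (hu : u < n)
    (hf : ∀ v < n, f v = if v = u then x else label v) :
    MemRep B n inp mark accepted core f (Function.update μ (B + 3 * n + u) x) := by
  refine ⟨fun a ha => ?_, fun v hv => ?_, fun v hv => ?_, fun v hv => ?_, fun v hv => ?_⟩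
  · rw [Function.update_of_ne (by omega), h.inp a ha]
  · rw [Function.update_of_ne (by omega), h.mark v hv]
  · rw [Function.update_of_ne (by omega), h.accepted v hv]
  · rw [Function.update_of_ne (by omega), h.core v hv]
  · rw [hf v hv, Function.update_apply, h.label v hv]
    exact if_congr (by omega) rfl rfl

lemma congr {mark' accepted' core' label' : ℕ → ℕ}
    (h : MemRep B n inp mark accepted core label μ) (h1 : ∀ v < n, mark' v = mark v)
    (h2 : ∀ v < n, accepted' v = accepted v) (h3 : ∀ v < n, core' v = core v)
    (h4 : ∀ v < n, label' v = label v) : MemRep B n inp mark' accepted' core' label' μ :=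
  ⟨h.inp, fun v hv => (h.mark v hv).trans (h1 v hv).symm,
    fun v hv => (h.accepted v hv).trans (h2 v hv).symm,
    fun v hv => (h.core v hv).trans (h3 v hv).symm,
    fun v hv => (h.label v hv).trans (h4 v hv).symm⟩

end MemRep

/-- Words are long enough for the addresses and numbers that occur in the recovery program. -/
structure WordBound (w n t M B : ℕ) : Prop where
  addr : B + 4 * n + t + 10 < 2 ^ w
  arith : (2 * M + 2) * (n + 1) * (t + 1) < 2 ^ w
  input : 3 + n + n * t ≤ B

namespace WordBound

variable {w n t M B a d m : ℕ}

lemma one_le (h : WordBound w n t M B) : 1 ≤ w := by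
  by_contra hw
  obtain rfl : w = 0 := by omega
  have := h.addr
  simp at this

lemma test (h : WordBound w n t M B) (ha : a ≤ n) (hd : d ≤ n) (hm : m ≤ t) :
    2 * M * a * m + t * (a + d) < 2 ^ w ∧ M * (t * (a + d)) < 2 ^ w ∧ 2 * M * a < 2 ^ w ∧
      2 * M < 2 ^ w ∧ M < 2 ^ w ∧ d + M * a < 2 ^ w := by
  have e1 : M * a * m ≤ M * n * t := Nat.mul_le_mul (Nat.mul_le_mul le_rfl ha) hm
  have e2 : t * (a + d) ≤ t * (n + n) := Nat.mul_le_mul le_rfl (by omega)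
  have e3 : M * (t * (a + d)) ≤ M * (t * (n + n)) := Nat.mul_le_mul le_rfl e2
  have e4 : M * a ≤ M * n := Nat.mul_le_mul le_rfl ha
  have e5 := h.arith
  refine ⟨?_, ?_, ?_, ?_, ?_, ?_⟩ <;> refine lt_of_le_of_lt ?_ e5
  all_goals nlinarith [Nat.zero_le (M * n * t), Nat.zero_le (M * n), Nat.zero_le (n * t),
    Nat.zero_le (M * t)]

end WordBound

/-- The contents of the input that concern a sampled vertex of degree `d`, whose record starts at
the address `ptr` and whose neighbors are `nb 0, …, nb (d - 1)`. -/
structure Round (n t B ptr d : ℕ) (dg : ℕ → ℕ) (sp : ℕ → ℕ → ℕ) (nb inp : ℕ → ℕ) : Prop where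
  ptr_le : ptr + 1 + d ≤ B
  d_le : d ≤ n
  nbr : ∀ k < d, inp (ptr + 1 + k) = nb k
  nbr_lt : ∀ k < d, nb k < n
  deg : ∀ v < n, inp (3 + v) = dg v
  deg_le : ∀ v < n, dg v ≤ n
  sample : ∀ v < n, ∀ i < t, inp (3 + n + v * t + i) = sp v i
  sample_lt : ∀ v < n, ∀ i < t, sp v i < n

/-- The values of the variables that do not change in the loops over the neighbors. -/
structure Regs (n t B ptr d st : ℕ) (ρ : ℕ → ℕ) : Prop where
  n : ρ 0 = n
  t : ρ 1 = t
  B : ρ 3 = B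
  ptr : ρ 4 = ptr
  d : ρ 6 = d
  st : ρ 14 = st

/-- The variables that do not change in the loops over the neighbors are the same in `ρ` and
`ρ'`. -/
def Frame (ρ ρ' : ℕ → ℕ) : Prop := ∀ x, x < 7 ∨ x = 14 → ρ' x = ρ x

lemma Frame.refl (ρ : ℕ → ℕ) : Frame ρ ρ := fun _ _ => rfl

lemma Frame.update {ρ ρ' : ℕ → ℕ} (h : Frame ρ ρ') {x : ℕ} (v : ℕ) (hx : 7 ≤ x ∧ x ≠ 14) :
    Frame ρ (Function.update ρ' x v) := fun y hy => by
  rw [Function.update_of_ne (by omega)]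
  exact h y hy

lemma Regs.frame {n t B ptr d st : ℕ} {ρ ρ' : ℕ → ℕ} (h : Regs n t B ptr d st ρ)
    (hF : Frame ρ ρ') : Regs n t B ptr d st ρ' :=
  ⟨by rw [hF 0 (by omega), h.n], by rw [hF 1 (by omega), h.t], by rw [hF 3 (by omega), h.B],
    by rw [hF 4 (by omega), h.ptr], by rw [hF 6 (by omega), h.d], by rw [hF 14 (by omega), h.st]⟩

/-- The test deciding whether the neighborhood of `v` is close to the set `N` of size `d`. -/
def Accepts (M t d : ℕ) (dg : ℕ → ℕ) (sp : ℕ → ℕ → ℕ) (N : Finset ℕ) (v : ℕ) : Prop :=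
  M * (t * (dg v + d)) ≤
    2 * M * dg v * (∑ i ∈ Finset.range t, if sp v i ∈ N then 1 else 0) + t * (dg v + d)

instance (M t d : ℕ) (dg : ℕ → ℕ) (sp : ℕ → ℕ → ℕ) (N : Finset ℕ) (v : ℕ) :
    Decidable (Accepts M t d dg sp N v) := Nat.decLe _ _

variable {w n t M B ptr d st : ℕ} {dg : ℕ → ℕ} {sp : ℕ → ℕ → ℕ} {nb inp : ℕ → ℕ}
  {mark accepted core label : ℕ → ℕ} {ρ μ : ℕ → ℕ} {Q : (ℕ → ℕ) → (ℕ → ℕ) → Prop}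

lemma mem_image_range_succ {nb : ℕ → ℕ} {k v : ℕ} :
    v ∈ (Finset.range (k + 1)).image nb ↔ v = nb k ∨ v ∈ (Finset.range k).image nb := by
  rw [Finset.range_add_one, Finset.image_insert, Finset.mem_insert]

lemma markLoop_spec (hW : WordBound w n t M B) (hD : Round n t B ptr d dg sp nb inp)
    (hr : Regs n t B ptr d st ρ) (hR : MemRep B n inp mark accepted core label μ)
    (hQ : ∀ ρ' μ', Frame ρ ρ' →
      MemRep B n inp (fun v => if v ∈ (Finset.range d).image nb then st else mark v) accepted core
        label μ' → Q ρ' μ') :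
    WP w markLoop (d * 40 + 9) ρ μ Q := by
  have haddr := hW.addr
  refine (WP.forLoop (m := d) (cost := fun _ => 28) hW.one_le (fun k ρ' μ' => Frame ρ ρ' ∧
    ρ' 7 = k ∧ MemRep B n inp (fun v => if v ∈ (Finset.range k).image nb then st else mark v) accepted
      core label μ') ⟨(Frame.refl ρ).update _ (by omega), by simp, by simpa using hR⟩ ?_ ?_ ?_
      ?_).mono (by simp) fun _ _ h => h
  · exact fun k ρ' μ' h => h.2.1
  · exact fun k ρ' μ' h => (hr.frame h.1).d
  · rintro k hk ρ' μ' ⟨hF, h7, hR'⟩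
    have hr' := hr.frame hF
    have hp := hD.ptr_le
    have hn := hD.nbr_lt k hk
    refine WP.put_le (x := B + nb k) (v := st) (.add (.var hr'.B) (.mem (.add (.add
      (.var hr'.ptr) (.lit (by omega)) (by omega)) (.var h7) (by omega)) ?_) (by omega))
      (.var hr'.st) ⟨h7, hF.update _ (by omega), by simp, ?_⟩
    · rw [hR'.inp _ (by omega), hD.nbr k hk]
    · refine hR'.set_mark hn fun v _ => ?_
      simp only [mem_image_range_succ]
      by_cases hv : v = nb k <;> simp [hv]
  · rintro ρ' μ' ⟨hF, -, hR'⟩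
    exact hQ _ _ hF hR'

lemma sample_index_lt {n t v i : ℕ} (hv : v < n) (hi : i < t) : v * t + i < n * t := by
  have : (v + 1) * t ≤ n * t := Nat.mul_le_mul hv le_rfl
  nlinarith

/-- Besides stamping the accepted neighbors and counting them, the loop looks for a core to join:
variable `12` stays `0` exactly when no accepted neighbor is in a core, and otherwise ends with the
label of a core that the accepted set meets. -/
lemma testLoop_spec (hW : WordBound w n t M B) (hD : Round n t B ptr d dg sp nb inp)
    (hr : Regs n t B ptr d st ρ) {N : Finset ℕ} (hN : ∀ v < n, mark v = st ↔ v ∈ N)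
    (h11 : ρ 11 = 0) (h12 : ρ 12 = 0) (hR : MemRep B n inp mark accepted core label μ)
    (hQ : ∀ ρ' μ', Frame ρ ρ' →
      ρ' 11 = (∑ i ∈ Finset.range d, if Accepts M t d dg sp N (nb i) then 1 else 0) →
      MemRep B n inp mark (fun v => if v ∈ (Finset.range d).image nb ∧ Accepts M t d dg sp N v then st
        else accepted v) core label μ' →
      (ρ' 12 = 0 ∧ ∀ i < d, Accepts M t d dg sp N (nb i) → core (nb i) = 0) ∨
        (ρ' 12 ≠ 0 ∧ ∃ i < d, Accepts M t d dg sp N (nb i) ∧ core (nb i) = ρ' 12) → Q ρ' μ') :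
    WP w (.forLoop 7 6 (testBody M)) (d * (t * 40 + 200) + 9) ρ μ Q := by
  have haddr := hW.addr
  have h2 : 1 < 2 ^ w := by omega
  refine (WP.forLoop (m := d) (cost := fun _ => t * 40 + 180) hW.one_le
    (fun k ρ' μ' => Frame ρ ρ' ∧ ρ' 7 = k ∧
      ρ' 11 = (∑ i ∈ Finset.range k, if Accepts M t d dg sp N (nb i) then 1 else 0) ∧
      MemRep B n inp mark (fun v => if v ∈ (Finset.range k).image nb ∧ Accepts M t d dg sp N v then st
        else accepted v) core label μ' ∧
      ((ρ' 12 = 0 ∧ ∀ i < k, Accepts M t d dg sp N (nb i) → core (nb i) = 0) ∨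
        (ρ' 12 ≠ 0 ∧ ∃ i < k, Accepts M t d dg sp N (nb i) ∧ core (nb i) = ρ' 12)))
    ⟨(Frame.refl ρ).update _ (by omega), by simp, by simpa using h11, by simpa using hR,
      Or.inl ⟨by simpa using h12, by simp⟩⟩ ?_ ?_ ?_ ?_).mono ?_ fun _ _ h => h
  · exact fun k ρ' μ' h => h.2.1
  · exact fun k ρ' μ' h => (hr.frame h.1).d
  · rintro k hk ρ' μ' ⟨hF, h7, h11', hR', h12'⟩
    have hr' := hr.frame hF
    have hp := hD.ptr_le
    have hn := hD.nbr_lt k hk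
    have hinp := hW.input
    have hdg := hD.deg_le _ hn
    have hut : nb k * t ≤ n * t := Nat.mul_le_mul hn.le le_rfl
    have hcnt_le : (∑ i ∈ Finset.range k, if Accepts M t d dg sp N (nb i) then 1 else 0) ≤ k :=
      (Finset.sum_le_card_nsmul _ _ 1 fun i _ => by split_ifs <;> omega).trans (by simp)
    have hd := hD.d_le
    set m := ∑ i ∈ Finset.range t, if sp (nb k) i ∈ N then 1 else 0 with hm
    have hm_le : m ≤ t :=
      (Finset.sum_le_card_nsmul _ _ 1 fun i _ => by split_ifs <;> omega).trans (by simp)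
    obtain ⟨b1, b2, b3, b4, b5, -⟩ := hW.test hdg hd hm_le
    set ρ₁ := Function.update (Function.update (Function.update (Function.update ρ' 8 (nb k)) 13
      (dg (nb k))) 15 (3 + n + nb k * t)) 10 0 with hρ₁
    have hF₁ : Frame ρ ρ₁ := (((hF.update _ (by omega)).update _ (by omega)).update _
      (by omega)).update _ (by omega)
    have hr₁ := hr.frame hF₁
    have e15 : ρ₁ 15 = 3 + n + nb k * t := by simp [hρ₁]
    -- A mark equals the current stamp exactly on `N`, so the loop counts the samples that fall in
    -- `N`.
    have hsum : (∑ i ∈ Finset.range (ρ₁ 1),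
        if μ' (ρ₁ 3 + μ' (ρ₁ 15 + i)) = ρ₁ 14 then 1 else 0) = m := by
      rw [hr₁.t, hr₁.B, hr₁.st, hm]
      refine Finset.sum_congr rfl fun i hi => ?_
      have hi := Finset.mem_range.1 hi
      have := sample_index_lt hn hi
      rw [e15, hR'.inp (3 + n + nb k * t + i) (by omega), hD.sample _ hn _ hi, hR'.mark _ (hD.sample_lt _ hn _ hi)]
      exact if_congr (hN _ (hD.sample_lt _ hn _ hi)) rfl rfl
    set ρ₂ := Function.update (Function.update ρ₁ 10 m) 9 t with hρ₂
    have hF₂ : Frame ρ ρ₂ := (hF₁.update _ (by omega)).update _ (by omega)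
    have hr₂ := hr.frame hF₂
    have e7 : ρ₂ 7 = k := by simp [hρ₂, hρ₁, h7]
    have e8 : ρ₂ 8 = nb k := by simp [hρ₂, hρ₁]
    have e10 : ρ₂ 10 = m := by simp [hρ₂]
    have e11 : ρ₂ 11 = ρ' 11 := by simp [hρ₂, hρ₁]
    have e12 : ρ₂ 12 = ρ' 12 := by simp [hρ₂, hρ₁]
    have e13 : ρ₂ 13 = dg (nb k) := by simp [hρ₂, hρ₁]
    have tail : WP w (Prog.cond (.op .lt (.op .add (.op .mul (.op .mul (.op .mul (.lit 2) (.lit M))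
        (.var 13)) (.var 10)) (.op .mul (.var 1) (.op .add (.var 13) (.var 6))))
        (.op .mul (.lit M) (.op .mul (.var 1) (.op .add (.var 13) (.var 6))))) .skip
        (.seq (.put (.op .add (.op .add (.var 3) (.var 0)) (.var 8)) (.var 14))
        (.seq (.assign 11 (.op .add (.var 11) (.lit 1)))
        (.cond (.mem (.op .add (.op .add (.var 3) (.op .mul (.lit 2) (.var 0))) (.var 8)))
        (.assign 12 (.mem (.op .add (.op .add (.var 3) (.op .mul (.lit 2) (.var 0))) (.var 8))))
        .skip)))) 120 ρ₂ μ' fun ρ' μ' => ρ' 7 = k ∧ Frame ρ ρ' ∧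
      ρ' 11 = (∑ i ∈ Finset.range (k + 1), if Accepts M t d dg sp N (nb i) then 1 else 0) ∧
      MemRep B n inp mark (fun v => if v ∈ (Finset.range (k + 1)).image nb ∧
        Accepts M t d dg sp N v then st else accepted v) core label μ' ∧
      ((ρ' 12 = 0 ∧ ∀ i < k + 1, Accepts M t d dg sp N (nb i) → core (nb i) = 0) ∨
        (ρ' 12 ≠ 0 ∧ ∃ i < k + 1, Accepts M t d dg sp N (nb i) ∧ core (nb i) = ρ' 12)) := by
      have hc := hR'.core _ hn
      have hmul : 2 * n < 2 ^ w := by omega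
      refine WP.cond_le 80 (.lt h2 (.add (.mul (.mul (.mul (.lit (by omega)) (.lit b5) b4)
        (.var e13) b3) (.var e10) (by omega)) (.mul (.var hr₂.t) (.add (.var e13) (.var hr₂.d)
        (by omega)) (by omega)) b1) (.mul (.lit b5) (.mul (.var hr₂.t) (.add (.var e13)
        (.var hr₂.d) (by omega)) (by omega)) b2)) (fun h => WP.skip_le ?_) fun h => ?_
      · have hT : ¬ Accepts M t d dg sp N (nb k) := by
          unfold Accepts
          rw [← hm]
          simpa using h
        refine ⟨e7, hF₂, ?_, ?_, ?_⟩
        · rw [e11, h11', Finset.sum_range_succ, if_neg hT, add_zero]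
        · refine hR'.congr (fun _ _ => rfl) (fun v hv => ?_) (fun _ _ => rfl) (fun _ _ => rfl)
          simp only [mem_image_range_succ]
          by_cases hv : v = nb k <;> simp [hv, hT]
        · rw [e12]
          rcases h12' with ⟨g1, g2⟩ | ⟨g1, i, g2, g3⟩
          · refine Or.inl ⟨g1, fun i hi hi' => ?_⟩
            by_cases hik : i = k
            · exact absurd (hik ▸ hi') hT
            · exact g2 i (by omega) hi'
          · exact Or.inr ⟨g1, i, by omega, g3⟩
      · have hT : Accepts M t d dg sp N (nb k) := by
          unfold Accepts
          rw [← hm]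
          simpa using h
        refine WP.seq_le 60 (WP.put_of_ev (.add (.add (.var hr₂.B) (.var hr₂.n) (by omega))
          (.var e8) (by omega)) (.var hr₂.st) ?_)
        refine WP.seq_le 50 (WP.assign_of_ev (.add (.var (e11.trans h11')) (.lit (by omega))
          (by omega)) ?_)
        have hcore : Function.update μ' (B + n + nb k) st (B + 2 * n + nb k) = core (nb k) := by
          rw [Function.update_of_ne (by omega), hc]
        have hR'' : MemRep B n inp mark (fun v => if v ∈ (Finset.range (k + 1)).image nb ∧
            Accepts M t d dg sp N v then st else accepted v) core label
            (Function.update μ' (B + n + nb k) st) := by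
          refine hR'.set_accepted hn fun v _ => ?_
          simp only [mem_image_range_succ]
          by_cases hv : v = nb k <;> simp [hv, hT]
        have hsum' : (∑ i ∈ Finset.range (k + 1), if Accepts M t d dg sp N (nb i) then 1 else 0) =
            (∑ i ∈ Finset.range k, if Accepts M t d dg sp N (nb i) then 1 else 0) + 1 := by
          rw [Finset.sum_range_succ, if_pos hT]
        refine WP.cond_le 20 (v := core (nb k)) (.mem (.add (.add (.var (v := B) (by simp [hr₂.B]))
          (.mul (.lit (by omega)) (.var (by simp [hr₂.n])) hmul) (by omega))
          (.var (v := nb k) (by simp [e8])) (by omega)) hcore)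
          (fun h' => WP.assign_le (v := core (nb k))
          (.mem (.add (.add (.var (v := B) (by simp [hr₂.B])) (.mul (.lit (by omega))
            (.var (by simp [hr₂.n])) hmul) (by omega)) (.var (v := nb k) (by simp [e8]))
            (by omega)) hcore) ?_) fun h' => WP.skip_le ?_
        · refine ⟨by simp [e7], (hF₂.update _ (by omega)).update _ (by omega), ?_, hR'', Or.inr ?_⟩
          · simp [hsum']
          · simp only [Function.update_self]
            exact ⟨h', k, by omega, hT, rfl⟩
        · refine ⟨by simp [e7], hF₂.update _ (by omega), ?_, hR'', ?_⟩
          · simp [hsum']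
          · rw [Function.update_of_ne (by omega), e12]
            rcases h12' with ⟨g1, g2⟩ | ⟨g1, i, g2, g3⟩
            · refine Or.inl ⟨g1, fun i hi hi' => ?_⟩
              by_cases hik : i = k
              · rw [hik, h']
              · exact g2 i (by omega) hi'
            · exact Or.inr ⟨g1, i, by omega, g3⟩
    refine WP.seq_le (t * 40 + 170) (WP.assign_of_ev (v := nb k) (.mem (.add (.add (.var hr'.ptr)
      (.lit (by omega)) (by omega)) (.var h7) (by omega)) ?_) ?_)
    · rw [hR'.inp _ (by omega), hD.nbr k hk]
    refine WP.seq_le (t * 40 + 160) (WP.assign_of_ev (v := dg (nb k))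
      (.mem (.add (.lit (by omega)) (.var (v := nb k) (by simp)) (by omega)) ?_) ?_)
    · rw [hR'.inp _ (by omega), hD.deg _ hn]
    refine WP.seq_le (t * 40 + 140) (WP.assign_of_ev (.add (.add (.lit (by omega))
      (.var (v := n) (by simp [hr'.n])) (by omega)) (.mul (.var (v := nb k) (by simp))
      (.var (v := t) (by simp [hr'.t])) (by omega)) (by omega)) ?_)
    refine WP.seq_le (t * 40 + 130) (WP.assign_of_ev (.lit (by omega)) ?_)
    refine WP.seq_le 120 (countLoop_spec (ρ := ρ₁) hW.one_le (by simp [hρ₁]) ?_ ?_ ?_)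
      (by rw [hr₁.t]; omega)
    · intro i hi
      rw [hr₁.t] at hi
      have := sample_index_lt hn hi
      rw [e15, hr₁.B, hR'.inp _ (by omega), hD.sample _ hn _ hi]
      have := hD.sample_lt _ hn _ hi
      omega
    · rw [hr₁.t]; omega
    · rw [hsum, hr₁.t, ← hρ₂]
      refine tail.mono le_rfl ?_
      rintro ρ'' μ'' ⟨h, hF'', h11'', hR'', h12''⟩
      exact ⟨h, hF''.update _ (by omega), by simp, by simpa using h11'', hR'', by simpa using h12''⟩
  · rintro ρ' μ' ⟨hF, -, h11', hR', h12'⟩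
    exact hQ _ _ hF h11' hR' h12'
  · simp only [Finset.sum_const, Finset.card_range, smul_eq_mul]
    exact Nat.add_le_add_right (Nat.mul_le_mul_left _ (by omega)) _

end Rounds

/-! ### The labelling loop and one complete round. -/

section Labelling

variable {w n t M B ptr d st : ℕ} {dg : ℕ → ℕ} {sp : ℕ → ℕ → ℕ} {nb inp : ℕ → ℕ}
  {mark accepted core label : ℕ → ℕ} {ρ μ : ℕ → ℕ} {Q : (ℕ → ℕ) → (ℕ → ℕ) → Prop}

/-- Variable `12` selects the update: at `0` the accepted set becomes a core, otherwise its
unlabelled vertices take the label found. The resulting functions are those of `ClusterInv.new` and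
`ClusterInv.join`. -/
lemma labelLoop_spec (hW : WordBound w n t M B) (hD : Round n t B ptr d dg sp nb inp)
    (hr : Regs n t B ptr d st ρ) {A : Finset ℕ} (hA : ∀ v < n, accepted v = st ↔ v ∈ A)
    (hR : MemRep B n inp mark accepted core label μ)
    (hQ : ∀ ρ' μ', Frame ρ ρ' →
      MemRep B n inp mark accepted
        (fun v => if v ∈ (Finset.range d).image nb ∧ v ∈ A ∧ ρ 12 = 0 then st else core v)
        (fun v => if v ∈ (Finset.range d).image nb ∧ v ∈ A then
          if ρ 12 = 0 then st else if label v = 0 then ρ 12 else label v else label v) μ' →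
      Q ρ' μ') :
    WP w (.forLoop 7 6 labelBody) (d * 112 + 9) ρ μ Q := by
  have haddr := hW.addr
  have h2 : 1 < 2 ^ w := by omega
  refine (WP.forLoop (m := d) (cost := fun _ => 100) hW.one_le
    (fun k ρ' μ' => Frame ρ ρ' ∧ ρ' 7 = k ∧ ρ' 12 = ρ 12 ∧
      MemRep B n inp mark accepted
        (fun v => if v ∈ (Finset.range k).image nb ∧ v ∈ A ∧ ρ 12 = 0 then st else core v)
        (fun v => if v ∈ (Finset.range k).image nb ∧ v ∈ A then
          if ρ 12 = 0 then st else if label v = 0 then ρ 12 else label v else label v) μ')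
    ⟨(Frame.refl ρ).update _ (by omega), by simp, by simp, by simpa using hR⟩ ?_ ?_ ?_ ?_).mono
      (by simp) fun _ _ h => h
  · exact fun k ρ' μ' h => h.2.1
  · exact fun k ρ' μ' h => (hr.frame h.1).d
  · rintro k hk ρ' μ' ⟨hF, h7, h12, hR'⟩
    have hr' := hr.frame hF
    have hp := hD.ptr_le
    have hn := hD.nbr_lt k hk
    have hF₁ : Frame ρ (Function.update ρ' 8 (nb k)) := hF.update _ (by omega)
    have hr₁ := hr.frame hF₁
    have hmul : 3 * n < 2 ^ w := by omega
    have e7 : Function.update ρ' 8 (nb k) 7 = k := by simp [h7]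
    have e8 : Function.update ρ' 8 (nb k) 8 = nb k := by simp
    have e12 : Function.update ρ' 8 (nb k) 12 = ρ 12 := by simp [h12]
    refine WP.seq_le 85 (WP.assign_of_ev (v := nb k) (.mem (.add (.add (.var hr'.ptr)
      (.lit (by omega)) (by omega)) (.var h7) (by omega)) ?_) ?_)
    · rw [hR'.inp _ (by omega), hD.nbr k hk]
    refine WP.cond_le 60 (.eq h2 (.mem (.add (.add (.var hr₁.B) (.var hr₁.n) (by omega))
      (.var e8) (by omega)) (hR'.accepted _ hn)) (.var hr₁.st)) (fun h => ?_)
      fun h => WP.skip_le ⟨e7, hF₁.update _ (by omega), by simp, by simp [h12], hR'.congr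
        (fun _ _ => rfl) (fun _ _ => rfl) (fun v hv => ?_) fun v hv => ?_⟩
    · have hk' : nb k ∈ A := by
        rw [← hA _ hn]
        by_contra hc
        simp [hc] at h
      refine WP.cond_le 40 (.var e12) (fun h0 => ?_) fun h0 => ?_
      · refine WP.cond_le 20 (.mem (.add (.add (.var hr₁.B) (.mul (.lit (by omega)) (.var hr₁.n)
          hmul) (by omega)) (.var e8) (by omega)) (hR'.label _ hn)) (fun hl => WP.skip_le
          ⟨e7, hF₁.update _ (by omega), by simp, by simp [h12], hR'.congr
            (fun _ _ => rfl) (fun _ _ => rfl) (fun v hv => ?_) fun v hv => ?_⟩)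
          fun hl => WP.put_le (.add (.add (.var hr₁.B) (.mul (.lit (by omega)) (.var hr₁.n)
          hmul) (by omega)) (.var e8) (by omega)) (.var e12)
          ⟨e7, hF₁.update _ (by omega), by simp, by simp [h12], (hR'.congr (fun _ _ => rfl)
            (fun _ _ => rfl) (fun v hv => ?_) (fun _ _ => rfl)).set_label hn fun v hv => ?_⟩
        · simp [h0]
        · simp only [mem_image_range_succ, h0, if_false] at hl ⊢
          by_cases hv : v = nb k
          · subst hv
            simp only [hk', and_true, true_or, if_true] at hl ⊢
            split_ifs at hl ⊢ <;> simp_all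
          · simp [hv]
        · simp [h0]
        · simp only [mem_image_range_succ, h0, if_false] at hl ⊢
          by_cases hv : v = nb k
          · subst hv
            simp only [hk', and_true, true_or, if_true] at hl ⊢
            split_ifs at hl ⊢ <;> simp_all
          · simp [hv]
      · refine WP.seq_le 20 (WP.put_of_ev (.add (.add (.var hr₁.B) (.mul (.lit (by omega))
          (.var hr₁.n) (by omega)) (by omega)) (.var e8) (by omega)) (.var hr₁.st) ?_)
        refine WP.put_le (.add (.add (.var hr₁.B) (.mul (.lit (by omega)) (.var hr₁.n)
          hmul) (by omega)) (.var e8) (by omega)) (.var hr₁.st)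
          ⟨e7, hF₁.update _ (by omega), by simp, by simp [h12],
            (hR'.set_core hn fun v hv => ?_).set_label hn fun v hv => ?_⟩
        · simp only [mem_image_range_succ]
          by_cases hv : v = nb k <;> simp [hv, hk', h0]
        · simp only [mem_image_range_succ]
          by_cases hv : v = nb k <;> simp [hv, hk', h0]
    · have hk' : nb k ∉ A := by
        rw [← hA _ hn]
        intro hc
        simp [hc] at h
      simp only [mem_image_range_succ]
      by_cases hv : v = nb k <;> simp [hv, hk']
    · have hk' : nb k ∉ A := by
        rw [← hA _ hn]
        intro hc
        simp [hc] at h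
      simp only [mem_image_range_succ]
      by_cases hv : v = nb k <;> simp [hv, hk']
  · rintro ρ' μ' ⟨hF, -, -, hR'⟩
    exact hQ _ _ hF hR'

/-- The neighbors of a sampled vertex that pass the test. -/
def acceptedNbrs (M t d : ℕ) (dg : ℕ → ℕ) (sp : ℕ → ℕ → ℕ) (nb : ℕ → ℕ) : Finset ℕ :=
  ((Finset.range d).image nb).filter (Accepts M t d dg sp ((Finset.range d).image nb))

/-- Almost all neighbors of a sampled vertex pass the test. -/
def AcceptsMost (M t d : ℕ) (dg : ℕ → ℕ) (sp : ℕ → ℕ → ℕ) (nb : ℕ → ℕ) : Prop :=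
  M * d ≤ d + M * ∑ i ∈ Finset.range d,
    if Accepts M t d dg sp ((Finset.range d).image nb) (nb i) then 1 else 0

/-- One round realizes one of `ClusterInv.skip`, `ClusterInv.new`, `ClusterInv.join`. The bounds
`mark v ≤ j` and `accepted v ≤ j` say that the stamp `j + 1` is fresh. -/
lemma roundBody_spec (hW : WordBound w n t M B) {j : ℕ} (hj : j < n)
    {A : ℕ → Finset ℕ} {pass : ℕ → Prop} (hD : Round n t B ptr d dg sp nb inp)
    (hc : inp ptr < n ∧ dg (inp ptr) = d)
    (hA : A j = acceptedNbrs M t d dg sp nb) (hpass : pass j ↔ AcceptsMost M t d dg sp nb)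
    (h0 : ρ 0 = n) (h1 : ρ 1 = t) (h3 : ρ 3 = B) (h4 : ρ 4 = ptr) (h5 : ρ 5 = j)
    (hmark : ∀ v < n, mark v ≤ j) (haccepted : ∀ v < n, accepted v ≤ j)
    (hI : ClusterInv A pass j core label) (hR : MemRep B n inp mark accepted core label μ)
    (hQ : ∀ ρ' μ' mark' accepted' core' label', ρ' 0 = n → ρ' 1 = t → ρ' 2 = ρ 2 → ρ' 3 = B →
      ρ' 4 = ptr + 1 + d → ρ' 5 = j → (∀ v < n, mark' v ≤ j + 1) → (∀ v < n, accepted' v ≤ j + 1) →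
      ClusterInv A pass (j + 1) core' label' →
      MemRep B n inp mark' accepted' core' label' μ' → Q ρ' μ') :
    WP w (roundBody M) ((d + 1) * ((t + 1) * 500)) ρ μ Q := by
  have haddr := hW.addr
  have hinp := hW.input
  have h2 : 1 < 2 ^ w := by omega
  have hp := hD.ptr_le
  set N := (Finset.range d).image nb with hN
  set ρ₁ := Function.update (Function.update ρ 6 d) 14 (j + 1) with hρ₁
  have hr₁ : Regs n t B ptr d (j + 1) ρ₁ := by
    constructor <;> simp [hρ₁, h0, h1, h3, h4]
  have e2 : ρ₁ 2 = ρ 2 := by simp [hρ₁]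
  have e5 : ρ₁ 5 = j := by simp [hρ₁, h5]
  have hd := hD.d_le
  refine WP.seq_le (d * 40 + (d * (t * 40 + 200) + (d * 112 + 150))) (WP.assign_of_ev (v := d)
    (.mem (.add (.lit (by omega)) (.mem (.var h4) (hR.inp _ (by omega))) (by omega)) ?_) ?_) ?_
  · rw [hR.inp _ (by omega), hD.deg _ hc.1, hc.2]
  · refine WP.seq_le (d * 40 + (d * (t * 40 + 200) + (d * 112 + 120))) (WP.assign_of_ev
      (.add (.var (v := j) (by simp [h5])) (.lit (by omega)) (by omega)) ?_)
    refine WP.seq_le (d * (t * 40 + 200) + (d * 112 + 110)) (markLoop_spec hW hD hr₁ hR ?_)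
      (by omega)
    intro ρ₂ μ₂ hF₂ hR₂
    rw [← hN] at hR₂
    set ρ₃ := Function.update (Function.update ρ₂ 11 0) 12 0 with hρ₃
    have hF₃ : Frame ρ₁ ρ₃ := (hF₂.update _ (by omega)).update _ (by omega)
    have hr₃ := hr₁.frame hF₃
    have hstamp : ∀ (P : Prop) [Decidable P], ∀ x ≤ j, (if P then j + 1 else x) = j + 1 ↔ P := by
      intro P _ x hx
      split_ifs with h
      · simp [h]
      · exact ⟨fun h' => by omega, fun h' => absurd h' h⟩
    refine WP.seq_le (d * (t * 40 + 200) + (d * 112 + 100)) (WP.assign_of_ev (.lit (by omega)) ?_)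
    refine WP.seq_le (d * (t * 40 + 200) + (d * 112 + 90)) (WP.assign_of_ev (.lit (by omega)) ?_)
    refine WP.seq_le (d * 112 + 80) (testLoop_spec hW hD hr₃ (N := N)
      (fun v hv => hstamp _ _ (hmark v hv)) (by simp) (by simp) hR₂ ?_) (by omega)
    intro ρ₄ μ₄ hF₄ h11 hR₄ h12
    have hr₄ := hr₃.frame hF₄
    have hF₄' : Frame ρ₁ ρ₄ := fun x hx => (hF₄ x hx).trans (hF₃ x hx)
    set cnt := ∑ i ∈ Finset.range d, if Accepts M t d dg sp N (nb i) then 1 else 0 with hcnt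
    have hcnt_le : cnt ≤ d :=
      (Finset.sum_le_card_nsmul _ _ 1 fun i _ => by split_ifs <;> omega).trans (by simp)
    obtain ⟨-, -, -, -, b5, b6⟩ := hW.test (hcnt_le.trans hd) hd (Nat.zero_le t)
    obtain ⟨-, -, -, -, -, b6'⟩ := hW.test hd hd (Nat.zero_le t)
    have hmemA : ∀ v, v ∈ A j ↔ v ∈ N ∧ Accepts M t d dg sp N v := by
      intro v; rw [hA, acceptedNbrs, Finset.mem_filter]
    refine WP.seq_le (B := d * 112 + 60) 15 (WP.cond_le (d * 112 + 30) (.lt h2 (.add (.var hr₄.d) (.mul (.lit b5)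
      (.var h11) (by omega)) b6) (.mul (.lit b5) (.var hr₄.d) (by omega)))
      (fun h => WP.skip_le ?_) fun h => (labelLoop_spec hW hD hr₄ (A := A j) (fun v hv => ?_) hR₄
        fun ρ₅ μ₅ hF₅ hR₅ => ?_).mono (by omega) fun _ _ h => h) (by omega)
    · have hnp : ¬ pass j := by
        have h' : d + M * cnt < M * d := by
          by_contra hc
          simp only [hc, if_false] at h
          exact h rfl
        rw [hpass, AcceptsMost, not_le]
        exact h'
      refine WP.assign_le (.add (.add (.var hr₄.ptr) (.lit (by omega)) (by omega)) (.var hr₄.d)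
        (by omega)) ?_
      refine hQ _ _ _ _ _ _ (by simp [hr₄.n]) (by simp [hr₄.t])
        (by simp [hF₄' 2 (by omega), e2]) (by simp [hr₄.B]) (by simp)
        (by simp [hF₄' 5 (by omega), e5]) ?_ ?_ (hI.skip hnp) hR₄
      · intro v hv
        have := hmark v hv
        split_ifs <;> omega
      · intro v hv
        have := haccepted v hv
        split_ifs <;> omega
    · rw [hmemA]
      exact hstamp _ _ (haccepted v hv)
    · have hp' : pass j := by
        have h' : ¬ d + M * cnt < M * d := by
          intro hc
          simp only [hc, if_true] at h
          exact one_ne_zero h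
        rw [hpass, AcceptsMost]
        exact not_lt.1 h'
      have hF₅' : Frame ρ₁ ρ₅ := fun x hx => (hF₅ x hx).trans (hF₄' x hx)
      have hr₅ := hr₄.frame hF₅
      refine WP.assign_le (.add (.add (.var hr₅.ptr) (.lit (by omega)) (by omega)) (.var hr₅.d)
        (by omega)) ?_
      refine hQ _ _ _ _ _ _ (by simp [hr₅.n]) (by simp [hr₅.t])
        (by simp [hF₅' 2 (by omega), e2]) (by simp [hr₅.B]) (by simp)
        (by simp [hF₅' 5 (by omega), e5]) ?_ ?_ ?_ hR₅
      · intro v hv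
        have := hmark v hv
        split_ifs <;> omega
      · intro v hv
        have := haccepted v hv
        split_ifs <;> omega
      · have hAN : ∀ v, (v ∈ N ∧ v ∈ A j) ↔ v ∈ A j := fun v => by rw [hmemA]; tauto
        -- Either no accepted vertex is in a core, so that a core is opened, or `nb i` is the common
        -- point needed for a join.
        rcases h12 with ⟨g1, g2⟩ | ⟨g1, i, hi, g2, g3⟩
        · convert hI.new hp' ?_ using 2
          · rename_i v
            simp only [← hN, g1, and_true, hAN]
          · rename_i v
            simp only [← hN, g1, if_true, hAN]
          · intro u hu
            rw [hmemA] at hu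
            obtain ⟨i, hi, rfl⟩ := Finset.mem_image.1 hu.1
            exact g2 i (Finset.mem_range.1 hi) hu.2
        · have hx : nb i ∈ A j := by
            rw [hmemA]
            exact ⟨Finset.mem_image_of_mem _ (Finset.mem_range.2 hi), g2⟩
          convert hI.join hp' hx (by rw [g3]; exact g1) using 2
          · rename_i v
            simp only [g1, and_false, if_false]
          · rename_i v
            simp only [← hN, g1, if_false, hAN, g3]
            by_cases h1 : v ∈ A j <;> by_cases h2 : label v = 0 <;> simp [h1, h2]
  · simp only [Expr.cost]
    nlinarith [Nat.zero_le (d * t)]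

end Labelling

/-! ### Correctness and running time of the whole program on a laid-out input. -/

section Program

/-- The contents of the input: the degrees `dg`, the samples `sp`, and the records of the `s`
sampled vertices, the `j`-th of which starts at the address `ptr j` and consists of the name `ctr j`
of the vertex and of the names `nb j 0, nb j 1, …` of its neighbors. -/
structure Layout (n t s : ℕ) (dg : ℕ → ℕ) (sp : ℕ → ℕ → ℕ) (ctr : ℕ → ℕ) (nb : ℕ → ℕ → ℕ)
    (ptr : ℕ → ℕ) (inp : ℕ → ℕ) : Prop where
  inp_zero : inp 0 = n
  inp_one : inp 1 = t
  inp_two : inp 2 = s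
  s_le : s ≤ n
  deg : ∀ v < n, inp (3 + v) = dg v
  deg_le : ∀ v < n, dg v ≤ n
  sample : ∀ v < n, ∀ i < t, inp (3 + n + v * t + i) = sp v i
  sample_lt : ∀ v < n, ∀ i < t, sp v i < n
  ptr_zero : ptr 0 = 3 + n + n * t
  ptr_succ : ∀ j < s, ptr (j + 1) = ptr j + 1 + dg (ctr j)
  center : ∀ j < s, inp (ptr j) = ctr j
  center_lt : ∀ j < s, ctr j < n
  nbr : ∀ j < s, ∀ k < dg (ctr j), inp (ptr j + 1 + k) = nb j k
  nbr_lt : ∀ j < s, ∀ k < dg (ctr j), nb j k < n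

variable {w n t s M : ℕ} {dg : ℕ → ℕ} {sp : ℕ → ℕ → ℕ} {ctr : ℕ → ℕ} {nb : ℕ → ℕ → ℕ}
  {ptr inp : ℕ → ℕ}

namespace Layout

lemma ptr_le (h : Layout n t s dg sp ctr nb ptr inp) : ∀ j ≤ s,
    ptr j ≤ 3 + n + n * t + j * (n + 1) := by
  intro j
  induction j with
  | zero => simp [h.ptr_zero]
  | succ j ih =>
    intro hj
    have h1 := ih (by omega)
    have h2 := h.deg_le _ (h.center_lt j hj)
    rw [h.ptr_succ j hj, add_mul]
    omega

lemma ptr_le_base (h : Layout n t s dg sp ctr nb ptr inp) {j : ℕ} (hj : j ≤ s) :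
    ptr j ≤ (n + t + 3) * (n + t + 3) := by
  have h1 := h.ptr_le j hj
  have h2 : j * (n + 1) ≤ n * (n + 1) := Nat.mul_le_mul (hj.trans h.s_le) le_rfl
  nlinarith

lemma round (h : Layout n t s dg sp ctr nb ptr inp) {j : ℕ} (hj : j < s) :
    Round n t ((n + t + 3) * (n + t + 3)) (ptr j) (dg (ctr j)) dg sp (nb j) inp := by
  refine ⟨?_, h.deg_le _ (h.center_lt j hj), h.nbr j hj, h.nbr_lt j hj, h.deg, h.deg_le, h.sample,
    h.sample_lt⟩
  rw [← h.ptr_succ j hj]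
  exact h.ptr_le_base hj

end Layout

/-- The cells from the base address on are zero, which represents the empty clustering. A round at a
center of degree `d` takes at most `500 (d + 1) (t + 1)` steps inside the loop; raising the constant
to `600` pays for loop overhead, set-up and output. -/
theorem recoveryProg_runs (hL : Layout n t s dg sp ctr nb ptr inp)
    (hW : WordBound w n t M ((n + t + 3) * (n + t + 3))) {input : List ℕ}
    (hinput : ∀ a, input.getD a 0 % 2 ^ w = inp a)
    (hzero : ∀ a, (n + t + 3) * (n + t + 3) ≤ a → inp a = 0) :
    ∃ s' T, Runs w (recoveryProg M) (initialState w input) s' T ∧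
      T ≤ (n + 1 + ∑ j ∈ Finset.range s, (dg (ctr j) + 1)) * ((t + 1) * 600) ∧
      ∃ core label : ℕ → ℕ, ClusterInv
        (fun j => acceptedNbrs M t (dg (ctr j)) dg sp (nb j))
        (fun j => AcceptsMost M t (dg (ctr j)) dg sp (nb j)) s core label ∧
        ∀ v < n, s'.mem v = label v := by
  set B := (n + t + 3) * (n + t + 3) with hB
  have haddr := hW.addr
  have hbase := hW.input
  have h2 : 1 < 2 ^ w := by omega
  have hsn := hL.s_le
  suffices h : WP w (recoveryProg M)
      ((n + 1 + ∑ j ∈ Finset.range s, (dg (ctr j) + 1)) * ((t + 1) * 600)) (fun _ => 0) inp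
      fun _ μ => ∃ core label : ℕ → ℕ, ClusterInv
        (fun j => acceptedNbrs M t (dg (ctr j)) dg sp (nb j))
        (fun j => AcceptsMost M t (dg (ctr j)) dg sp (nb j)) s core label ∧
        ∀ v < n, μ v = label v by
    obtain ⟨s', T, h1, h2, -, h4⟩ := h (initialState w input)
      ⟨fun _ => by simp [initialState], fun _ => Nat.mod_lt _ (by positivity)⟩ (fun _ => rfl)
      (funext hinput)
    exact ⟨s', T, h1, h2, h4⟩
  set c := ∑ j ∈ Finset.range s, ((dg (ctr j) + 1) * ((t + 1) * 500) + 12) + 9 + (n * 40 + 9) with hc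
  have hcost : c + 80 ≤ (n + 1 + ∑ j ∈ Finset.range s, (dg (ctr j) + 1)) * ((t + 1) * 600) := by
    have h1 : ∑ j ∈ Finset.range s, ((dg (ctr j) + 1) * ((t + 1) * 500) + 12) ≤
        ∑ j ∈ Finset.range s, (dg (ctr j) + 1) * ((t + 1) * 512) :=
      Finset.sum_le_sum fun j _ => by nlinarith [Nat.zero_le (dg (ctr j) * t)]
    rw [← Finset.sum_mul] at h1
    rw [hc]
    nlinarith [Nat.zero_le (n * t),
      Nat.zero_le ((∑ j ∈ Finset.range s, (dg (ctr j) + 1)) * (t + 1))]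
  refine WP.mono (B := c + 80) ?_ hcost fun _ _ h => h
  refine WP.seq_le (c + 60)
    (WP.assign_of_ev (.mem (.lit (by omega)) hL.inp_zero) ?_) ?_
  · refine WP.seq_le (c + 50)
      (WP.assign_of_ev (.mem (.lit h2) hL.inp_one) ?_) ?_
    · refine WP.seq_le (c + 40)
        (WP.assign_of_ev (.mem (.lit (by omega)) hL.inp_two) ?_) ?_
      · have hE : ∀ ρ μ, ρ 0 = n → ρ 1 = t → Ev w ρ μ
            (.op .add (.op .add (.var 0) (.var 1)) (.lit 3)) (n + t + 3) := by
          intro ρ μ e0 e1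
          exact .add (.add (.var e0) (.var e1) (by nlinarith)) (.lit (by omega)) (by nlinarith)
        refine WP.seq_le (c + 20)
          (WP.assign_of_ev (v := B) (.mul (hE _ _ (by simp) (by simp)) (hE _ _ (by simp) (by simp))
            (by rw [← hB]; omega)) ?_) ?_
        · refine WP.seq_le
            (c + 0)
            (WP.assign_of_ev (.add (.add (.lit (by omega)) (.var (v := n) (by simp)) (by omega))
              (.mul (.var (v := n) (by simp)) (.var (v := t) (by simp)) (by omega)) (by omega))
              ?_) ?_
          · refine WP.seq_le (n * 40 + 9) (WP.forLoop hW.one_le (m := s)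
              (cost := fun j => (dg (ctr j) + 1) * ((t + 1) * 500)) (fun j ρ μ =>
                ρ 0 = n ∧ ρ 1 = t ∧ ρ 2 = s ∧ ρ 3 = B ∧ ρ 4 = ptr j ∧ ρ 5 = j ∧
                ∃ mark accepted core label, (∀ v < n, mark v ≤ j) ∧ (∀ v < n, accepted v ≤ j) ∧
                  ClusterInv (fun j => acceptedNbrs M t (dg (ctr j)) dg sp (nb j))
                    (fun j => AcceptsMost M t (dg (ctr j)) dg sp (nb j)) j core label ∧
                  MemRep B n inp mark accepted core label μ) ?_ ?_ ?_ ?_ ?_) ?_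
            · refine ⟨by simp, by simp, by simp, by simp, by simp [hL.ptr_zero], by simp,
                fun _ => 0, fun _ => 0, fun _ => 0, fun _ => 0, by simp, by simp, ClusterInv.zero,
                ⟨fun _ _ => rfl, fun v _ => hzero _ (by omega), fun v _ => hzero _ (by omega),
                  fun v _ => hzero _ (by omega), fun v _ => hzero _ (by omega)⟩⟩
            · rintro j ρ μ ⟨-, -, -, -, -, h, -⟩; exact h
            · rintro j ρ μ ⟨-, -, h, -⟩; exact h
            · rintro j hj ρ μ ⟨r0, r1, r2, r3, r4, r5, mark, accepted, core, label, hm, ha, hI, hR⟩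
              have hD := hL.round hj
              have hp := hD.ptr_le
              refine roundBody_spec (j := j) (A := fun j => acceptedNbrs M t (dg (ctr j)) dg sp (nb j))
                (pass := fun j => AcceptsMost M t (dg (ctr j)) dg sp (nb j)) hW (by omega) hD ?_
                rfl Iff.rfl r0 r1 r3 r4 r5 hm ha hI hR ?_
              · rw [hL.center j hj]
                exact ⟨hL.center_lt j hj, rfl⟩
              · intro ρ' μ' mark' accepted' core' label' q0 q1 q2 q3 q4 q5 hm' ha' hI' hR'
                refine ⟨q5, by simpa using q0, by simpa using q1, by simpa [r2] using q2,
                  by simpa using q3, ?_, by simp, mark', accepted', core', label', hm', ha', hI',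
                  hR'⟩
                simp [q4, hL.ptr_succ j hj]
            · rintro ρ μ ⟨r0, r1, r2, r3, r4, r5, mark, accepted, core, label, hm, ha, hI, hR⟩
              -- Output overwrites the first `n` cells of the input, which is no longer needed. The
              -- label array begins beyond them and stays intact during the copying.
              refine (WP.forLoop hW.one_le (m := n) (cost := fun _ => 28) (fun k ρ' μ' =>
                ρ' 0 = n ∧ ρ' 3 = B ∧ ρ' 7 = k ∧ (∀ v < k, μ' v = label v) ∧
                ∀ v < n, μ' (B + 3 * n + v) = label v)
                ⟨by simpa using r0, by simpa using r3, by simp, by simp, hR.label⟩ ?_ ?_ ?_ ?_).mono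
                (by simp) fun _ _ h => h
              · rintro j ρ μ ⟨-, -, h, -⟩; exact h
              · rintro j ρ μ ⟨h, -⟩; exact h
              · rintro k hk ρ' μ' ⟨q0, q3, q7, q, q'⟩
                refine WP.put_le (.var q7) (.mem (.add (.add (.var q3) (.mul (.lit (by omega))
                  (.var q0) (by omega)) (by omega)) (.var q7) (by omega)) (q' k hk))
                  ⟨q7, by simpa using q0, by simpa using q3, by simp, fun v hv => ?_,
                    fun v hv => ?_⟩
                · by_cases hvk : v = k
                  · rw [hvk, Function.update_self]
                  · rw [Function.update_of_ne hvk, q v (by omega)]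
                · rw [Function.update_of_ne (by omega), q' v hv]
              · rintro ρ' μ' ⟨-, -, -, q, -⟩
                exact ⟨core, label, hI, q⟩
            · omega
          · simp only [Expr.cost]; omega
        · simp only [Expr.cost]; omega
      · simp only [Expr.cost]; omega
    · simp only [Expr.cost]; omega
  · simp only [Expr.cost]; omega

end Program

/-! ### List indexing and the length of the input. -/

section Input

/-- Entry `k` of block `j` sits at offset `k` after the total length of the earlier blocks. This
gives the addresses of samples and of vertex records. -/
lemma List.getD_flatMap_sum {α β : Type*} (l : List α) (f : α → List β) (x : α) (d : β) {j k : ℕ}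
    (hj : j < l.length) (hk : k < (f (l.getD j x)).length) :
    (l.flatMap f).getD (∑ i ∈ Finset.range j, (f (l.getD i x)).length + k) d =
      (f (l.getD j x)).getD k d := by
  induction l generalizing j with
  | nil => simp at hj
  | cons a l ih =>
    cases j with
    | zero =>
      simp only [List.getD_cons_zero, Finset.range_zero, Finset.sum_empty, zero_add,
        List.flatMap_cons] at hk ⊢
      rw [List.getD_append _ _ _ _ hk]
    | succ j =>
      simp only [List.getD_cons_succ, List.length_cons, List.flatMap_cons] at hj hk ⊢
      rw [Finset.sum_range_succ']
      simp only [List.getD_cons_succ, List.getD_cons_zero]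
      rw [List.getD_append_right _ _ _ _ (by omega), ← ih (by omega) hk]
      congr 1
      omega

lemma List.sum_range_getD {α : Type*} (l : List α) (f : α → ℕ) (x : α) :
    ∑ i ∈ Finset.range l.length, f (l.getD i x) = (l.map f).sum := by
  induction l with
  | nil => simp
  | cons a l ih =>
    rw [List.length_cons, Finset.sum_range_succ']
    simp only [List.getD_cons_succ, List.getD_cons_zero, List.map_cons, List.sum_cons, ih]
    omega

lemma List.sum_map_filter_eq {α : Type*} (l : List α) (f : α → ℕ) (p : α → Bool) :
    ((l.filter p).map f).sum = (l.map fun a => if p a then f a else 0).sum := by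
  induction l with
  | nil => simp
  | cons a l ih => by_cases h : p a <;> simp [h, ih]

variable {n : ℕ} {G : SimpleGraph (Fin n)} [DecidableRel G.Adj] {adj : Fin n → List (Fin n)}

lemma IsAdjacencyList.length_eq (hadj : IsAdjacencyList G adj) (v : Fin n) :
    (adj v).length = G.degree v := by
  have h : (adj v).toFinset = G.neighborFinset v := by
    ext u
    rw [List.mem_toFinset, (hadj v).2, SimpleGraph.mem_neighborFinset]
  rw [← SimpleGraph.card_neighborFinset_eq_degree, ← h, List.toFinset_card_of_nodup (hadj v).1]

lemma degree_le_of_fin (v : Fin n) : G.degree v ≤ n := by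
  have := G.degree_lt_card_verts v
  rw [Fintype.card_fin] at this
  exact this.le

/-- The record of a sampled vertex: its name, followed by the names of its neighbors. -/
def vertexRecord (adj : Fin n → List (Fin n)) (v : Fin n) : List ℕ :=
  (v : ℕ) :: List.map (fun u : Fin n => (u : ℕ)) (adj v)

/-- The list of the sampled vertices. -/
def sampledList {t : ℕ} (ω : (Fin n → Fin t → Fin n) × (Fin n → Bool)) : List (Fin n) :=
  (List.finRange n).filter fun v => ω.2 v

lemma recoveryInput_eq {t : ℕ} (ω : (Fin n → Fin t → Fin n) × (Fin n → Bool)) :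
    recoveryInput G adj ω =
    [n, t, ((List.finRange n).filter fun v => ω.2 v).length] ++
      (List.finRange n).map (fun v => G.degree v) ++
      (List.finRange n).flatMap (fun v => (List.finRange t).map fun i => (ω.1 v i : ℕ)) ++
      (sampledList ω).flatMap (vertexRecord adj) := by
  have h : vertexRecord adj = fun v : Fin n =>
      (v : ℕ) :: List.flatMap (fun u : Fin n => [(u : ℕ)]) (adj v) := by
    funext v
    rw [vertexRecord, List.map_eq_flatMap]
  rw [h]
  simp [recoveryInput, sampledList]

/-- Justifies the base address: the work arrays do not overlap the input. -/
lemma length_recoveryInput_le {t : ℕ}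
    (ω : (Fin n → Fin t → Fin n) × (Fin n → Bool)) (hadj : IsAdjacencyList G adj) :
    (recoveryInput G adj ω).length ≤ (n + t + 3) * (n + t + 3) := by
  have hs : (sampledList ω).length ≤ n :=
    (List.length_filter_le _ _).trans (by simp)
  have h4 : ((sampledList ω).flatMap
      (vertexRecord adj)).length ≤
      (sampledList ω).length * (n + 1) := by
    rw [List.length_flatMap]
    refine (List.sum_le_card_nsmul _ (n + 1) fun x hx => ?_).trans (by simp)
    obtain ⟨v, -, rfl⟩ := List.mem_map.1 hx
    have := degree_le_of_fin (G := G) v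
    simp [vertexRecord, hadj.length_eq, this]
  have h5 : (sampledList ω).length * (n + 1) ≤ n * (n + 1) := Nat.mul_le_mul hs le_rfl
  have h6 : (recoveryInput G adj ω).length = 3 + n + n * t + ((sampledList ω).flatMap
      (vertexRecord adj)).length := by
    rw [recoveryInput_eq]
    simp
    omega
  rw [h6]
  nlinarith

end Input

/-! ### The actual input has the layout that the program expects. -/

section Sampled

variable {n : ℕ} [NeZero n] (G : SimpleGraph (Fin n)) [DecidableRel G.Adj]
  (adj : Fin n → List (Fin n)) {t : ℕ} (ω : (Fin n → Fin t → Fin n) × (Fin n → Bool))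

/-- The `j`-th sampled vertex. -/
def sampledVertex (j : ℕ) : Fin n := (sampledList ω).getD j 0

/-- The degrees of the vertices, indexed by numbers. -/
def degreeNat (v : ℕ) : ℕ := G.degree (Fin.ofNat n v)

/-- The sampled neighbors, indexed by numbers. -/
def sampleNat (v i : ℕ) : ℕ := if h : i < t then (ω.1 (Fin.ofNat n v) ⟨i, h⟩ : ℕ) else 0

/-- The neighbors of the `j`-th sampled vertex. -/
def sampledNbr (j k : ℕ) : ℕ := ((adj (sampledVertex ω j)).getD k 0 : Fin n)

/-- The address of the record of the `j`-th sampled vertex. -/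
def recordPtr (j : ℕ) : ℕ :=
  3 + n + n * t + ∑ i ∈ Finset.range j, (G.degree (sampledVertex ω i) + 1)

variable {G adj}

lemma Fin.ofNat_val_eq {n : ℕ} [NeZero n] (v : Fin n) : Fin.ofNat n (v : ℕ) = v := by
  ext; simp

lemma degreeNat_val (v : Fin n) : degreeNat G (v : ℕ) = G.degree v :=
  congrArg (fun v => G.degree v) (Fin.ofNat_val_eq v)

lemma finRange_getD {v : ℕ} (hv : v < n) : (List.finRange n).getD v 0 = Fin.ofNat n v := by
  rw [List.getD_eq_getElem _ _ (by simpa using hv)]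
  ext; simp [Nat.mod_eq_of_lt hv]

lemma layout_recoveryInput (hadj : IsAdjacencyList G adj) :
    Layout n t (sampledList ω).length (degreeNat G) (sampleNat ω)
      (fun j => (sampledVertex ω j : ℕ)) (sampledNbr adj ω) (recordPtr G ω)
      (fun a => (recoveryInput G adj ω).getD a 0) := by
  have hlen : ∀ v : Fin n, (vertexRecord adj v).length = G.degree v + 1 := by
    intro v; simp [vertexRecord, hadj.length_eq]
  have hs : (sampledList ω).length ≤ n :=
    (List.length_filter_le _ _).trans (by simp)
  set l1 : List ℕ := [n, t, ((List.finRange n).filter fun v => ω.2 v).length] with hl1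
  set l2 : List ℕ := (List.finRange n).map (fun v => G.degree v) with hl2
  set l3 : List ℕ :=
    (List.finRange n).flatMap (fun v => (List.finRange t).map fun i => (ω.1 v i : ℕ)) with hl3
  set l4 : List ℕ := (sampledList ω).flatMap
      (vertexRecord adj) with hl4
  have hin : recoveryInput G adj ω = l1 ++ l2 ++ l3 ++ l4 := recoveryInput_eq ω
  have h1 : l1.length = 3 := rfl
  have h2 : l2.length = n := by simp [hl2]
  have h3 : l3.length = n * t := by simp [hl3]
  -- The input consists of header, degrees, samples and records. The facts `g1` to `g4` turn
  -- addresses into positions in these four blocks, and `g5` locates the individual records.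
  have g1 : ∀ a < 3, (recoveryInput G adj ω).getD a 0 = l1.getD a 0 := by
    intro a ha
    rw [hin, List.getD_append _ _ _ _ (by simp only [List.length_append]; omega),
      List.getD_append _ _ _ _ (by simp only [List.length_append]; omega),
      List.getD_append _ _ _ _ (by omega)]
  have g2 : ∀ a < n, (recoveryInput G adj ω).getD (3 + a) 0 = l2.getD a 0 := by
    intro a ha
    rw [hin, List.getD_append _ _ _ _ (by simp only [List.length_append]; omega),
      List.getD_append _ _ _ _ (by simp only [List.length_append]; omega),
      List.getD_append_right _ _ _ _ (by omega)]
    congr 1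
    omega
  have g3 : ∀ a < n * t, (recoveryInput G adj ω).getD (3 + n + a) 0 = l3.getD a 0 := by
    intro a ha
    rw [hin, List.getD_append _ _ _ _ (by simp only [List.length_append]; omega),
      List.getD_append_right _ _ _ _ (by simp only [List.length_append]; omega)]
    congr 1
    simp only [List.length_append]
    omega
  have g4 : ∀ a, (recoveryInput G adj ω).getD (3 + n + n * t + a) 0 = l4.getD a 0 := by
    intro a
    rw [hin, List.getD_append_right _ _ _ _ (by simp only [List.length_append]; omega)]
    congr 1
    simp only [List.length_append]
    omega
  have g5 : ∀ j < (sampledList ω).length, ∀ k < G.degree (sampledVertex ω j) + 1,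
      (recoveryInput G adj ω).getD (recordPtr G ω j + k) 0 =
        (vertexRecord adj (sampledVertex ω j)).getD k 0 := by
    intro j hj k hk
    have := List.getD_flatMap_sum (sampledList ω)
      (vertexRecord adj) 0 0 (j := j) (k := k) hj
      (by rw [hlen]; exact hk)
    simp only [hlen] at this
    rw [recordPtr, add_assoc, g4]
    exact this
  refine ⟨g1 0 (by omega), g1 1 (by omega), g1 2 (by omega), hs, fun v hv => ?_, fun v _ => ?_,
    fun v hv i hi => ?_, fun v _ i hi => ?_, ?_, fun j hj => ?_, fun j hj => ?_, fun j _ => ?_,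
    fun j hj k hk => ?_, fun j _ k _ => ?_⟩
  · rw [g2 v hv, List.getD_eq_getElem _ _ (by omega)]
    simp only [hl2, List.getElem_map]
    refine congrArg (fun v => G.degree v) ?_
    ext; simp [Nat.mod_eq_of_lt hv]
  · exact degree_le_of_fin _
  · have := List.getD_flatMap_sum (List.finRange n)
      (fun v => (List.finRange t).map fun i => (ω.1 v i : ℕ)) 0 0 (j := v) (k := i)
      (by simpa using hv) (by simpa using hi)
    simp only [List.length_map, List.length_finRange, Finset.sum_const, Finset.card_range,
      smul_eq_mul] at this
    rw [add_assoc (3 + n), g3 _ (sample_index_lt hv hi), hl3, this, finRange_getD hv,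
      List.getD_eq_getElem _ _ (by simpa using hi)]
    simp [sampleNat, hi]
  · simp only [sampleNat, hi, dif_pos]
    exact (ω.1 _ _).2
  · simp [recordPtr]
  · simp only [recordPtr, Finset.sum_range_succ, degreeNat_val]
    omega
  · have := g5 j hj 0 (by omega)
    simpa [vertexRecord] using this
  · exact (sampledVertex ω j).2
  · rw [degreeNat_val] at hk
    have := g5 j hj (k + 1) (by omega)
    rw [add_assoc, add_comm 1 k, this, vertexRecord, List.getD_cons_succ, sampledNbr]
    have hk' : k < (adj (sampledVertex ω j)).length := by rw [hadj.length_eq]; exact hk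
    rw [List.getD_eq_getElem _ _ (by simpa using hk'), List.getD_eq_getElem _ _ hk',
      List.getElem_map]
  · exact Fin.is_lt _

lemma mem_recoveryInput_le (hadj : IsAdjacencyList G adj) {x : ℕ}
    (hx : x ∈ recoveryInput G adj ω) : x ≤ n + t := by
  have hs : ((List.finRange n).filter fun v => ω.2 v).length ≤ n :=
    (List.length_filter_le _ _).trans (by simp)
  rw [recoveryInput_eq] at hx
  simp only [vertexRecord, List.mem_append, List.mem_cons, List.not_mem_nil, or_false,
    List.mem_map, List.mem_flatMap] at hx
  rcases hx with (((rfl | rfl | rfl) | ⟨v, -, rfl⟩) | ⟨v, -, i, -, rfl⟩) | ⟨v, -, rfl | ⟨u, -, rfl⟩⟩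
  · omega
  · omega
  · omega
  · have := degree_le_of_fin (G := G) v
    omega
  · have := (ω.1 v i).2
    omega
  · have := v.2
    omega
  · have := u.2
    omega

lemma sum_degree_sampled :
    ∑ j ∈ Finset.range (sampledList ω).length,
        (degreeNat G (sampledVertex ω j : ℕ) + 1) ≤ n + ∑ v, if ω.2 v then G.degree v else 0 := by
  simp only [degreeNat_val, sampledVertex]
  rw [List.sum_range_getD (sampledList ω) (fun v => G.degree v + 1), sampledList,
    List.sum_map_filter_eq, ← Fin.sum_univ_def]
  calc ∑ v, (if ω.2 v then G.degree v + 1 else 0)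
      ≤ ∑ v : Fin n, (1 + if ω.2 v then G.degree v else 0) :=
        Finset.sum_le_sum fun v _ => by split_ifs <;> omega
    _ = n + ∑ v, if ω.2 v then G.degree v else 0 := by simp [Finset.sum_add_distrib]

end Sampled

/-! ### From good samples to a decomposition. -/

section Correctness

/-- A clustering of sets of numbers restricts to the numbers below `n`. -/
lemma ClusterInv.comap_fin {n m : ℕ} {A : ℕ → Finset ℕ} {A' : ℕ → Finset (Fin n)} {pass : ℕ → Prop}
    {core label : ℕ → ℕ} (h : ClusterInv A pass m core label)
    (hA : ∀ i < m, ∀ v, v ∈ A i ↔ ∃ u ∈ A' i, (u : ℕ) = v) :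
    ClusterInv A' pass m (fun v => core v) (fun v => label v) := by
  have hA' : ∀ i < m, ∀ u : Fin n, (u : ℕ) ∈ A i ↔ u ∈ A' i := by
    intro i hi u
    rw [hA i hi]
    exact ⟨fun ⟨u', h1, h2⟩ => Fin.ext h2 ▸ h1, fun h => ⟨u, h, rfl⟩⟩
  refine ⟨fun u hu => ?_, fun u hu => ?_, fun i hi hp u hu => ?_⟩
  · obtain ⟨h1, i, hi, h2, h3, h4, h5⟩ := h.core_eq u hu
    exact ⟨h1, i, hi, h2, h3, (hA' i hi u).1 h4, fun x hx => h5 x ((hA' i hi x).2 hx)⟩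
  · rcases h.label u hu with h1 | ⟨i, hi, h2, h3, x, hx, h4⟩
    · exact Or.inl h1
    · obtain ⟨x', hx', rfl⟩ := (hA i hi x).1 hx
      exact Or.inr ⟨i, hi, h2, (hA' i hi u).1 h3, x', hx', h4⟩
  · exact h.labelled i hi hp u ((hA' i hi u).2 hu)

variable {n : ℕ} {G : SimpleGraph (Fin n)} [DecidableRel G.Adj] {adj : Fin n → List (Fin n)} {t : ℕ}

/-- The sampled neighbors estimate all the sizes `|N(u) ∩ N(w)|` up to an error `θ deg u`. -/
def GoodSamples (G : SimpleGraph (Fin n)) [DecidableRel G.Adj] (θ : ℝ)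
    (σ : Fin n → Fin t → Fin n) : Prop :=
  ∀ u w, |(G.degree u : ℝ) * (∑ i, if G.Adj w (σ u i) then 1 else 0) -
    t * ((G.neighborFinset u ∩ G.neighborFinset w).card : ℝ)| ≤ θ * (t * G.degree u)

/-- Every non-sparse vertex has a sampled similar neighbor. -/
def HitsDense (G : SimpleGraph (Fin n)) [DecidableRel G.Adj] (θ : ℝ) (b : Fin n → Bool) : Prop :=
  ∀ v, ¬ IsSparseVertex G θ v → ∃ w ∈ similarNbrs G θ v, b w = true

variable [NeZero n] (ω : (Fin n → Fin t → Fin n) × (Fin n → Bool))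

lemma sampledNbr_mem (hadj : IsAdjacencyList G adj) (j v : ℕ) :
    v ∈ (Finset.range (G.degree (sampledVertex ω j))).image (sampledNbr adj ω j) ↔
      ∃ u : Fin n, G.Adj (sampledVertex ω j) u ∧ (u : ℕ) = v := by
  rw [Finset.mem_image]
  constructor
  · rintro ⟨k, hk, rfl⟩
    rw [Finset.mem_range, ← hadj.length_eq] at hk
    refine ⟨_, ?_, rfl⟩
    rw [List.getD_eq_getElem _ _ hk, ← (hadj _).2]
    exact List.getElem_mem hk
  · rintro ⟨u, hu, rfl⟩
    rw [← (hadj _).2] at hu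
    obtain ⟨k, hk, rfl⟩ := List.getElem_of_mem hu
    refine ⟨k, by rwa [Finset.mem_range, ← hadj.length_eq], ?_⟩
    rw [sampledNbr, List.getD_eq_getElem _ _ hk]

lemma sampledNbr_injOn (hadj : IsAdjacencyList G adj) (j : ℕ) :
    Set.InjOn (sampledNbr adj ω j) (Finset.range (G.degree (sampledVertex ω j))) := by
  intro k hk k' hk' h
  rw [Finset.coe_range, Set.mem_Iio, ← hadj.length_eq] at hk hk'
  rw [sampledNbr, sampledNbr, List.getD_eq_getElem _ _ hk, List.getD_eq_getElem _ _ hk'] at h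
  exact (List.Nodup.getElem_inj_iff (hadj _).1).1 (Fin.ext h)

/-- The test run by the program, in terms of the graph. -/
lemma accepts_iff (hadj : IsAdjacencyList G adj) (M j : ℕ) (u : Fin n) :
    Accepts M t (G.degree (sampledVertex ω j)) (degreeNat G) (sampleNat ω)
      ((Finset.range (G.degree (sampledVertex ω j))).image (sampledNbr adj ω j)) u ↔
    (M : ℝ) * (t * (G.degree u + G.degree (sampledVertex ω j))) ≤
      2 * M * (G.degree u * (∑ i, if G.Adj (sampledVertex ω j) (ω.1 u i) then 1 else 0)) +
        t * (G.degree u + G.degree (sampledVertex ω j)) := by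
  have h : (∑ i ∈ Finset.range t, if sampleNat ω u i ∈
      (Finset.range (G.degree (sampledVertex ω j))).image (sampledNbr adj ω j) then 1 else 0) =
      ∑ i : Fin t, if G.Adj (sampledVertex ω j) (ω.1 u i) then 1 else 0 := by
    rw [Finset.sum_range]
    refine Finset.sum_congr rfl fun i _ => if_congr ?_ rfl rfl
    rw [sampledNbr_mem ω hadj, sampleNat, dif_pos i.2, Fin.ofNat_val_eq]
    exact ⟨fun ⟨x, h1, h2⟩ => Fin.ext h2 ▸ h1, fun h => ⟨_, h, rfl⟩⟩
  rw [Accepts, degreeNat_val, h, ← Nat.cast_le (α := ℝ)]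
  push_cast
  rw [mul_assoc (2 * (M : ℝ)) (G.degree u : ℝ)]

/-- The neighbors of the `j`-th sampled vertex that pass the test. -/
def acceptedFin (G : SimpleGraph (Fin n)) [DecidableRel G.Adj] (adj : Fin n → List (Fin n)) (M : ℕ)
    (ω : (Fin n → Fin t → Fin n) × (Fin n → Bool)) (j : ℕ) : Finset (Fin n) :=
  (G.neighborFinset (sampledVertex ω j)).filter fun u =>
    Accepts M t (G.degree (sampledVertex ω j)) (degreeNat G) (sampleNat ω)
      ((Finset.range (G.degree (sampledVertex ω j))).image (sampledNbr adj ω j)) u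

/-- Since `D(u, w) + 2 |N(u) ∩ N(w)| = deg u + deg w`, an error `θ deg u` in the intersection is an
error `2 θ deg u` in the distance. The integer test is the comparison with threshold `β = 1 / M`,
multiplied by `M t`. -/
lemma isApproxTest_acceptedFin (hadj : IsAdjacencyList G adj) {M : ℕ} {θ : ℝ} (hM : 0 < M)
    (ht : 0 < t) (hσ : GoodSamples G θ ω.1) (j : ℕ) :
    IsApproxTest G θ (1 / M) (sampledVertex ω j) (acceptedFin G adj M ω j) := by
  have hM' : (0 : ℝ) < M := by exact_mod_cast hM
  have ht' : (0 : ℝ) < t := by exact_mod_cast ht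
  set w := sampledVertex ω j
  have hD : ∀ u, (nbrDist G u w : ℝ) + 2 * (G.neighborFinset u ∩ G.neighborFinset w).card =
      G.degree u + G.degree w := fun u => by exact_mod_cast nbrDist_add_two_mul_card_inter G u w
  have scale : ∀ a b : ℝ, a ≤ 1 / M * b ↔ (M * t) * a ≤ t * b := by
    intro a b
    rw [one_div, ← div_eq_inv_mul, le_div_iff₀ hM']
    constructor
    · intro h; nlinarith
    · intro h
      have : t * (a * M) ≤ t * b := by linarith
      exact le_of_mul_le_mul_left this ht'
  refine ⟨Finset.filter_subset _ _, fun u hu h => ?_, fun u hu => ?_⟩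
  · refine Finset.mem_filter.2 ⟨hu, ?_⟩
    rw [accepts_iff ω hadj]
    have h1 := (abs_le.1 (hσ u w)).1
    rw [scale] at h
    have h2 := hD u
    have h3 : 2 * (M : ℝ) * (t * ((G.neighborFinset u ∩ G.neighborFinset w).card : ℝ) -
        θ * (t * G.degree u)) ≤ 2 * M * ((G.degree u : ℝ) *
          (∑ i, if G.Adj w (ω.1 u i) then 1 else 0)) :=
      mul_le_mul_of_nonneg_left (by linarith) (by positivity)
    have h4 : (M : ℝ) * (t * (G.degree u + G.degree w)) = M * (t * ((nbrDist G u w : ℝ) +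
        2 * (G.neighborFinset u ∩ G.neighborFinset w).card)) := by rw [h2]
    linarith
  · have hu' := (Finset.mem_filter.1 hu).2
    rw [accepts_iff ω hadj] at hu'
    have h1 := (abs_le.1 (hσ u w)).2
    have h2 := hD u
    have h3 : 2 * (M : ℝ) * ((G.degree u : ℝ) * (∑ i, if G.Adj w (ω.1 u i) then 1 else 0)) ≤
        2 * M * (t * ((G.neighborFinset u ∩ G.neighborFinset w).card : ℝ) +
          θ * (t * G.degree u)) := mul_le_mul_of_nonneg_left (by linarith) (by positivity)
    have h4 : (M : ℝ) * (t * (G.degree u + G.degree w)) = M * (t * ((nbrDist G u w : ℝ) +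
        2 * (G.neighborFinset u ∩ G.neighborFinset w).card)) := by rw [h2]
    rw [← sub_le_iff_le_add, scale]
    linarith

lemma mem_acceptedNbrs_iff (hadj : IsAdjacencyList G adj) (M j v : ℕ) :
    v ∈ acceptedNbrs M t (degreeNat G (sampledVertex ω j : ℕ)) (degreeNat G) (sampleNat ω)
      (sampledNbr adj ω j) ↔ ∃ u ∈ acceptedFin G adj M ω j, (u : ℕ) = v := by
  rw [acceptedNbrs, degreeNat_val, Finset.mem_filter, sampledNbr_mem ω hadj]
  constructor
  · rintro ⟨⟨u, hu, rfl⟩, h⟩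
    exact ⟨u, Finset.mem_filter.2 ⟨by simpa using hu, h⟩, rfl⟩
  · rintro ⟨u, hu, rfl⟩
    rw [acceptedFin, Finset.mem_filter] at hu
    exact ⟨⟨u, by simpa using hu.1, rfl⟩, hu.2⟩

/-- The adjacency lists have no repetitions, so the count kept by the program is the cardinality of
the accepted set. -/
lemma acceptsMost_iff (hadj : IsAdjacencyList G adj) {M : ℕ} (hM : 0 < M) (j : ℕ) :
    AcceptsMost M t (degreeNat G (sampledVertex ω j : ℕ)) (degreeNat G) (sampleNat ω)
      (sampledNbr adj ω j) ↔
    ((G.neighborFinset (sampledVertex ω j) \ acceptedFin G adj M ω j).card : ℝ) ≤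
      1 / M * G.degree (sampledVertex ω j) := by
  have hM' : (0 : ℝ) < M := by exact_mod_cast hM
  have hsum : (∑ i ∈ Finset.range (G.degree (sampledVertex ω j)),
      if Accepts M t (G.degree (sampledVertex ω j)) (degreeNat G) (sampleNat ω)
        ((Finset.range (G.degree (sampledVertex ω j))).image (sampledNbr adj ω j))
        (sampledNbr adj ω j i) then 1 else 0) = (acceptedFin G adj M ω j).card := by
    have h1 : (acceptedFin G adj M ω j).image (fun u : Fin n => (u : ℕ)) =
        acceptedNbrs M t (G.degree (sampledVertex ω j)) (degreeNat G) (sampleNat ω)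
          (sampledNbr adj ω j) := by
      ext v
      have := mem_acceptedNbrs_iff ω hadj M j v
      rw [degreeNat_val] at this
      rw [this, Finset.mem_image]
    rw [← Finset.card_image_of_injective _ Fin.val_injective, h1, acceptedNbrs,
      Finset.card_filter, Finset.sum_image (sampledNbr_injOn ω hadj j)]
  have hcard := Finset.card_sdiff_add_card_eq_card (Finset.filter_subset _ _ :
    acceptedFin G adj M ω j ⊆ G.neighborFinset (sampledVertex ω j))
  rw [SimpleGraph.card_neighborFinset_eq_degree] at hcard
  have hcard' : ((G.neighborFinset (sampledVertex ω j) \ acceptedFin G adj M ω j).card : ℝ) +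
      (acceptedFin G adj M ω j).card = G.degree (sampledVertex ω j) := by exact_mod_cast hcard
  rw [AcceptsMost, degreeNat_val, hsum, ← Nat.cast_le (α := ℝ), one_div, ← div_eq_inv_mul,
    le_div_iff₀ hM']
  push_cast
  rw [← hcard']
  constructor <;> intro h <;> linarith

lemma exists_sampledVertex_eq {v : Fin n} (hv : ω.2 v = true) :
    ∃ j < (sampledList ω).length, sampledVertex ω j = v := by
  have : v ∈ sampledList ω := by simp [sampledList, hv]
  obtain ⟨j, hj, rfl⟩ := List.getElem_of_mem this
  exact ⟨j, hj, List.getD_eq_getElem _ _ hj⟩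

/-- On good samples the program computes a sparse-dense decomposition. -/
theorem computesLabels_of_good (hadj : IsAdjacencyList G adj) {η ε : ℝ} {w M : ℕ} (hη0 : 0 < η)
    (hη : η ≤ 1 / 10000) (hε0 : 0 < ε) (hε : ε ≤ 1) (hM : 0 < M) (hM1 : 3 * (η * ε) ≤ 1 / M)
    (hM2 : 1 / (M : ℝ) ≤ 6 * (η * ε)) (ht : 0 < t)
    (hW : WordBound w n t M ((n + t + 3) * (n + t + 3)))
    (hσ : GoodSamples G (η * ε) ω.1) (hb : HitsDense G (η * ε) ω.2) {B : ℝ}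
    (hB : ((2 * n + 1 + ∑ v, if ω.2 v then G.degree v else 0 : ℕ) : ℝ) * ((t + 1) * 600) ≤ B) :
    ComputesLabels w (recoveryProg M) (recoveryInput G adj ω) n B
      fun L => IsSparseDenseDecomposition G η ε (sparseOfLabels L) (cliquesOfLabels L) := by
  have haddr := hW.addr
  have hbase := hW.input
  have hlt : ∀ a, (recoveryInput G adj ω).getD a 0 < 2 ^ w := by
    intro a
    by_cases ha : a < (recoveryInput G adj ω).length
    · rw [List.getD_eq_getElem _ _ ha]
      have := mem_recoveryInput_le ω hadj (List.getElem_mem ha)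
      omega
    · rw [List.getD_eq_default _ _ (not_lt.1 ha)]
      positivity
  obtain ⟨s', T, h1, h2, core, label, h3, h4⟩ := recoveryProg_runs (layout_recoveryInput ω hadj) hW
    (fun a => Nat.mod_eq_of_lt (hlt a)) fun a ha =>
      List.getD_eq_default _ _ ((length_recoveryInput_le ω hadj).trans ha)
  refine ⟨s', T, h1, le_trans ?_ hB, ?_⟩
  · have h5 := sum_degree_sampled (G := G) ω
    have h6 : T ≤ (2 * n + 1 + ∑ v, if ω.2 v then G.degree v else 0) * ((t + 1) * 600) :=
      h2.trans (Nat.mul_le_mul (by omega) le_rfl)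
    exact_mod_cast h6
  · have h5 : (fun v : Fin n => s'.mem v) = fun v : Fin n => label v :=
      funext fun v => h4 v v.2
    rw [h5]
    refine (h3.comap_fin (A' := acceptedFin G adj M ω) fun i _ v => mem_acceptedNbrs_iff ω hadj M i v
      ).decomposition_of_approxTest (ctr := sampledVertex ω) hη0 hη hε0 hε hM1 hM2
      (fun i _ => isApproxTest_acceptedFin ω hadj hM ht hσ i)
      (fun i _ => acceptsMost_iff ω hadj hM i) fun v hv => ?_
    obtain ⟨x, hx, hx'⟩ := hb v hv
    obtain ⟨j, hj, rfl⟩ := exists_sampledVertex_eq ω hx'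
    exact ⟨j, hj, hx⟩

end Correctness

/-! ### Tail bounds for estimates, hits, and the total sampled degree. -/

section Probability

/-- **Hoeffding's inequality** for the number of hits of a set among independent samples. -/
lemma measureReal_count_deviation {α : Type*} [MeasurableSpace α] (μ : Measure α)
    [IsProbabilityMeasure μ] {S : Set α} (hS : MeasurableSet S) [DecidablePred (· ∈ S)] {t : ℕ}
    (ht : 0 < t) {δ : ℝ} (hδ : 0 ≤ δ) :
    (Measure.pi fun _ : Fin t => μ).real
      {x | δ * t ≤ |(∑ i, if x i ∈ S then (1 : ℝ) else 0) - t * μ.real S|} ≤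
      2 * Real.exp (-2 * δ ^ 2 * t) := by
  have ht' : (0 : ℝ) < t := by exact_mod_cast ht
  let Y : α → ℝ := S.indicator 1
  have hYm : Measurable Y := measurable_one.indicator hS
  have hYb : ∀ x, Y x ∈ Set.Icc (0 : ℝ) 1 := by
    intro x
    by_cases hx : x ∈ S <;> simp [Y, hx]
  have hYint : ∫ x, Y x ∂μ = μ.real S := integral_indicator_one hS
  have hsub : HasSubgaussianMGF (fun x => Y x - μ.real S) ((‖(1 : ℝ) - 0‖₊ / 2) ^ 2) μ := by
    have := hasSubgaussianMGF_of_mem_Icc (μ := μ) hYm.aemeasurable (ae_of_all _ hYb)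
    rwa [hYint] at this
  have hsub' : HasSubgaussianMGF (fun x => -(Y x - μ.real S)) ((‖(1 : ℝ) - 0‖₊ / 2) ^ 2) μ :=
    hsub.neg
  have hc : (((‖(1 : ℝ) - 0‖₊ / 2) ^ 2 : NNReal) : ℝ) = 1 / 4 := by
    simp; norm_num
  have key : ∀ Z : α → ℝ, Measurable Z → HasSubgaussianMGF Z ((‖(1 : ℝ) - 0‖₊ / 2) ^ 2) μ →
      (Measure.pi fun _ : Fin t => μ).real {x | δ * t ≤ ∑ i, Z (x i)} ≤
        Real.exp (-2 * δ ^ 2 * t) := by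
    intro Z hZ hZs
    have hind : iIndepFun (fun (i : Fin t) (x : Fin t → α) => Z (x i))
        (Measure.pi fun _ : Fin t => μ) := iIndepFun_pi (fun _ => hZ.aemeasurable)
    have h := HasSubgaussianMGF.measure_sum_ge_le_of_iIndepFun hind (s := Finset.univ)
      (c := fun _ => (‖(1 : ℝ) - 0‖₊ / 2) ^ 2) (fun i _ => ?_) (ε := δ * t) (by positivity)
    · refine h.trans (le_of_eq ?_)
      congr 1
      rw [Finset.sum_const, Finset.card_univ, Fintype.card_fin, nsmul_eq_mul, NNReal.coe_mul, hc]
      push_cast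
      field_simp
      ring
    · have hp := measurePreserving_eval (fun _ : Fin t => μ) i
      have : HasSubgaussianMGF Z ((‖(1 : ℝ) - 0‖₊ / 2) ^ 2)
          ((Measure.pi fun _ : Fin t => μ).map (Function.eval i)) := by rwa [hp.map_eq]
      exact HasSubgaussianMGF.of_map hp.measurable.aemeasurable this
  have h1 := key _ (hYm.sub_const _) hsub
  have h2 := key (fun x => -(Y x - μ.real S)) (hYm.sub_const _).neg hsub'
  refine (measureReal_mono (μ := Measure.pi fun _ : Fin t => μ) (s₂ := {x | δ * t ≤ ∑ i, (Y (x i) - μ.real S)} ∪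
    {x | δ * t ≤ ∑ i, -(Y (x i) - μ.real S)}) ?_).trans ((measureReal_union_le _ _).trans ?_)
  · intro x hx
    have e : (∑ i, if x i ∈ S then (1 : ℝ) else 0) - t * μ.real S =
        ∑ i, (Y (x i) - μ.real S) := by
      rw [Finset.sum_sub_distrib]
      simp [Y, Set.indicator_apply]
    rw [Set.mem_ofPred_eq, e] at hx
    rcases le_abs.1 hx with h | h
    · exact Or.inl h
    · refine Or.inr ?_
      rw [Set.mem_ofPred_eq, Finset.sum_neg_distrib]
      exact h
  · linarith

variable {n : ℕ} (G : SimpleGraph (Fin n)) [DecidableRel G.Adj] {c : ℝ} {t : ℕ}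

instance isProbabilityMeasure_neighborLaw (v : Fin n) : IsProbabilityMeasure (neighborLaw G v) := by
  unfold neighborLaw
  split_ifs with h
  · infer_instance
  · refine isProbabilityMeasure_uniformOn (Set.toFinite _) ?_
    obtain ⟨u, hu⟩ := (G.degree_pos_iff_exists_adj v).1 (Nat.pos_of_ne_zero h)
    exact ⟨u, hu⟩

/-- The last clause bounds the expected contribution of a vertex to the total sampled degree. -/
lemma inclusionProb_mem (hc : 0 < c) (hn : 1 ≤ n) (d : ℕ) :
    0 ≤ inclusionProb c n d ∧ inclusionProb c n d ≤ 1 ∧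
      inclusionProb c n d * d ≤ c * Real.log n := by
  have hlog : 0 ≤ Real.log n := Real.log_nonneg (by exact_mod_cast hn)
  have h0 : 0 ≤ c * Real.log n := by positivity
  unfold inclusionProb
  split_ifs with h
  · exact ⟨by norm_num, le_rfl, by linarith⟩
  · have hd : (0 : ℝ) < d := by linarith
    refine ⟨by positivity, by rw [div_le_one hd]; linarith, ?_⟩
    rw [div_mul_cancel₀ _ hd.ne']

lemma isProbabilityMeasure_inclusionLaw (hc : 0 < c) (v : Fin n) :
    IsProbabilityMeasure (inclusionLaw G c v) := by
  obtain ⟨h0, h1, -⟩ := inclusionProb_mem hc (Nat.one_le_of_lt v.2) (G.degree v)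
  refine ⟨?_⟩
  simp only [inclusionLaw, Measure.coe_add, Measure.coe_smul, Pi.add_apply, Pi.smul_apply,
    measure_univ, smul_eq_mul, mul_one]
  rw [← ENNReal.ofReal_add h0 (by linarith)]
  simp

lemma inclusionLaw_real_false (hc : 0 < c) (v : Fin n) :
    (inclusionLaw G c v).real {false} = 1 - inclusionProb c n (G.degree v) := by
  obtain ⟨h0, h1, -⟩ := inclusionProb_mem hc (Nat.one_le_of_lt v.2) (G.degree v)
  simp only [inclusionLaw, Measure.real, Measure.coe_add, Measure.coe_smul, Pi.add_apply,
    Pi.smul_apply, smul_eq_mul]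
  simp [h1]

lemma neighborLaw_real {u : Fin n} (hu : 0 < G.degree u) (w : Fin n) :
    (neighborLaw G u).real (G.neighborSet w) =
      ((G.neighborFinset u ∩ G.neighborFinset w).card : ℝ) / G.degree u := by
  rw [neighborLaw, if_neg hu.ne', Measure.real, uniformOn,
    cond_apply (Set.toFinite _).measurableSet]
  have h1 : G.neighborSet u ∩ G.neighborSet w =
      ((G.neighborFinset u ∩ G.neighborFinset w : Finset (Fin n)) : Set (Fin n)) := by
    simp
  have h2 : Measure.count (G.neighborSet u) = (G.degree u : ENNReal) := by
    rw [← SimpleGraph.card_neighborFinset_eq_degree, ← Measure.count_apply_finset,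
      SimpleGraph.coe_neighborFinset]
  rw [h1, h2, Measure.count_apply_finset, ENNReal.toReal_mul, ENNReal.toReal_inv,
    ENNReal.toReal_natCast, ENNReal.toReal_natCast, div_eq_inv_mul]

/-- The samples of `u` hit `N(w)` independently with probability `|N(u) ∩ N(w)| / deg u`; multiply
Hoeffding's bound by `deg u`. For isolated `u` both sides of the strict inequality vanish, so the
event is empty. -/
lemma samples_deviation (ht : 0 < t) {θ : ℝ} (hθ : 0 ≤ θ) (u w : Fin n) :
    (Measure.pi fun v => Measure.pi fun _ : Fin t => neighborLaw G v).real
      {σ | θ * (t * G.degree u) < |(G.degree u : ℝ) * (∑ i, if G.Adj w (σ u i) then 1 else 0) -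
        t * ((G.neighborFinset u ∩ G.neighborFinset w).card : ℝ)|} ≤
      2 * Real.exp (-2 * θ ^ 2 * t) := by
  rcases Nat.eq_zero_or_pos (G.degree u) with h0 | hpos
  · have : (G.neighborFinset u ∩ G.neighborFinset w).card = 0 := by
      have h1 := Finset.card_le_card (Finset.inter_subset_left
        (s₁ := G.neighborFinset u) (s₂ := G.neighborFinset w))
      rw [SimpleGraph.card_neighborFinset_eq_degree, h0] at h1
      omega
    simp only [h0, this, Nat.cast_zero, mul_zero, zero_mul, sub_zero, abs_zero, lt_irrefl,
      Set.ofPred_false, measureReal_empty]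
    positivity
  · have hd : (0 : ℝ) < G.degree u := by exact_mod_cast hpos
    have hp := measurePreserving_eval
      (fun v => Measure.pi fun _ : Fin t => neighborLaw G v) u
    have h1 := measureReal_count_deviation (neighborLaw G u) (S := G.neighborSet w)
      (Set.toFinite _).measurableSet ht hθ
    rw [← hp.measureReal_preimage (Set.toFinite _).measurableSet.nullMeasurableSet] at h1
    refine (measureReal_mono fun σ hσ => ?_).trans h1
    rw [Set.mem_ofPred_eq] at hσ
    rw [Set.mem_preimage, Set.mem_ofPred_eq, neighborLaw_real G hpos]
    have e : (G.degree u : ℝ) * (∑ i, if G.Adj w (σ u i) then 1 else 0) -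
        t * ((G.neighborFinset u ∩ G.neighborFinset w).card : ℝ) =
        G.degree u * ((∑ i, if G.Adj w (σ u i) then 1 else 0) -
          t * (((G.neighborFinset u ∩ G.neighborFinset w).card : ℝ) / G.degree u)) := by
      field_simp
    rw [e, abs_mul, abs_of_pos hd, ← mul_assoc, mul_comm (θ * (t : ℝ))] at hσ
    exact (lt_of_mul_lt_mul_left hσ hd.le).le

/-- By independence the probability is a product of factors `1 - p_w` over the similar neighbors. A
factor is `0` if `p_w = 1`, and otherwise at most `exp (-c log n / (2 deg v))` because `deg w ≤ 2
deg v`. There are at least `deg v / 2` factors. -/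
lemma hits_failure (hc : 0 < c) (hn : 2 ≤ n) {θ : ℝ} (hθ0 : 0 ≤ θ) (hθ : θ ≤ 1 / 1000) {v : Fin n}
    (hv : ¬ IsSparseVertex G θ v) :
    (Measure.pi fun v => inclusionLaw G c v).real {b | ∀ w ∈ similarNbrs G θ v, b w = false} ≤
      Real.exp (-(c * Real.log n / 4)) := by
  have := fun v => isProbabilityMeasure_inclusionLaw G hc v
  have hlog : 0 ≤ Real.log n := Real.log_nonneg (by exact_mod_cast (by omega : 1 ≤ n))
  have hcl : 0 ≤ c * Real.log n := by positivity
  have hcard := card_similarNbrs hv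
  have hdpos : (0 : ℝ) < G.degree v := by
    obtain ⟨w, hw⟩ := similarNbrs_nonempty hθ hv
    have hw := (Finset.mem_filter.1 hw).1
    rw [SimpleGraph.mem_neighborFinset] at hw
    exact_mod_cast (G.degree_pos_iff_exists_adj v).2 ⟨w, hw⟩
  have hset : {b : Fin n → Bool | ∀ w ∈ similarNbrs G θ v, b w = false} =
      Set.pi Set.univ fun w => if w ∈ similarNbrs G θ v then {false} else Set.univ := by
    ext b
    simp only [Set.mem_ofPred_eq, Set.mem_pi, Set.mem_univ, true_implies]
    refine forall_congr' fun w => ?_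
    split_ifs with h <;> simp [h]
  rw [hset, Measure.real, Measure.pi_pi, ENNReal.toReal_prod]
  have hterm : ∀ w : Fin n, ((inclusionLaw G c w)
      (if w ∈ similarNbrs G θ v then {false} else Set.univ)).toReal ≤
      Real.exp (if w ∈ similarNbrs G θ v then -(c * Real.log n / (2 * G.degree v)) else 0) := by
    intro w
    split_ifs with h
    · have h1 := inclusionLaw_real_false G hc w
      rw [Measure.real] at h1
      rw [h1]
      obtain ⟨-, hw, -⟩ := dist_of_mem_similarNbrs hθ0 hθ h
      unfold inclusionProb
      split_ifs with hp
      · rw [sub_self]; positivity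
      · refine (Real.one_sub_le_exp_neg _).trans (Real.exp_le_exp.2 (neg_le_neg ?_))
        have hdw : (0 : ℝ) < G.degree w := by linarith
        gcongr
        linarith
    · rw [measure_univ, ENNReal.toReal_one, Real.exp_zero]
  refine (Finset.prod_le_prod (fun _ _ => ENNReal.toReal_nonneg) fun w _ => hterm w).trans ?_
  rw [← Real.exp_sum, Real.exp_le_exp, Finset.sum_ite_mem, Finset.univ_inter, Finset.sum_const,
    nsmul_eq_mul, mul_neg, neg_le_neg_iff]
  have h1 : (G.degree v : ℝ) / 2 ≤ (similarNbrs G θ v).card := by nlinarith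
  calc c * Real.log n / 4 = G.degree v / 2 * (c * Real.log n / (2 * G.degree v)) := by
        field_simp; norm_num
    _ ≤ _ := mul_le_mul_of_nonneg_right h1 (by positivity)

/-- Markov's inequality for the exponential of the sum divided by `n`. As `deg v / n ≤ 1`, the
estimate `exp x ≤ 1 + 2 x` bounds each factor of the moment by `exp (2 c log n / n)`, and the `n`
factors multiply to `exp (2 c log n)`. -/
lemma sampledDegrees_tail (hc : 0 < c) (hn : 2 ≤ n) (K : ℝ) :
    (Measure.pi fun v => inclusionLaw G c v).real
      {b | K * (n * Real.log n) ≤ ∑ v, if b v then (G.degree v : ℝ) else 0} ≤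
      Real.exp ((2 * c - K) * Real.log n) := by
  have := fun v => isProbabilityMeasure_inclusionLaw G hc v
  have hn' : (0 : ℝ) < n := by exact_mod_cast (by omega : 0 < n)
  have hlog : 0 ≤ Real.log n := Real.log_nonneg (by exact_mod_cast (by omega : 1 ≤ n))
  let f : Fin n → Bool → ℝ := fun v b => Real.exp (if b then (G.degree v : ℝ) / n else 0)
  have hf : ∀ b : Fin n → Bool, ∏ v, f v (b v) =
      Real.exp ((∑ v, if b v then (G.degree v : ℝ) else 0) / n) := by
    intro b
    rw [← Real.exp_sum, Finset.sum_div]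
    congr 1
    exact Finset.sum_congr rfl fun v _ => by split_ifs <;> simp
  have hint : ∀ v, ∫ b, f v b ∂(inclusionLaw G c v) ≤ Real.exp (2 * (c * Real.log n) / n) := by
    intro v
    obtain ⟨h0, h1, h2⟩ := inclusionProb_mem hc (Nat.one_le_of_lt v.2) (G.degree v)
    obtain ⟨p, hp⟩ : ∃ p, p = inclusionProb c n (G.degree v) := ⟨_, rfl⟩
    rw [← hp] at h0 h1 h2
    have hfin : ∀ (x : ℝ) (b : Bool), IsFiniteMeasure (ENNReal.ofReal x • Measure.dirac b) :=
      fun x b => Measure.smul_finite _ ENNReal.ofReal_ne_top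
    have hval : ∫ b, f v b ∂(inclusionLaw G c v) =
        p * Real.exp ((G.degree v : ℝ) / n) + (1 - p) := by
      rw [inclusionLaw, ← hp, integral_add_measure Integrable.of_finite Integrable.of_finite,
        integral_smul_measure, integral_smul_measure, integral_dirac, integral_dirac,
        ENNReal.toReal_ofReal h0, ENNReal.toReal_ofReal (by linarith)]
      simp [f]
    have hx0 : 0 ≤ (G.degree v : ℝ) / n := by positivity
    have hx1 : (G.degree v : ℝ) / n ≤ 1 := by
      rw [div_le_one hn']
      exact_mod_cast degree_le_of_fin v
    have hexp : Real.exp ((G.degree v : ℝ) / n) - 1 ≤ 2 * ((G.degree v : ℝ) / n) := by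
      have := Real.abs_exp_sub_one_le (x := (G.degree v : ℝ) / n) (by rwa [abs_of_nonneg hx0])
      rw [abs_of_nonneg hx0] at this
      exact (le_abs_self _).trans this
    rw [hval]
    have h3 : p * (Real.exp ((G.degree v : ℝ) / n) - 1) ≤ p * (2 * ((G.degree v : ℝ) / n)) :=
      mul_le_mul_of_nonneg_left hexp h0
    have h4 : p * (2 * ((G.degree v : ℝ) / n)) ≤ 2 * (c * Real.log n) / n := by
      rw [show p * (2 * ((G.degree v : ℝ) / n)) = 2 * (p * G.degree v) / n by ring]
      gcongr
    have h5 := Real.add_one_le_exp (2 * (c * Real.log n) / n)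
    linarith
  have hprod : ∫ b, ∏ v, f v (b v) ∂(Measure.pi fun v => inclusionLaw G c v) ≤
      Real.exp (2 * (c * Real.log n)) := by
    rw [integral_fintype_prod_eq_prod]
    refine (Finset.prod_le_prod (fun v _ => integral_nonneg fun b => (Real.exp_pos _).le)
      fun v _ => hint v).trans ?_
    rw [Finset.prod_const, Finset.card_univ, Fintype.card_fin, ← Real.exp_nat_mul]
    rw [mul_div_cancel₀ _ hn'.ne']
  have hmarkov := mul_meas_ge_le_integral_of_nonneg
    (μ := Measure.pi fun v => inclusionLaw G c v) (f := fun b => ∏ v, f v (b v))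
    (ae_of_all _ fun b => Finset.prod_nonneg fun v _ => (Real.exp_pos _).le) Integrable.of_finite
    (Real.exp (K * Real.log n))
  have hsub : {b : Fin n → Bool | K * (n * Real.log n) ≤
      ∑ v, if b v then (G.degree v : ℝ) else 0} ⊆
      {b | Real.exp (K * Real.log n) ≤ ∏ v, f v (b v)} := by
    intro b hb
    rw [Set.mem_ofPred_eq] at hb
    rw [Set.mem_ofPred_eq, hf, Real.exp_le_exp, le_div_iff₀ hn']
    linarith
  have h1 := measureReal_mono (μ := Measure.pi fun v => inclusionLaw G c v) hsub
  have h2 : Real.exp (K * Real.log n) * Real.exp ((2 * c - K) * Real.log n) =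
      Real.exp (2 * (c * Real.log n)) := by
    rw [← Real.exp_add]; congr 1; ring
  refine h1.trans (le_of_mul_le_mul_left ?_ (Real.exp_pos (K * Real.log n)))
  rw [h2]
  exact hmarkov.trans hprod

end Probability

/-! ### Union bounds, word length, and the choice of constants. -/

section HighProbability

variable {n : ℕ} (G : SimpleGraph (Fin n)) [DecidableRel G.Adj] {c : ℝ} {t : ℕ}

lemma goodSamples_failure (ht : 0 < t) {θ : ℝ} (hθ : 0 ≤ θ) :
    (Measure.pi fun v => Measure.pi fun _ : Fin t => neighborLaw G v).real
      {σ | ¬ GoodSamples G θ σ} ≤ (n : ℝ) ^ 2 * (2 * Real.exp (-2 * θ ^ 2 * t)) := by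
  have hsub : {σ | ¬ GoodSamples G θ σ} ⊆ ⋃ x : Fin n × Fin n,
      {σ : Fin n → Fin t → Fin n | θ * (t * G.degree x.1) <
        |(G.degree x.1 : ℝ) * (∑ i, if G.Adj x.2 (σ x.1 i) then 1 else 0) -
        t * ((G.neighborFinset x.1 ∩ G.neighborFinset x.2).card : ℝ)|} := by
    intro σ hσ
    rw [Set.mem_ofPred_eq, GoodSamples] at hσ
    push Not at hσ
    obtain ⟨u, w, h⟩ := hσ
    exact Set.mem_iUnion.2 ⟨(u, w), h⟩
  refine (measureReal_mono hsub).trans ((measureReal_iUnion_fintype_le _).trans ?_)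
  refine (Finset.sum_le_sum fun x _ => samples_deviation G ht hθ x.1 x.2).trans (le_of_eq ?_)
  rw [Finset.sum_const, Finset.card_univ, Fintype.card_prod, Fintype.card_fin, nsmul_eq_mul,
    Nat.cast_mul, ← sq]

lemma hitsDense_failure (hc : 0 < c) (hn : 2 ≤ n) {θ : ℝ} (hθ0 : 0 ≤ θ) (hθ : θ ≤ 1 / 1000) :
    (Measure.pi fun v => inclusionLaw G c v).real {b | ¬ HitsDense G θ b} ≤
      n * Real.exp (-(c * Real.log n / 4)) := by
  classical
  have := fun v => isProbabilityMeasure_inclusionLaw G hc v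
  have hsub : {b | ¬ HitsDense G θ b} ⊆ ⋃ v ∈ Finset.univ.filter fun v => ¬ IsSparseVertex G θ v,
      {b : Fin n → Bool | ∀ w ∈ similarNbrs G θ v, b w = false} := by
    intro b hb
    rw [Set.mem_ofPred_eq, HitsDense] at hb
    push Not at hb
    obtain ⟨v, hv, h⟩ := hb
    simp only [Set.mem_iUnion]
    exact ⟨v, by simpa using hv, fun w hw => by simpa using h w hw⟩
  refine (measureReal_mono hsub (measure_ne_top _ _)).trans ((measureReal_biUnion_finset_le _ _).trans ?_)
  refine (Finset.sum_le_sum fun v hv =>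
    hits_failure G hc hn hθ0 hθ (Finset.mem_filter.1 hv).2).trans ?_
  rw [Finset.sum_const, nsmul_eq_mul]
  gcongr
  exact_mod_cast (Finset.card_le_univ _).trans (Fintype.card_fin n).le

/-- The samples are good with high probability. -/
lemma samplingLaw_failure (hc : 0 < c) (hn : 2 ≤ n) (ht : 0 < t) {θ : ℝ} (hθ0 : 0 ≤ θ)
    (hθ : θ ≤ 1 / 1000) (K : ℝ) :
    1 - ((n : ℝ) ^ 2 * (2 * Real.exp (-2 * θ ^ 2 * t)) + n * Real.exp (-(c * Real.log n / 4)) +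
      Real.exp ((2 * c - K) * Real.log n)) ≤
    (samplingLaw G c t).real {ω | GoodSamples G θ ω.1 ∧ HitsDense G θ ω.2 ∧
      (∑ v, if ω.2 v then (G.degree v : ℝ) else 0) < K * (n * Real.log n)} := by
  have := fun v => isProbabilityMeasure_inclusionLaw G hc v
  have hP : IsProbabilityMeasure (samplingLaw G c t) := by unfold samplingLaw; infer_instance
  have h1 : (samplingLaw G c t).real (Prod.fst ⁻¹' {σ | ¬ GoodSamples G θ σ}) ≤ _ :=
    ((measurePreserving_fst (μ := Measure.pi fun v => Measure.pi fun _ : Fin t => neighborLaw G v)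
      (ν := Measure.pi fun v => inclusionLaw G c v)).measureReal_preimage
      (Set.toFinite _).measurableSet.nullMeasurableSet).trans_le (goodSamples_failure G ht hθ0)
  have hsnd := fun s : Set (Fin n → Bool) =>
    (measurePreserving_snd (μ := Measure.pi fun v => Measure.pi fun _ : Fin t => neighborLaw G v)
      (ν := Measure.pi fun v => inclusionLaw G c v)).measureReal_preimage
      (Set.toFinite s).measurableSet.nullMeasurableSet
  have h2 : (samplingLaw G c t).real (Prod.snd ⁻¹' {b | ¬ HitsDense G θ b}) ≤ _ :=
    (hsnd _).trans_le (hitsDense_failure G hc hn hθ0 hθ)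
  have h3 : (samplingLaw G c t).real (Prod.snd ⁻¹'
      {b | K * (n * Real.log n) ≤ ∑ v, if b v then (G.degree v : ℝ) else 0}) ≤ _ :=
    (hsnd _).trans_le (sampledDegrees_tail G hc hn K)
  have hcompl := probReal_compl_eq_one_sub (μ := samplingLaw G c t)
    (s := {ω | GoodSamples G θ ω.1 ∧ HitsDense G θ ω.2 ∧
      (∑ v, if ω.2 v then (G.degree v : ℝ) else 0) < K * (n * Real.log n)})
    (Set.toFinite _).measurableSet
  have hsub : {ω : (Fin n → Fin t → Fin n) × (Fin n → Bool) | GoodSamples G θ ω.1 ∧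
      HitsDense G θ ω.2 ∧ (∑ v, if ω.2 v then (G.degree v : ℝ) else 0) < K * (n * Real.log n)}ᶜ ⊆
      (Prod.fst ⁻¹' {σ | ¬ GoodSamples G θ σ} ∪ Prod.snd ⁻¹' {b | ¬ HitsDense G θ b}) ∪
      Prod.snd ⁻¹' {b | K * (n * Real.log n) ≤ ∑ v, if b v then (G.degree v : ℝ) else 0} := by
    intro ω hω
    rw [Set.mem_compl_iff, Set.mem_ofPred_eq] at hω
    by_cases ha : GoodSamples G θ ω.1
    · by_cases hb : HitsDense G θ ω.2
      · exact Or.inr (not_lt.1 fun h => hω ⟨ha, hb, h⟩)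
      · exact Or.inl (Or.inr hb)
    · exact Or.inl (Or.inl ha)
  have h4 := (measureReal_mono (μ := samplingLaw G c t) hsub).trans
    ((measureReal_union_le _ _).trans (add_le_add_left (measureReal_union_le _ _) _))
  linarith

/-- All numbers that occur are at most `D N²`, where `N = 2 ^ (Nat.log 2 n + 1)` exceeds `n`. A word
length of `(D + 2) (Nat.log 2 n + 1)` suffices, since `2 ^ w = N ^ D N²` and `N ^ D ≥ 2 ^ D > D`. -/
lemma exists_wordBound (M A : ℕ) : ∃ κ : ℕ, ∀ n t : ℕ, t ≤ A * n →
    WordBound (κ * (Nat.log 2 n + 1)) n t M ((n + t + 3) * (n + t + 3)) := by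
  refine ⟨((A + 4) * (A + 4) + A + 14 + (2 * M + 2) * (A + 1)) + 2, fun n t ht => ?_⟩
  generalize hD : (A + 4) * (A + 4) + A + 14 + (2 * M + 2) * (A + 1) = D
  obtain ⟨N, hN⟩ : ∃ N, N = 2 ^ (Nat.log 2 n + 1) := ⟨_, rfl⟩
  have hnN : n + 1 ≤ N := hN ▸ Nat.lt_pow_succ_log_self (by norm_num) n
  have hN2 : 2 ≤ N := by
    rw [hN, pow_succ]
    have := Nat.one_le_two_pow (n := Nat.log 2 n)
    omega
  have hpow : D * (N * N) < 2 ^ ((D + 2) * (Nat.log 2 n + 1)) := by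
    rw [mul_comm (D + 2), pow_mul, ← hN, pow_add, sq]
    exact Nat.mul_lt_mul_of_pos_right
      (Nat.lt_two_pow_self.trans_le (Nat.pow_le_pow_left hN2 D)) (by positivity)
  have htN : t ≤ A * N := ht.trans (Nat.mul_le_mul_left _ (by omega))
  have hNN : N ≤ N * N := Nat.le_mul_self N
  refine ⟨lt_of_le_of_lt ?_ hpow, lt_of_le_of_lt ?_ hpow, by nlinarith⟩
  · have h1 : n + t + 3 ≤ (A + 4) * N := by nlinarith
    have h2 := Nat.mul_le_mul h1 h1
    have h3 : A * N ≤ A * (N * N) := Nat.mul_le_mul_left _ hNN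
    have h4 : (A + 4) * (A + 4) + A + 14 ≤ D := by omega
    have h5 := Nat.mul_le_mul_right (N * N) h4
    nlinarith
  · have h1 : t + 1 ≤ (A + 1) * N := by nlinarith
    have h2 := Nat.mul_le_mul (Nat.mul_le_mul_left (2 * M + 2) hnN) h1
    have h3 : (2 * M + 2) * (A + 1) ≤ D := by omega
    have h4 := Nat.mul_le_mul_right (N * N) h3
    nlinarith

lemma half_le_log {n : ℕ} (hn : 2 ≤ n) : 1 / 2 ≤ Real.log n := by
  have h1 := Real.log_two_gt_d9
  have h2 : Real.log 2 ≤ Real.log n := Real.log_le_log (by norm_num) (by exact_mod_cast hn)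
  linarith

lemma sampleCount_pos {ε : ℝ} (hc : 0 < c) (hε : 0 < ε) (hn : 2 ≤ n) : 0 < sampleCount c ε n := by
  have := half_le_log hn
  exact Nat.ceil_pos.2 (by positivity)

lemma sampleCount_lt {ε : ℝ} (hc : 0 < c) (hn : 2 ≤ n) :
    (sampleCount c ε n : ℝ) < c / ε ^ 2 * Real.log n + 1 := by
  have := half_le_log hn
  rw [← mul_div_right_comm]
  exact Nat.ceil_lt_add_one (by positivity)

lemma exp_mul_log_eq {n : ℕ} (hn : 2 ≤ n) (m : ℕ) :
    Real.exp (-(m * Real.log n)) = 1 / (n : ℝ) ^ m := by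
  have hn' : (0 : ℝ) < n := by exact_mod_cast (by omega : 0 < n)
  rw [Real.exp_neg, ← Real.log_pow, Real.exp_log (by positivity), one_div]

/-- The exponents are chosen so that each summand is at most `2 n ^ (-k - 2)`; the total `4 n ^ (-k
- 2)` is at most `n ^ (-k)` because `n ≥ 2`. -/
lemma failure_le {n k : ℕ} (hn : 2 ≤ n) {x y z : ℝ} (hx : (k + 4 : ℝ) * Real.log n ≤ x)
    (hy : (k + 3 : ℝ) * Real.log n ≤ y) (hz : (k + 2 : ℝ) * Real.log n ≤ z) :
    (n : ℝ) ^ 2 * (2 * Real.exp (-x)) + n * Real.exp (-y) + Real.exp (-z) ≤ 1 / (n : ℝ) ^ k := by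
  have hn' : (2 : ℝ) ≤ n := by exact_mod_cast hn
  have h1 := Real.exp_le_exp.2 (neg_le_neg hx)
  have h2 := Real.exp_le_exp.2 (neg_le_neg hy)
  have h3 := Real.exp_le_exp.2 (neg_le_neg hz)
  have e1 := exp_mul_log_eq hn (k + 4)
  have e2 := exp_mul_log_eq hn (k + 3)
  have e3 := exp_mul_log_eq hn (k + 2)
  push_cast at e1 e2 e3
  rw [e1] at h1
  rw [e2] at h2
  rw [e3] at h3
  calc _ ≤ (n : ℝ) ^ 2 * (2 * (1 / (n : ℝ) ^ (k + 4))) + n * (1 / (n : ℝ) ^ (k + 3)) +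
        1 / (n : ℝ) ^ (k + 2) := by gcongr
    _ = 4 / (n : ℝ) ^ 2 * (1 / (n : ℝ) ^ k) := by
        field_simp
        ring
    _ ≤ 1 * (1 / (n : ℝ) ^ k) := by
        gcongr
        rw [div_le_one (by positivity)]
        nlinarith
    _ = _ := one_mul _

/-- The recovery program succeeds with high probability. -/
lemma recovery_probability (k : ℕ) {η : ℝ} (hη0 : 0 < η) (hη : η ≤ 1 / 10000) :
    ∃ c : ℝ, 0 < c ∧ ∀ ε : ℝ, 0 < ε → ε < 1 → ∃ (p : Prog) (κ : ℕ) (C : ℝ), ∀ n : ℕ, 2 ≤ n →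
      ∀ (G : SimpleGraph (Fin n)) [DecidableRel G.Adj] (adj : Fin n → List (Fin n)),
        IsAdjacencyList G adj → 1 - 1 / (n : ℝ) ^ k ≤
          (samplingLaw G c (sampleCount c ε n)).real
            {ω | ComputesLabels (κ * (Nat.log 2 n + 1)) p (recoveryInput G adj ω) n
              (C * (n : ℝ) * Real.log n ^ 2)
              fun L => IsSparseDenseDecomposition G η ε (sparseOfLabels L) (cliquesOfLabels L)} := by
  -- The Hoeffding exponent `2 (η ε)² t` is at least `2 η² c log n = (k + 4) log n`. The powers of
  -- `ε` cancel, so `c` depends only on `k` once `η` is fixed.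
  obtain ⟨c, hcdef⟩ : ∃ c : ℝ, c = (k + 4) / (2 * η ^ 2) := ⟨_, rfl⟩
  have hc : 0 < c := by rw [hcdef]; positivity
  have hc1 : 2 * η ^ 2 * c = k + 4 := by rw [hcdef]; field_simp
  have hc2 : (k : ℝ) + 3 ≤ c / 4 := by
    have : η ^ 2 ≤ 1 / 100 := by nlinarith
    nlinarith
  refine ⟨c, hc, fun ε hε0 hε1 => ?_⟩
  have hθ0 : 0 < η * ε := by positivity
  have hθ : η * ε ≤ 1 / 10000 := by nlinarith
  -- The program needs an integer in place of `1 / β`. Rounding `1 / (3 θ)` down puts `1 / M`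
  -- between `3 θ` and `6 θ`.
  obtain ⟨M, hM⟩ : ∃ M : ℕ, M = ⌊1 / (3 * (η * ε))⌋₊ := ⟨_, rfl⟩
  have hlarge : 3 ≤ 1 / (3 * (η * ε)) := by
    rw [le_div_iff₀ (by positivity)]
    linarith
  have hMle : (M : ℝ) ≤ 1 / (3 * (η * ε)) := hM ▸ Nat.floor_le (by positivity)
  have hMlt : 1 / (3 * (η * ε)) < M + 1 := hM ▸ Nat.lt_floor_add_one _
  have hMpos : (0 : ℝ) < M := by linarith
  obtain ⟨A, hA⟩ := exists_nat_ge (c / ε ^ 2 + 1)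
  obtain ⟨κ, hκ⟩ := exists_wordBound M A
  -- Makes the tail bound for the total sampled degree equal to `n ^ (-k - 2)`.
  obtain ⟨K, hK⟩ : ∃ K : ℝ, K = 2 * c + k + 2 := ⟨_, rfl⟩
  have hK0 : 0 ≤ K := by rw [hK]; positivity
  refine ⟨recoveryProg M, κ, 600 * (K + 6) * (c / ε ^ 2 + 4), fun n hn G _ adj hadj => ?_⟩
  have : NeZero n := ⟨by omega⟩
  have hn' : (2 : ℝ) ≤ n := by exact_mod_cast hn
  have hlog := half_le_log hn
  have ht := sampleCount_pos hc hε0 hn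
  have ht' : (sampleCount c ε n : ℝ) < c / ε ^ 2 * Real.log n + 1 := sampleCount_lt hc hn
  have hta : c / ε ^ 2 * Real.log n ≤ sampleCount c ε n := by
    rw [div_mul_eq_mul_div]
    exact Nat.le_ceil _
  have hW := hκ n (sampleCount c ε n) (by
    have hle : Real.log n ≤ n := (Real.log_le_sub_one_of_pos (by linarith)).trans (by linarith)
    have h1 : c / ε ^ 2 * Real.log n ≤ c / ε ^ 2 * n := by gcongr
    have h2 : (c / ε ^ 2 + 1) * n ≤ A * n := by gcongr
    have h3 : (sampleCount c ε n : ℝ) ≤ A * n := by linarith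
    exact_mod_cast h3)
  have hP : IsProbabilityMeasure (samplingLaw G c (sampleCount c ε n)) := by
    have := fun v => isProbabilityMeasure_inclusionLaw G hc v
    unfold samplingLaw
    infer_instance
  have hprob := samplingLaw_failure G hc hn ht hθ0.le (hθ.trans (by norm_num)) K
  have hfail := failure_le (k := k) hn (x := 2 * (η * ε) ^ 2 * sampleCount c ε n)
    (y := c * Real.log n / 4) (z := (K - 2 * c) * Real.log n)
    (by
      calc (k + 4 : ℝ) * Real.log n = 2 * (η * ε) ^ 2 * (c / ε ^ 2 * Real.log n) := by
            rw [← hc1]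
            field_simp
        _ ≤ _ := by gcongr)
    (by nlinarith) (by rw [hK]; nlinarith)
  rw [show -(2 * (η * ε) ^ 2 * (sampleCount c ε n : ℝ)) = -2 * (η * ε) ^ 2 * sampleCount c ε n by
    ring, show -((K - 2 * c) * Real.log n) = (2 * c - K) * Real.log n by ring] at hfail
  refine le_trans (by linarith) (hprob.trans (measureReal_mono ?_))
  rintro ω ⟨hσ, hb, hsum⟩
  refine computesLabels_of_good ω hadj hη0 hη hε0 hε1.le (by exact_mod_cast hMpos) ?_ ?_ ht hW hσ hb
    ?_
  · rw [le_div_iff₀ hMpos]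
    rwa [le_div_iff₀ (by positivity), mul_comm] at hMle
  · rw [div_lt_iff₀ (by positivity)] at hMlt
    rw [div_le_iff₀ hMpos]
    nlinarith
  · push_cast
    -- The lower order terms are absorbed using `log n ≥ 1 / 2`: `2 n + 1 ≤ 6 n log n` here, and `2
    -- ≤ 4 log n` in the next bound.
    have h1 : (2 * n + 1 + ∑ v, if ω.2 v then (G.degree v : ℝ) else 0) ≤
        (K + 6) * (n * Real.log n) := by nlinarith
    have h2 : ((sampleCount c ε n : ℝ) + 1) * 600 ≤ 600 * ((c / ε ^ 2 + 4) * Real.log n) := by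
      linarith
    calc _ ≤ (K + 6) * (n * Real.log n) * (600 * ((c / ε ^ 2 + 4) * Real.log n)) := by gcongr
      _ = _ := by ring

end HighProbability

theorem mainTheorem4 :
    ∃ η₀ ε₀ : ℝ, 0 < η₀ ∧ 0 < ε₀ ∧
      -- existence of the decomposition
      (∀ ε : ℝ, 0 < ε → ε < ε₀ →
        ∀ (V : Type*) [Fintype V] [DecidableEq V] (G : SimpleGraph V) [DecidableRel G.Adj],
          ∃ (sparse : Finset V) (cliques : Finset (Finset V)),
            IsSparseDenseDecomposition G η₀ ε sparse cliques) ∧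
      -- recovery from the samples, with high probability, in time O(n log² n)
      (∀ k : ℕ, ∃ c : ℝ, 0 < c ∧
        ∀ ε : ℝ, 0 < ε → ε < ε₀ →
          ∃ (p : Prog) (κ : ℕ) (C : ℝ),
            ∀ (n : ℕ), 2 ≤ n →
              ∀ (G : SimpleGraph (Fin n)) [DecidableRel G.Adj] (adj : Fin n → List (Fin n)),
                IsAdjacencyList G adj →
                  1 - 1 / (n : ℝ) ^ k ≤
                    (samplingLaw G c (sampleCount c ε n)).real
                      {ω | ComputesLabels (κ * (Nat.log 2 n + 1)) p (recoveryInput G adj ω) n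
                        (C * (n : ℝ) * Real.log n ^ 2)
                        fun L => IsSparseDenseDecomposition G η₀ ε
                          (sparseOfLabels L) (cliquesOfLabels L)}) := by
  -- No smallness of `ε` beyond `ε < 1` is required: only `η₀ ε` has to be small, and `η₀` takes
  -- care of that.
  refine ⟨1 / 10000, 1, by norm_num, by norm_num, fun ε hε0 hε1 V _ _ G _ =>
    exists_isSparseDenseDecomposition G (by norm_num) le_rfl hε0 hε1.le, fun k =>
    recovery_probability k (by norm_num) le_rfl⟩
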